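/- **Setting.** Let $N\ge 3$, let $U\subseteq\mathbb R^4$ and $V\subseteq\mathbb R^6$ be open, $l>0$, and let $M_6,M_5,M_4\in\mathbb R$. Points of $U\times(-l,l)$ are written $x=(\chi^\mu,\tau)$, Latin indices $a,b$ run over $(\chi^\mu,\tau)$, Greek indices over the $\chi^\mu$, and capital indices over the coordinates of $V$. Signature is $(-,+,\dots,+)$. For $0<\rho<l$ let $g^{(\rho)}$ be a Lorentzian metric of class $C^N$ on $V$, let $\varphi^{(\rho)}:U\times(-l,l)\to V$ be an injective map of class $C^N$ whose induced metric $\hat g_{ab}$ is in Gaussian normal form, $\hat g_{\tau\tau}=1$, $\hat g_{\tau\mu}=0$, with $\hat g_{\mu\nu}$ Lorentzian on every leaf $\tau=\text{const}$, and let $n^{(\rho)}$ be its unit normal field, such that the sign of $\det(\partial_a\varphi^{(\rho)},n^{(\rho)})$ is the same for all $\rho$ and $x$. Let $g$ be a $C^N$ Lorentzian metric on $V$ and $\varphi:U\times(-l,l)\to V$ a map which is $C^N$ in $\chi$ for each fixed $\tau$ and $C^N$ jointly where $\tau\ne0$, with Lorentzian induced metrics on all leaves, and with unit normal $n$ for $\tau\neq0$,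 of that same orientation sign. Assume, for $\rho\to0^+$: * $g^{(\rho)}\to g$ in $C^N$: all derivatives of order $\le N$ converge uniformly on $V$. * All derivatives of $\varphi^{(\rho)}$ of order $\le N$ converge to those of $\varphi$ uniformly on $\rho\le|\tau|<l$ (that is, $\sup_{\chi\in U,\ \rho\le|\tau|<l}|\partial^\alpha\varphi^{(\rho)}-\partial^\alpha\varphi|\to0$), and their values at $(\chi,\rho)$ and at $(\chi,-\rho)$ have finite limits for each $\chi$. * All derivatives with respect to the $\chi^\mu$ only, of order $\le N$, converge uniformly on $U\times(-l,l)$ to those of $\varphi$, and are Lipschitz on $U\times(-l,l)$ with one constant for all small $\rho$. * For every $\chi\in U$, $\int_{-\rho}^{\rho}\big|n^{(\rho)}_L\,\partial_\tau^2\varphi^{(\rho)L}\big|\,d\tau$ has a finite limit. * No cusp: $n_+\ne-n_-$ at every $\chi\in U$. Here and below a subscript $\pm$ denotes the one-sided limit $\tau\to0^\pm$ of a quantity of the limit configuration; $N_\pm$ and $n_\pm$ are these limits of $\partial_\tau\varphi$ and $n$, and $[X]_\pm=X_+-X_-$. **Notation.** $G_{ab}$ is the Einstein tensor of the metric $\hat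 g_{ab}$ induced on the brane, $\tilde K_{ab}=n_L\big(\partial_a\partial_b\varphi^L+\Gamma^L_{AB}\,\partial_a\varphi^A\partial_b\varphi^B\big)$ is its extrinsic curvature, $\tilde K=\hat g^{ab}\tilde K_{ab}$, and $$E^{(\rho)}_{ab}=2M_6^4\big(\tilde K_{ab}-\hat g_{ab}\tilde K\big)+M_5^3\,G_{ab}$$ is formed with $g^{(\rho)},\varphi^{(\rho)},n^{(\rho)}$; $E_{ab}$ is the same expression for $g,\varphi,n$. On the codimension-2 brane $\tau=0$ of the limit configuration, $\bar g_{\mu\nu}$ is the induced metric, $\bar G_{\mu\nu}$ its Einstein tensor, $\bar K_{\mu\nu}|_\pm$ are the one-sided limits of the extrinsic curvature of the leaves $\tau=\text{const}$ in the codimension-1 brane with respect to the unit normal $\partial_\tau$, computed as for $\tilde K_{ab}$, and $\bar K=\bar g^{\mu\nu}\bar K_{\mu\nu}$. The oriented dihedral angle is $$\Omega=-\operatorname{sgn}\langle N_-,n_+\rangle\,\arccos\langle n_-,n_+\rangle .$$ In the plane normal to the codimension-2 brane, let $\vartheta=\inf\{\theta>0:\cos\theta\,N_++\sin\theta\,n_+=-N_-\}$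 be the angle of the sector between the two faces into which the normal points; $\Delta=2\pi-2\vartheta$ is the deficit angle of two copies of the sector glued along their faces. **Theorem.** 1. The limits $N_\pm$, $n_\pm$, $\bar K_{\mu\nu}|_\pm$ exist at every $\chi\in U$. 2. $\Delta=2\Omega$. 3. For all $\chi\in U$ and all $\mu,\nu$, $$\lim_{\rho\to0^+}\int_{-\rho}^{\rho}E^{(\rho)}_{\mu\nu}(\chi,\tau)\,d\tau=-2M_6^4\,\Omega\,\bar g_{\mu\nu}+M_5^3\big[\bar K_{\mu\nu}-\bar g_{\mu\nu}\bar K\big]_\pm .$$ 4. At every $X\in V$ at which the Einstein tensor of $g^{(\rho)}$ vanishes for all sufficiently small $\rho$, the Einstein tensor of $g$ vanishes. 5. Suppose the Israel junction conditions $E^{(\rho)}_{ab}=T^{(\rho)}_{ab}$ hold for all $0<\rho<l$, with $T^{(\rho)}_{ab}=0$ for $|\tau|>\rho$. Then: * $E_{ab}=0$ for $\tau\ne0$. * If $\int_{-\rho}^{\rho}T^{(\rho)}_{\mu\nu}\,d\tau=\bar T_{\mu\nu}(\chi)$ for all $\rho$, the codimension-2 junction conditions hold on $U$: $$-2M_6^4\,\Omega\,\bar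 g_{\mu\nu}+M_5^3\big[\bar K_{\mu\nu}-\bar g_{\mu\nu}\bar K\big]_\pm=\bar T_{\mu\nu},\qquad -M_6^4\,\Delta\,\bar g_{\mu\nu}+M_5^3\big[\bar K_{\mu\nu}-\bar g_{\mu\nu}\bar K\big]_\pm=\bar T_{\mu\nu}.$$ * (Cascading DGP.) If instead the source includes a 4D induced-gravity term, $\int_{-\rho}^{\rho}T^{(\rho)}_{\mu\nu}\,d\tau=\bar T_{\mu\nu}-M_4^2\,\bar G_{\mu\nu}$ for all $\rho$, then on $U$ $$-M_6^4\,\Delta\,\bar g_{\mu\nu}+M_5^3\big[\bar K_{\mu\nu}-\bar g_{\mu\nu}\bar K\big]_\pm+M_4^2\,\bar G_{\mu\nu}=\bar T_{\mu\nu},$$ and if in addition the brane is $\mathbb Z_2$-symmetric about $\tau=0$, i.e. the induced leaf metric satisfies $\hat g_{\mu\nu}(\chi,-\tau)=\hat g_{\mu\nu}(\chi,\tau)$, then, with $[\ ]_+$ denoting the limit $\tau\to0^+$, $$-M_6^4\,\Delta\,\bar g_{\mu\nu}+2M_5^3\big[\bar K_{\mu\nu}-\bar g_{\mu\nu}\bar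 K\big]_++M_4^2\,\bar G_{\mu\nu}=\bar T_{\mu\nu}.$$ Together with item 4 and $E_{ab}=0$ for $\tau\neq0$ these are the thin-limit equations of the Cascading DGP model. -/

import Mathlib

open Filter Topology Set
open scoped NNReal Matrix

noncomputable section

/-! ### Tensor calculus in a coordinate chart -/

/-- The partial derivative `∂ᵢ f` of a function of `d` real coordinates. -/
def pd {d : ℕ} {F : Type*} [NormedAddCommGroup F] [NormedSpace ℝ F]
    (i : Fin d) (f : (Fin d → ℝ) → F) (x : Fin d → ℝ) : F :=
  lineDeriv ℝ f x (Pi.single i 1)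

/-- The components `g_{AB}(X)` of a metric in a chart with `d` coordinates. -/
abbrev MetricField (d : ℕ) := (Fin d → ℝ) → Fin d → Fin d → ℝ

/-- A symmetric bilinear form of signature `(-, +, …, +)`: it is congruent to
`diag(-1, 1, …, 1)`. -/
def IsLorentzian {d : ℕ} (h : Fin (d + 1) → Fin (d + 1) → ℝ) : Prop :=
  ∃ P : Matrix (Fin (d + 1)) (Fin (d + 1)) ℝ, IsUnit P.det ∧
    Pᵀ * Matrix.of h * P = Matrix.diagonal (Fin.cons (-1) fun _ => 1)

/-- The scalar product `g_{AB} v^A w^B`. -/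
def metricInner {d : ℕ} (h : Fin d → Fin d → ℝ) (v w : Fin d → ℝ) : ℝ :=
  ∑ A, ∑ B, h A B * v A * w B

/-- The inverse metric `g^{AB}`. -/
def invMetric {d : ℕ} (h : Fin d → Fin d → ℝ) (A B : Fin d) : ℝ :=
  (Matrix.of h)⁻¹ A B

/-- The Christoffel symbols `Γ^L_{AB}` of the Levi-Civita connection. -/
def christoffel {d : ℕ} (g : MetricField d) (X : Fin d → ℝ) (L A B : Fin d) : ℝ :=
  (1 / 2) * ∑ M, invMetric (g X) L M *
    (pd A (fun Y => g Y M B) X + pd B (fun Y => g Y M A) X - pd M (fun Y => g Y A B) X)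

/-- The Ricci tensor
`R_{AB} = ∂_L Γ^L_{AB} - ∂_B Γ^L_{AL} + Γ^L_{LM} Γ^M_{AB} - Γ^L_{BM} Γ^M_{AL}`. -/
def ricci {d : ℕ} (g : MetricField d) (X : Fin d → ℝ) (A B : Fin d) : ℝ :=
  ∑ L, (pd L (fun Y => christoffel g Y L A B) X - pd B (fun Y => christoffel g Y L A L) X
    + ∑ M, (christoffel g X L L M * christoffel g X M A B
      - christoffel g X L B M * christoffel g X M A L))

/-- The scalar curvature `g^{AB} R_{AB}`. -/
def scalarCurv {d : ℕ} (g : MetricField d) (X : Fin d → ℝ) : ℝ :=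
  ∑ A, ∑ B, invMetric (g X) A B * ricci g X A B

/-- The Einstein tensor `G_{AB} = R_{AB} - (1/2) R g_{AB}`. -/
def einstein {d : ℕ} (g : MetricField d) (X : Fin d → ℝ) (A B : Fin d) : ℝ :=
  ricci g X A B - (1 / 2) * scalarCurv g X * g X A B

/-- The metric `g_{AB}|_f ∂ₐ f^A ∂_b f^B` induced by a parametrised submanifold `f`. -/
def inducedMetric {m d : ℕ} (g : MetricField d) (f : (Fin m → ℝ) → (Fin d → ℝ)) :
    MetricField m :=
  fun x a b => metricInner (g (f x)) (pd a f x) (pd b f x)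

/-- The extrinsic curvature `K_{ab} = n_L (∂ₐ ∂_b f^L + Γ^L_{AB}|_f ∂ₐ f^A ∂_b f^B)` at `x` of
the hypersurface `f` with unit normal vector `n` at `f x`. -/
def extrinsicCurvature {m d : ℕ} (g : MetricField d) (f : (Fin m → ℝ) → (Fin d → ℝ))
    (n : Fin d → ℝ) (x : Fin m → ℝ) (a b : Fin m) : ℝ :=
  metricInner (g (f x)) n fun L =>
    pd a (pd b f) x L + ∑ A, ∑ B, christoffel g (f x) L A B * pd a f x A * pd b f x B

/-- `K_{ab} - h_{ab} tr K`, the trace being taken with the metric `h`. -/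
def traceReversed {d : ℕ} (h K : Fin d → Fin d → ℝ) (a b : Fin d) : ℝ :=
  K a b - h a b * ∑ c, ∑ e, invMetric h c e * K c e

/-- `n` is a unit (space-like) vector at `f x` normal to the hypersurface `f`, and the frame
`(∂₀ f, …, ∂_{m-1} f, n)` has the orientation given by the sign of `ε`. -/
structure IsOrientedUnitNormal {m : ℕ} (ε : ℝ) (g : MetricField (m + 1))
    (f : (Fin m → ℝ) → (Fin (m + 1) → ℝ)) (x : Fin m → ℝ) (n : Fin (m + 1) → ℝ) : Prop where
  normal : ∀ a, metricInner (g (f x)) n (pd a f x) = 0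
  unit : metricInner (g (f x)) n n = 1
  oriented : 0 < ε * (Matrix.of
    (Fin.snoc (α := fun _ => Fin (m + 1) → ℝ) (fun a => pd a f x) n)).det

/-! ### The codimension-1 brane in Gaussian normal coordinates -/

/-- The index of the coordinate `τ` among the coordinates `(χ⁰, χ¹, χ², χ³, τ)`. -/
abbrev iτ : Fin 5 := Fin.last 4

/-- The point with coordinates `(χ, τ)`. -/
def gnc (χ : Fin 4 → ℝ) (τ : ℝ) : Fin 5 → ℝ := Fin.snoc χ τ

/-- The coordinate domain `U × (-l, l)`. -/
def slab (U : Set (Fin 4 → ℝ)) (l : ℝ) : Set (Fin 5 → ℝ) :=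
  {x | Fin.init x ∈ U ∧ |x iτ| < l}

/-- The four-dimensional leaf `χ ↦ φ (χ, τ)`. -/
def leaf (φ : (Fin 5 → ℝ) → (Fin 6 → ℝ)) (τ : ℝ) (χ : Fin 4 → ℝ) : Fin 6 → ℝ := φ (gnc χ τ)

/-- The partial derivatives of order `k` of `φ` with respect to the coordinates `χ` only,
as a multilinear map. -/
def parDeriv (k : ℕ) (φ : (Fin 5 → ℝ) → (Fin 6 → ℝ)) (x : Fin 5 → ℝ) :=
  iteratedFDeriv ℝ k (leaf φ (x iτ)) (Fin.init x)

/-- The left-hand side of the Israel junction conditions,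
`2 M₆⁴ (K_{ab} - g_{ab} K) + M₅³ G_{ab}`, for the brane `φ` with unit normal field `n` in the
bulk metric `g`. -/
def israelLHS (M₆ M₅ : ℝ) (g : MetricField 6) (φ n : (Fin 5 → ℝ) → (Fin 6 → ℝ))
    (x : Fin 5 → ℝ) (a b : Fin 5) : ℝ :=
  2 * M₆ ^ 4 * traceReversed (inducedMetric g φ x) (extrinsicCurvature g φ (n x) x) a b
    + M₅ ^ 3 * einstein (inducedMetric g φ) x a b

/-! ### Quantities at the codimension-2 brane `τ = 0`

Below, the filter `F` is `𝓝[>] 0` or `𝓝[<] 0` and selects the side of the brane. -/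

/-- The one-sided limit of the tangent vector `∂_τ φ`. -/
def tangentSide (φ : (Fin 5 → ℝ) → (Fin 6 → ℝ)) (F : Filter ℝ) (χ : Fin 4 → ℝ) : Fin 6 → ℝ :=
  limUnder F fun τ => pd iτ φ (gnc χ τ)

/-- The one-sided limit of the normal vector `n`. -/
def normalSide (n : (Fin 5 → ℝ) → (Fin 6 → ℝ)) (F : Filter ℝ) (χ : Fin 4 → ℝ) : Fin 6 → ℝ :=
  limUnder F fun τ => n (gnc χ τ)

/-- The metric induced on the codimension-2 brane. -/
def cod2Metric (g : MetricField 6) (φ : (Fin 5 → ℝ) → (Fin 6 → ℝ)) : MetricField 4 :=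
  inducedMetric g (leaf φ 0)

/-- The extrinsic curvature of the leaf of constant `τ` in the codimension-1 brane with its
induced metric, the unit normal of the leaf being `∂_τ`. -/
def leafCurvature (g : MetricField 6) (φ : (Fin 5 → ℝ) → (Fin 6 → ℝ)) (χ : Fin 4 → ℝ) (τ : ℝ) :
    Fin 4 → Fin 4 → ℝ :=
  extrinsicCurvature (inducedMetric g φ) (fun χ' => gnc χ' τ) (Pi.single iτ 1) χ

/-- The one-sided limit of the extrinsic curvature at the codimension-2 brane. -/
def cod2Curvature (g : MetricField 6) (φ : (Fin 5 → ℝ) → (Fin 6 → ℝ)) (F : Filter ℝ)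
    (χ : Fin 4 → ℝ) : Fin 4 → Fin 4 → ℝ :=
  limUnder F fun τ => leafCurvature g φ χ τ

/-- `K̄_{μν} - ḡ_{μν} K̄` on one side of the codimension-2 brane. -/
def cod2TraceReversed (g : MetricField 6) (φ : (Fin 5 → ℝ) → (Fin 6 → ℝ)) (F : Filter ℝ)
    (χ : Fin 4 → ℝ) (μ ν : Fin 4) : ℝ :=
  traceReversed (cod2Metric g φ χ) (cod2Curvature g φ F χ) μ ν

/-- The jump `[K̄_{μν} - ḡ_{μν} K̄]_±` across the codimension-2 brane. -/
def cod2Jump (g : MetricField 6) (φ : (Fin 5 → ℝ) → (Fin 6 → ℝ))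
    (χ : Fin 4 → ℝ) (μ ν : Fin 4) : ℝ :=
  cod2TraceReversed g φ (𝓝[>] 0) χ μ ν - cod2TraceReversed g φ (𝓝[<] 0) χ μ ν

/-- The oriented dihedral angle `Ω = - sgn ⟨N₋, n₊⟩ arccos ⟨n₋, n₊⟩`. -/
def orientedDihedralAngle (g : MetricField 6) (φ n : (Fin 5 → ℝ) → (Fin 6 → ℝ))
    (χ : Fin 4 → ℝ) : ℝ :=
  -(SignType.sign (metricInner (g (leaf φ 0 χ))
      (tangentSide φ (𝓝[<] 0) χ) (normalSide n (𝓝[>] 0) χ)) : ℝ)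
    * Real.arccos (metricInner (g (leaf φ 0 χ))
      (normalSide n (𝓝[<] 0) χ) (normalSide n (𝓝[>] 0) χ))

/-- The angle of the sector, in the plane normal to the codimension-2 brane, which the normal
vector points into. The sector is swept by rotating from the face `N₊` (the side `τ > 0`) towards
`n₊` until the other face `-N₋` (the side `τ < 0`) is first met. -/
def sectorAngle (φ n : (Fin 5 → ℝ) → (Fin 6 → ℝ)) (χ : Fin 4 → ℝ) : ℝ :=
  sInf {θ : ℝ | 0 < θ ∧ Real.cos θ • tangentSide φ (𝓝[>] 0) χ
    + Real.sin θ • normalSide n (𝓝[>] 0) χ = -tangentSide φ (𝓝[<] 0) χ}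

/-- The local deficit angle `Δ` of the `ℤ₂`-symmetric bulk, whose normal section consists of two
copies of the sector glued along their faces. -/
def deficitAngle (φ n : (Fin 5 → ℝ) → (Fin 6 → ℝ)) (χ : Fin 4 → ℝ) : ℝ :=
  2 * Real.pi - 2 * sectorAngle φ n χ

/-! ### The thin-limit ansatz -/

/-- The thin-limit ansatz on `U × (-l, l)`: bulk metrics `g ρ`, codimension-1 embeddings `φ ρ` in
Gaussian normal coordinates and their unit normals `n ρ`, for `0 < ρ < l`, which converge for
`ρ → 0⁺` to a ridge configuration `g₀, φ₀, n₀`. Smoothness means being of class `C^N`. -/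
structure ThinLimitAnsatz (N : ℕ) (U : Set (Fin 4 → ℝ)) (l : ℝ) (V : Set (Fin 6 → ℝ)) (ε : ℝ)
    (g : ℝ → MetricField 6) (φ n : ℝ → (Fin 5 → ℝ) → (Fin 6 → ℝ))
    (g₀ : MetricField 6) (φ₀ n₀ : (Fin 5 → ℝ) → (Fin 6 → ℝ)) : Prop where
  l_pos : 0 < l
  isOpen_U : IsOpen U
  isOpen_V : IsOpen V
  /-- The bulk metrics are smooth and Lorentzian. -/
  metric_smooth : ∀ ρ ∈ Ioo 0 l, ContDiffOn ℝ N (g ρ) V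
  metric_lorentzian : ∀ ρ ∈ Ioo 0 l, ∀ X ∈ V, IsLorentzian (g ρ X)
  /-- The codimension-1 branes are smooth, lie in the bulk chart and do not self-intersect. -/
  brane_smooth : ∀ ρ ∈ Ioo 0 l, ContDiffOn ℝ N (φ ρ) (slab U l)
  brane_mapsTo : ∀ ρ ∈ Ioo 0 l, MapsTo (φ ρ) (slab U l) V
  brane_injOn : ∀ ρ ∈ Ioo 0 l, InjOn (φ ρ) (slab U l)
  /-- The coordinates are Gaussian normal: the induced metric has `g_{ττ} = 1`, `g_{τμ} = 0`. -/
  gauss_tt : ∀ ρ ∈ Ioo 0 l, ∀ x ∈ slab U l, inducedMetric (g ρ) (φ ρ) x iτ iτ = 1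
  gauss_tm : ∀ ρ ∈ Ioo 0 l, ∀ x ∈ slab U l, ∀ μ : Fin 4,
    inducedMetric (g ρ) (φ ρ) x iτ μ.castSucc = 0
  /-- The leaves of constant `τ` are immersed with a Lorentzian induced metric. -/
  leaf_lorentzian : ∀ ρ ∈ Ioo 0 l, ∀ χ ∈ U, ∀ τ, |τ| < l →
    IsLorentzian (inducedMetric (g ρ) (leaf (φ ρ) τ) χ)
  /-- The branes are oriented by their unit normals. -/
  normal : ∀ ρ ∈ Ioo 0 l, ∀ x ∈ slab U l, IsOrientedUnitNormal ε (g ρ) (φ ρ) x (n ρ x)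
  /-- The limit metric is smooth and Lorentzian. -/
  lim_metric_smooth : ContDiffOn ℝ N g₀ V
  lim_metric_lorentzian : ∀ X ∈ V, IsLorentzian (g₀ X)
  /-- The limit brane is smooth in `χ`, and smooth away from `τ = 0`. -/
  lim_brane_smooth_par : ∀ τ, |τ| < l → ContDiffOn ℝ N (leaf φ₀ τ) U
  lim_brane_smooth : ContDiffOn ℝ N φ₀ (slab U l ∩ {x | x iτ ≠ 0})
  lim_brane_mapsTo : MapsTo φ₀ (slab U l) V
  lim_leaf_lorentzian : ∀ χ ∈ U, ∀ τ, |τ| < l → IsLorentzian (inducedMetric g₀ (leaf φ₀ τ) χ)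
  lim_normal : ∀ x ∈ slab U l, x iτ ≠ 0 → IsOrientedUnitNormal ε g₀ φ₀ x (n₀ x)
  /-- The limit configuration has no cusp: `n₊` and `n₋` are not antiparallel. -/
  no_cusp : ∀ χ ∈ U, normalSide n₀ (𝓝[>] 0) χ ≠ -normalSide n₀ (𝓝[<] 0) χ
  /-- The metrics converge in `C^N`: all derivatives of order at most `N` converge uniformly. -/
  metric_conv : ∀ k ≤ N, TendstoUniformlyOn (fun ρ X => iteratedFDeriv ℝ k (g ρ) X)
    (fun X => iteratedFDeriv ℝ k g₀ X) (𝓝[>] 0) V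
  /-- Outside the ribbon, on `ρ ≤ |τ| < l`, all derivatives of the embeddings of order at most `N`
  converge uniformly. -/
  brane_conv_ext : ∀ k ≤ N, ∀ e > 0, ∃ δ > 0, ∀ ρ ∈ Ioo 0 δ, ∀ x ∈ slab U l, ρ ≤ |x iτ| →
    ‖iteratedFDeriv ℝ k (φ ρ) x - iteratedFDeriv ℝ k φ₀ x‖ < e
  /-- The derivatives of order at most `N` have finite limits on the two sides of the ribbon. -/
  brane_lim_pos : ∀ k ≤ N, ∀ χ ∈ U, ∃ D,
    Tendsto (fun ρ => iteratedFDeriv ℝ k (φ ρ) (gnc χ ρ)) (𝓝[>] 0) (𝓝 D)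
  brane_lim_neg : ∀ k ≤ N, ∀ χ ∈ U, ∃ D,
    Tendsto (fun ρ => iteratedFDeriv ℝ k (φ ρ) (gnc χ (-ρ))) (𝓝[>] 0) (𝓝 D)
  /-- On all of `U × (-l, l)` the derivatives of order at most `N` with respect to `χ` converge
  uniformly and remain bounded in the Lipschitz norm. -/
  brane_conv_par : ∀ k ≤ N,
    TendstoUniformlyOn (fun ρ => parDeriv k (φ ρ)) (parDeriv k φ₀) (𝓝[>] 0) (slab U l)
  brane_lipschitz : ∃ C : ℝ≥0, ∀ᶠ ρ in 𝓝[>] 0, ∀ k ≤ N,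
    LipschitzOnWith C (parDeriv k (φ ρ)) (slab U l)
  /-- The integrals of `|n_L ∂_τ² φ^L|` across the ribbon have a finite limit. -/
  abs_integral : ∀ χ ∈ U, ∃ I : ℝ, Tendsto (fun ρ => ∫ τ in (-ρ)..ρ,
    |metricInner (g ρ (φ ρ (gnc χ τ))) (n ρ (gnc χ τ)) (pd iτ (pd iτ (φ ρ)) (gnc χ τ))|)
    (𝓝[>] 0) (𝓝 I)

end

/-! Only two terms of the junction conditions are unbounded in the ribbon. In Gaussian normal
coordinates the trace in `K̃_{μν} - ĝ_{μν} K̃` contains `K̃_{ττ}`, hence the normal acceleration `κ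
= n_L ∂_τ² φ^L`; and the second `τ`-derivatives in `G_{μν}` combine into the total derivative `∂_τ`
of the trace-reversed leaf curvature (`einstein_castSucc`). `israelLHS_castSucc` isolates both
terms. What remains is built from the bulk metric with its derivatives, from derivatives along the
leaves, which converge, and from `∂_τ φ` and `∂_τ ∂_μ φ`, which the uniform Lipschitz bound
controls. So the remainder is bounded and its integral over a ribbon of width `2ρ` vanishes in the
limit.

The total derivative integrates to boundary values at `τ = ±ρ`. These points lie in the region where
all derivatives of the embedding converge, so the difference tends to the jump of the leaf
curvature.

The substance is `tendsto_integral_accel`: the integral of `κ` tends to `Ω`. Project to the normal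
plane of the ridge, identified with `ℂ` so that `N₊` is `1` and `n₊` is `i`, and let `z` be the
image of `∂_τ φ`. Every cluster point of the frame `(∂_τ φ, n)` is the reference frame rotated in
this plane (`exists_ultra_frame`, `tendsto_ribbon_frame`), so `|z| → 1` and the image of `n` is
close to `i z`. The tangential part of `∂_τ² φ` is bounded (`exists_accel_sub_le`). Hence `Im
(z'/z)` equals `κ` up to an error `o(1) |κ| + O(1)`, and the bound on the integral of `|κ|` removes
that error. The limit is therefore the total turning of `z` across the ribbon.

The end values `e^{iα}` and `1` of `z` determine the turning only modulo `2π`. The integer is fixed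
by the absence of self-intersections, through Hopf's secant argument (`exists_angle_of_embedded`):
for an embedded plane arc the secant direction is a nonvanishing continuous function on the square
of parameters, so the turning along the diagonal equals that along two edges. There the secants stay
in a half plane about the bisector `e^{iα/2}`, because the ribbon is short and the exclusion of
cusps gives `|α| < π`. The projection of a line `χ = const` need not be embedded. It is replaced by
a curve in the brane along which the ridge components of the position are constant
(`exists_planar_curve`). Two points of this curve with the same projection coincide in the bulk, so
injectivity of the brane applies, and the velocity of the curve is uniformly close to `z`.

The algebra of limits is organised by `ConvJet`, which is stable under products, inverses and
composition, so that the tensors of a convergent family converge. Adjoining the limit configuration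
at the parameter `0` (`withLimit`) identifies the limits: a family which converges along a filter
containing its base point converges to its value there. Normals converge because Cramer's rule and
the orientation express them continuously by the tangent frame (`IsRidgeFrame.normal_eq`,
`IsRidgeFrame.frame_det_eq`). At the ridge the two faces differ by a rotation through `α`, which
makes `Ω = -α` and the sector angle `π + α`, hence `Δ = 2Ω`. -/

noncomputable section

/-! ### Partial derivatives -/

section PartialDerivatives

variable {d m : ℕ} {E F : Type*} [NormedAddCommGroup E] [NormedSpace ℝ E]
  [NormedAddCommGroup F] [NormedSpace ℝ F]

theorem pd_eq_fderiv {i : Fin d} {f : (Fin d → ℝ) → F} {x : Fin d → ℝ}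
    (h : DifferentiableAt ℝ f x) : pd i f x = fderiv ℝ f x (Pi.single i 1) :=
  h.lineDeriv_eq_fderiv

theorem eventuallyEq_pd {f g : (Fin d → ℝ) → F} {x : Fin d → ℝ} (i : Fin d)
    (h : f =ᶠ[𝓝 x] g) : pd i f =ᶠ[𝓝 x] pd i g := by
  filter_upwards [eventually_eventually_nhds.2 h] with y hy
  exact Filter.EventuallyEq.lineDeriv_eq hy

theorem ContDiffAt.eventually_differentiableAt {k : ℕ} {f : E → F} {x : E}
    (h : ContDiffAt ℝ (k + 1 : ℕ) f x) : ∀ᶠ y in 𝓝 x, DifferentiableAt ℝ f y := by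
  filter_upwards [h.eventually (by simp)] with y hy
  exact hy.differentiableAt (by simp)

theorem eventually_pd_eq_fderiv {k : ℕ} {f : (Fin d → ℝ) → F} {x : Fin d → ℝ} (i : Fin d)
    (h : ContDiffAt ℝ (k + 1 : ℕ) f x) :
    pd i f =ᶠ[𝓝 x] fun y => fderiv ℝ f y (Pi.single i 1) := by
  filter_upwards [h.eventually_differentiableAt] with y hy
  exact pd_eq_fderiv hy

theorem ContDiffAt.pd {k : ℕ} {f : (Fin d → ℝ) → F} {x : Fin d → ℝ} (i : Fin d)
    (h : ContDiffAt ℝ (k + 1 : ℕ) f x) : ContDiffAt ℝ k (pd i f) x := by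
  have h1 : ContDiffAt ℝ k (fun y => fderiv ℝ f y (Pi.single i 1)) x :=
    (h.fderiv_right (m := (k : WithTop ℕ∞)) (by push_cast; exact le_rfl)).clm_apply
      contDiffAt_const
  exact h1.congr_of_eventuallyEq (eventually_pd_eq_fderiv i h)

theorem pd_const (i : Fin d) (c : F) : pd i (fun _ : Fin d → ℝ => c) = fun _ => 0 := by
  funext x
  rw [pd_eq_fderiv (differentiableAt_const c)]
  simp

theorem pd_clm (i : Fin d) (L : F →L[ℝ] E) {f : (Fin d → ℝ) → F} {x : Fin d → ℝ}
    (h : DifferentiableAt ℝ f x) : pd i (fun y => L (f y)) x = L (pd i f x) := by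
  have h1 := L.hasFDerivAt.comp x h.hasFDerivAt
  simp only [Function.comp_def] at h1
  rw [pd_eq_fderiv h, pd_eq_fderiv h1.differentiableAt, h1.fderiv]; rfl

theorem pd_component (i : Fin d) {f : (Fin d → ℝ) → (Fin m → ℝ)} {x : Fin d → ℝ}
    (h : DifferentiableAt ℝ f x) (A : Fin m) : pd i (fun y => f y A) x = pd i f x A :=
  pd_clm i (ContinuousLinearMap.proj (R := ℝ) (φ := fun _ : Fin m => ℝ) A) h

theorem pd_add (i : Fin d) {f g : (Fin d → ℝ) → F} {x : Fin d → ℝ}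
    (hf : DifferentiableAt ℝ f x) (hg : DifferentiableAt ℝ g x) :
    pd i (fun y => f y + g y) x = pd i f x + pd i g x := by
  rw [pd_eq_fderiv hf, pd_eq_fderiv hg, pd_eq_fderiv (hf.fun_add hg), fderiv_fun_add hf hg]
  simp

theorem pd_sum (i : Fin d) {ι : Type*} (s : Finset ι) {f : ι → (Fin d → ℝ) → F}
    {x : Fin d → ℝ} (hf : ∀ j ∈ s, DifferentiableAt ℝ (f j) x) :
    pd i (fun y => ∑ j ∈ s, f j y) x = ∑ j ∈ s, pd i (f j) x := by
  rw [pd_eq_fderiv (DifferentiableAt.fun_sum hf), fderiv_fun_sum hf]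
  simp only [sum_apply]
  exact Finset.sum_congr rfl fun j hj => (pd_eq_fderiv (hf j hj)).symm

theorem pd_mul (i : Fin d) {f g : (Fin d → ℝ) → ℝ} {x : Fin d → ℝ}
    (hf : DifferentiableAt ℝ f x) (hg : DifferentiableAt ℝ g x) :
    pd i (fun y => f y * g y) x = pd i f x * g x + f x * pd i g x := by
  rw [pd_eq_fderiv hf, pd_eq_fderiv hg, pd_eq_fderiv (hf.fun_mul hg), fderiv_fun_mul hf hg]
  simp; ring

theorem pd_inv (i : Fin d) {f : (Fin d → ℝ) → ℝ} {x : Fin d → ℝ}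
    (hf : DifferentiableAt ℝ f x) (h0 : f x ≠ 0) :
    pd i (fun y => (f y)⁻¹) x = -(pd i f x * ((f x)⁻¹ * (f x)⁻¹)) := by
  have h1 : HasFDerivAt (fun y => (f y)⁻¹) _ x :=
    (hasDerivAt_inv h0).comp_hasFDerivAt x hf.hasFDerivAt
  rw [pd_eq_fderiv h1.differentiableAt, h1.fderiv, pd_eq_fderiv hf]
  simp
  field_simp

theorem fderiv_eq_sum_pd {f : (Fin d → ℝ) → F} {x : Fin d → ℝ}
    (h : DifferentiableAt ℝ f x) (v : Fin d → ℝ) :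
    fderiv ℝ f x v = ∑ A, v A • pd A f x := by
  conv_lhs => rw [← Finset.univ_sum_single v, map_sum]
  refine Finset.sum_congr rfl fun A _ => ?_
  rw [pd_eq_fderiv h, ← map_smul]
  congr 1
  ext B
  by_cases hB : B = A
  · subst hB; simp
  · simp [hB]

theorem pd_comp (i : Fin m) {g : (Fin d → ℝ) → F} {f : (Fin m → ℝ) → (Fin d → ℝ)}
    {x : Fin m → ℝ} (hg : DifferentiableAt ℝ g (f x)) (hf : DifferentiableAt ℝ f x) :
    pd i (fun y => g (f y)) x = ∑ A, pd i f x A • pd A g (f x) := by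
  have h1 := hg.hasFDerivAt.comp x hf.hasFDerivAt
  simp only [Function.comp_def] at h1
  rw [pd_eq_fderiv h1.differentiableAt, h1.fderiv, pd_eq_fderiv hf]
  exact fderiv_eq_sum_pd hg _

end PartialDerivatives

/-! ### Families of functions with convergent jets -/

section ConvJet

variable {ι : Type*} {d m : ℕ} {E F : Type*} [NormedAddCommGroup E] [NormedSpace ℝ E]
  [NormedAddCommGroup F] [NormedSpace ℝ F]

/-- All partial derivatives of order at most `k` of the functions `F i` at the points `x i`
have finite limits along the filter `l`. -/
def ConvJet : ℕ → Filter ι → (ι → (Fin d → ℝ) → F) → (ι → Fin d → ℝ) → Prop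
  | 0, l, f, x => (∀ᶠ i in l, ContDiffAt ℝ (0 : ℕ) (f i) (x i)) ∧
      ∃ y, Tendsto (fun i => f i (x i)) l (𝓝 y)
  | k + 1, l, f, x => (∀ᶠ i in l, ContDiffAt ℝ (k + 1 : ℕ) (f i) (x i)) ∧
      (∃ y, Tendsto (fun i => f i (x i)) l (𝓝 y)) ∧
      ∀ a, ConvJet k l (fun i => pd a (f i)) x

namespace ConvJet

variable {k : ℕ} {l : Filter ι} {f g : ι → (Fin d → ℝ) → F} {x : ι → Fin d → ℝ}

theorem contDiffAt (h : ConvJet k l f x) : ∀ᶠ i in l, ContDiffAt ℝ k (f i) (x i) := by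
  cases k with
  | zero => exact h.1
  | succ k => exact h.1

theorem tendsto (h : ConvJet k l f x) : ∃ y, Tendsto (fun i => f i (x i)) l (𝓝 y) := by
  cases k with
  | zero => exact h.2
  | succ k => exact h.2.1

theorem pd (h : ConvJet (k + 1) l f x) (a : Fin d) : ConvJet k l (fun i => pd a (f i)) x :=
  h.2.2 a

theorem of_succ (h : ConvJet (k + 1) l f x) : ConvJet k l f x := by
  induction k generalizing f with
  | zero => exact ⟨h.1.mono fun i hi => hi.of_le (by simp), h.2.1⟩
  | succ k ih =>
    refine ⟨h.1.mono fun i hi => hi.of_le ?_, h.2.1, fun a => ih (h.pd a)⟩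
    exact_mod_cast Nat.le_succ _

theorem of_le {j : ℕ} (hjk : j ≤ k) (h : ConvJet k l f x) : ConvJet j l f x := by
  induction hjk with
  | refl => exact h
  | step _ ih => exact ih h.of_succ

theorem congr (h : ConvJet k l f x) (hfg : ∀ᶠ i in l, f i =ᶠ[𝓝 (x i)] g i) :
    ConvJet k l g x := by
  induction k generalizing f g with
  | zero =>
    obtain ⟨h1, y, h2⟩ := h
    refine ⟨?_, y, h2.congr' ?_⟩
    · filter_upwards [h1, hfg] with i hi hfi using hi.congr_of_eventuallyEq hfi.symm
    · filter_upwards [hfg] with i hi using hi.self_of_nhds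
  | succ k ih =>
    obtain ⟨h1, ⟨y, h2⟩, h3⟩ := h
    refine ⟨?_, ⟨y, h2.congr' ?_⟩, fun a => ih (h3 a) ?_⟩
    · filter_upwards [h1, hfg] with i hi hfi using hi.congr_of_eventuallyEq hfi.symm
    · filter_upwards [hfg] with i hi using hi.self_of_nhds
    · filter_upwards [hfg] with i hi using eventuallyEq_pd a hi

theorem mono {l' : Filter ι} (hl : l' ≤ l) (h : ConvJet k l f x) : ConvJet k l' f x := by
  induction k generalizing f with
  | zero => exact ⟨h.1.filter_mono hl, h.2.imp fun y hy => hy.mono_left hl⟩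
  | succ k ih =>
    exact ⟨h.1.filter_mono hl, h.2.1.imp fun y hy => hy.mono_left hl, fun a => ih (h.2.2 a)⟩

theorem const (c : F) : ConvJet k l (fun _ _ => c) x := by
  induction k generalizing c with
  | zero => exact ⟨Eventually.of_forall fun i => contDiffAt_const, c, tendsto_const_nhds⟩
  | succ k ih =>
    refine ⟨Eventually.of_forall fun i => contDiffAt_const, ⟨c, tendsto_const_nhds⟩, fun a => ?_⟩
    simp only [pd_const]
    exact ih 0

theorem clm (L : F →L[ℝ] E) (h : ConvJet k l f x) : ConvJet k l (fun i y => L (f i y)) x := by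
  induction k generalizing f with
  | zero =>
    obtain ⟨h1, y, h2⟩ := h
    exact ⟨h1.mono fun i hi => L.contDiff.contDiffAt.comp (x i) hi, L y,
      (L.continuous.tendsto y).comp h2⟩
  | succ k ih =>
    obtain ⟨h1, ⟨y, h2⟩, h3⟩ := h
    refine ⟨h1.mono fun i hi => L.contDiff.contDiffAt.comp (x i) hi, ⟨L y,
      (L.continuous.tendsto y).comp h2⟩, fun a => (ih (h3 a)).congr ?_⟩
    filter_upwards [h1] with i hi
    filter_upwards [hi.eventually_differentiableAt] with y hy
    exact (pd_clm a L hy).symm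

theorem component {f : ι → (Fin d → ℝ) → (Fin m → ℝ)} (h : ConvJet k l f x) (A : Fin m) :
    ConvJet k l (fun i y => f i y A) x :=
  h.clm (ContinuousLinearMap.proj (R := ℝ) (φ := fun _ : Fin m => ℝ) A)

theorem component₂ {m' : ℕ} {f : ι → (Fin d → ℝ) → (Fin m → Fin m' → ℝ)} (h : ConvJet k l f x)
    (A : Fin m) (B : Fin m') : ConvJet k l (fun i y => f i y A B) x := by
  have h1 := h.clm (ContinuousLinearMap.proj (R := ℝ) (φ := fun _ : Fin m => Fin m' → ℝ) A)
  exact h1.component B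

theorem add (hf : ConvJet k l f x) (hg : ConvJet k l g x) :
    ConvJet k l (fun i y => f i y + g i y) x := by
  induction k generalizing f g with
  | zero =>
    obtain ⟨h1, y, h2⟩ := hf
    obtain ⟨h1', y', h2'⟩ := hg
    exact ⟨by filter_upwards [h1, h1'] with i hi hi' using hi.add hi', y + y', h2.add h2'⟩
  | succ k ih =>
    obtain ⟨h1, ⟨y, h2⟩, h3⟩ := hf
    obtain ⟨h1', ⟨y', h2'⟩, h3'⟩ := hg
    refine ⟨by filter_upwards [h1, h1'] with i hi hi' using hi.add hi', ⟨y + y', h2.add h2'⟩,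
      fun a => (ih (h3 a) (h3' a)).congr ?_⟩
    filter_upwards [h1, h1'] with i hi hi'
    filter_upwards [hi.eventually_differentiableAt, hi'.eventually_differentiableAt] with y hy hy'
    exact (pd_add a hy hy').symm

theorem sum {κ : Type*} (s : Finset κ) {f : κ → ι → (Fin d → ℝ) → F}
    (h : ∀ j ∈ s, ConvJet k l (f j) x) : ConvJet k l (fun i y => ∑ j ∈ s, f j i y) x := by
  classical
  induction s using Finset.induction_on with
  | empty => simpa using const (0 : F)
  | insert j s hj ih =>
    simp only [Finset.sum_insert hj]
    exact (h j (by simp)).add (ih fun j' hj' => h j' (by simp [hj']))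

variable {p q : ι → (Fin d → ℝ) → ℝ}

theorem mul (hf : ConvJet k l p x) (hg : ConvJet k l q x) :
    ConvJet k l (fun i y => p i y * q i y) x := by
  induction k generalizing p q with
  | zero =>
    obtain ⟨h1, y, h2⟩ := hf
    obtain ⟨h1', y', h2'⟩ := hg
    exact ⟨by filter_upwards [h1, h1'] with i hi hi' using hi.mul hi', y * y', h2.mul h2'⟩
  | succ k ih =>
    obtain ⟨y, h2⟩ := hf.tendsto
    obtain ⟨y', h2'⟩ := hg.tendsto
    refine ⟨by filter_upwards [hf.1, hg.1] with i hi hi' using hi.mul hi', ⟨y * y', h2.mul h2'⟩,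
      fun a => ((ih (hf.pd a) hg.of_succ).add (ih hf.of_succ (hg.pd a))).congr ?_⟩
    filter_upwards [hf.1, hg.1] with i hi hi'
    filter_upwards [hi.eventually_differentiableAt, hi'.eventually_differentiableAt] with y hy hy'
    exact (pd_mul a hy hy').symm

theorem const_mul (c : ℝ) (hf : ConvJet k l p x) : ConvJet k l (fun i y => c * p i y) x :=
  (const c).mul hf

theorem neg (hf : ConvJet k l p x) : ConvJet k l (fun i y => -p i y) x := by
  simpa using hf.const_mul (-1)

theorem sub (hf : ConvJet k l p x) (hg : ConvJet k l q x) :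
    ConvJet k l (fun i y => p i y - q i y) x := by
  simpa [sub_eq_add_neg] using hf.add hg.neg

theorem prod {κ : Type*} (s : Finset κ) {f : κ → ι → (Fin d → ℝ) → ℝ}
    (h : ∀ j ∈ s, ConvJet k l (f j) x) : ConvJet k l (fun i y => ∏ j ∈ s, f j i y) x := by
  classical
  induction s using Finset.induction_on with
  | empty => simpa using const (1 : ℝ)
  | insert j s hj ih =>
    simp only [Finset.prod_insert hj]
    exact (h j (by simp)).mul (ih fun j' hj' => h j' (by simp [hj']))

/-- The derivative of `1/p` is `-∂p` times the square of `1/p`, so the induction on the order closes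
on itself. The nonzero limit keeps `p` away from zero near the base points. -/
theorem inv (hf : ConvJet k l p x) {y₀ : ℝ} (h0 : y₀ ≠ 0)
    (hy : Tendsto (fun i => p i (x i)) l (𝓝 y₀)) : ConvJet k l (fun i y => (p i y)⁻¹) x := by
  have hne : ∀ᶠ i in l, p i (x i) ≠ 0 := hy.eventually_ne h0
  induction k with
  | zero =>
    exact ⟨by filter_upwards [hf.1, hne] with i hi hi' using hi.inv hi', _, hy.inv₀ h0⟩
  | succ k ih =>
    have h1 := ih hf.of_succ
    refine ⟨by filter_upwards [hf.1, hne] with i hi hi' using hi.inv hi', ⟨_, hy.inv₀ h0⟩,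
      fun a => ((hf.pd a).mul (h1.mul h1)).neg.congr ?_⟩
    filter_upwards [hf.1, hne] with i hi hi'
    filter_upwards [hi.eventually_differentiableAt, hi.continuousAt.eventually_ne hi'] with y hy hy'
    exact (pd_inv a hy hy').symm

/-- By the chain rule a first derivative of the composite is a sum of products of `∂_a f^A` with
composites `(∂_A q) ∘ f`. The latter fall under the induction hypothesis because `q` is kept
general. -/
theorem comp {q : ι → (Fin m → ℝ) → ℝ} {f : ι → (Fin d → ℝ) → (Fin m → ℝ)}
    (hq : ConvJet k l q fun i => f i (x i)) (hf : ConvJet k l f x) :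
    ConvJet k l (fun i y => q i (f i y)) x := by
  induction k generalizing q with
  | zero =>
    obtain ⟨h1, y, h2⟩ := hq
    exact ⟨by filter_upwards [h1, hf.1] with i hi hi' using hi.comp (x i) hi', y, h2⟩
  | succ k ih =>
    refine ⟨by filter_upwards [hq.1, hf.1] with i hi hi' using hi.comp (x i) hi', hq.2.1,
      fun a => ConvJet.congr (f := fun i y => ∑ A, _root_.pd a (f i) y A * _root_.pd A (q i) (f i y))
        (ConvJet.sum _ fun A _ => ?_) ?_⟩
    · exact ((hf.pd a).component A).mul (ih (hq.pd A) hf.of_succ)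
    · filter_upwards [hq.1, hf.1] with i hi hi'
      filter_upwards [hi'.eventually_differentiableAt,
        hi'.continuousAt.eventually hi.eventually_differentiableAt] with y hy hy'
      exact (pd_comp a hy' hy).symm

theorem of_contDiffAt {f : (Fin d → ℝ) → F} {x₀ : Fin d → ℝ} (hf : ContDiffAt ℝ k f x₀)
    (hx : Tendsto x l (𝓝 x₀)) : ConvJet k l (fun _ => f) x := by
  induction k generalizing f with
  | zero => exact ⟨hx.eventually (hf.eventually (by simp)), _, hf.continuousAt.tendsto.comp hx⟩
  | succ k ih =>
    exact ⟨hx.eventually (hf.eventually (by simp)), ⟨_, hf.continuousAt.tendsto.comp hx⟩,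
      fun a => ih (hf.pd a)⟩

/-- This is the bridge from the Fréchet derivatives in the ansatz to the partial derivatives in the
tensor formulas. The `j`-th derivative of `∂_a f` is the `(j+1)`-th derivative of `f`, curried on
the right and evaluated at the `a`-th basis vector, which is a continuous linear operation. -/
theorem of_iteratedFDeriv (hf : ∀ᶠ i in l, ContDiffAt ℝ k (f i) (x i))
    (h : ∀ j ≤ k, ∃ D, Tendsto (fun i => iteratedFDeriv ℝ j (f i) (x i)) l (𝓝 D)) :
    ConvJet k l f x := by
  have h0 : ∃ y, Tendsto (fun i => f i (x i)) l (𝓝 y) := by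
    obtain ⟨D, hD⟩ := h 0 (Nat.zero_le _)
    refine ⟨D 0, ?_⟩
    have := ((ContinuousMultilinearMap.apply ℝ (fun _ : Fin 0 => Fin d → ℝ) F 0).continuous.tendsto
      D).comp hD
    simpa [Function.comp_def] using this
  induction k generalizing f with
  | zero => exact ⟨hf, h0⟩
  | succ k ih =>
    have key : ∀ a : Fin d, ∀ j ≤ k, ∃ D,
        Tendsto (fun i => iteratedFDeriv ℝ j (_root_.pd a (f i)) (x i)) l (𝓝 D) := by
      intro a j hj
      obtain ⟨D, hD⟩ := h (j + 1) (by omega)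
      let L : ((Fin d → ℝ) →L[ℝ] F) →L[ℝ] F := ContinuousLinearMap.apply ℝ F (Pi.single a 1)
      let C := continuousMultilinearCurryRightEquiv' ℝ j (Fin d → ℝ) F
      refine ⟨L.compContinuousMultilinearMap (C D), ?_⟩
      have h2 : Tendsto (fun i => L.compContinuousMultilinearMap
          (C (iteratedFDeriv ℝ (j + 1) (f i) (x i)))) l
          (𝓝 (L.compContinuousMultilinearMap (C D))) := by
        have c1 : Continuous fun M : ContinuousMultilinearMap ℝ (fun _ : Fin j => Fin d → ℝ)
            ((Fin d → ℝ) →L[ℝ] F) => L.compContinuousMultilinearMap M :=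
          (ContinuousLinearMap.compContinuousMultilinearMapL ℝ (fun _ : Fin j => Fin d → ℝ)
            ((Fin d → ℝ) →L[ℝ] F) F L).continuous
        exact ((c1.comp C.continuous).tendsto D).comp hD
      refine h2.congr' ?_
      filter_upwards [hf] with i hi
      have e1 : iteratedFDeriv ℝ j (_root_.pd a (f i)) (x i)
          = iteratedFDeriv ℝ j (fun y => L (fderiv ℝ (f i) y)) (x i) :=
        ((eventually_pd_eq_fderiv a hi).iteratedFDeriv ℝ j).self_of_nhds
      have e2 := L.iteratedFDeriv_comp_left (i := j) (x := x i) (f := fderiv ℝ (f i))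
        (hi.fderiv_right (m := (k : WithTop ℕ∞)) (by push_cast; exact le_rfl))
        (by exact_mod_cast hj)
      rw [e1]
      simp only [Function.comp_def] at e2
      rw [e2, iteratedFDeriv_succ_eq_comp_right]
      congr 1
      exact C.apply_symm_apply _
    refine ⟨hf, h0, fun a => ih (hf.mono fun i hi => hi.pd a) (key a) ?_⟩
    obtain ⟨D, hD⟩ := key a 0 (Nat.zero_le _)
    refine ⟨D 0, ?_⟩
    have := ((ContinuousMultilinearMap.apply ℝ (fun _ : Fin 0 => Fin d → ℝ) F 0).continuous.tendsto
      D).comp hD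
    simpa [Function.comp_def] using this

end ConvJet

end ConvJet

end

noncomputable section

/-! ### Convergence of the tensors of a convergent family of metrics -/

/-- The family `f` has a finite limit along `l`. -/
def HasLim {ι E : Type*} [TopologicalSpace E] (l : Filter ι) (f : ι → E) : Prop :=
  ∃ y, Tendsto f l (𝓝 y)

namespace HasLim

variable {ι κ E : Type*} {l : Filter ι} {p q : ι → ℝ}

theorem mono [TopologicalSpace E] {f : ι → E} {l' : Filter ι} (hf : HasLim l f) (h : l' ≤ l) :
    HasLim l' f := hf.imp fun _ hy => hy.mono_left h

theorem congr [TopologicalSpace E] {f g : ι → E} (hf : HasLim l f) (h : f =ᶠ[l] g) :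
    HasLim l g := hf.imp fun _ hy => hy.congr' h

theorem const [TopologicalSpace E] (c : E) : HasLim l fun _ : ι => c := ⟨c, tendsto_const_nhds⟩

theorem add (hp : HasLim l p) (hq : HasLim l q) : HasLim l fun i => p i + q i :=
  let ⟨_, h⟩ := hp; let ⟨_, h'⟩ := hq; ⟨_, h.add h'⟩

theorem sub (hp : HasLim l p) (hq : HasLim l q) : HasLim l fun i => p i - q i :=
  let ⟨_, h⟩ := hp; let ⟨_, h'⟩ := hq; ⟨_, h.sub h'⟩

theorem mul (hp : HasLim l p) (hq : HasLim l q) : HasLim l fun i => p i * q i :=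
  let ⟨_, h⟩ := hp; let ⟨_, h'⟩ := hq; ⟨_, h.mul h'⟩

theorem neg (hp : HasLim l p) : HasLim l fun i => -p i :=
  let ⟨_, h⟩ := hp; ⟨_, h.neg⟩

theorem const_mul (c : ℝ) (hp : HasLim l p) : HasLim l fun i => c * p i := (const c).mul hp

theorem sum (s : Finset κ) {f : κ → ι → ℝ} (h : ∀ j, HasLim l (f j)) :
    HasLim l fun i => ∑ j ∈ s, f j i := by
  choose y hy using h
  exact ⟨_, tendsto_finsetSum s fun j _ => hy j⟩

theorem pi {d : ℕ} {f : ι → Fin d → ℝ} (h : ∀ A, HasLim l fun i => f i A) : HasLim l f := by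
  choose y hy using h
  exact ⟨y, tendsto_pi_nhds.2 hy⟩

theorem apply {d : ℕ} {f : ι → Fin d → ℝ} (h : HasLim l f) (A : Fin d) :
    HasLim l fun i => f i A :=
  let ⟨y, hy⟩ := h; ⟨y A, tendsto_pi_nhds.1 hy A⟩

theorem metricInner {d : ℕ} {h : ι → Fin d → Fin d → ℝ} {v w : ι → Fin d → ℝ}
    (hh : ∀ A B, HasLim l fun i => h i A B) (hv : ∀ A, HasLim l fun i => v i A)
    (hw : ∀ A, HasLim l fun i => w i A) :
    HasLim l fun i => _root_.metricInner (h i) (v i) (w i) :=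
  sum _ fun A => sum _ fun B => ((hh A B).mul (hv A)).mul (hw B)

/-- A number is a function on a space of dimension zero. This transfers the statements about jets to
families of plain numbers. -/
theorem convJet (hp : HasLim l p) : ConvJet 0 l (fun i _ => p i) fun _ => (0 : Fin 0 → ℝ) :=
  ⟨Eventually.of_forall fun _ => contDiffAt_const, hp⟩

end HasLim

theorem ConvJet.hasLim {ι F : Type*} [NormedAddCommGroup F] [NormedSpace ℝ F] {d k : ℕ}
    {l : Filter ι} {f : ι → (Fin d → ℝ) → F} {x : ι → Fin d → ℝ} (h : ConvJet k l f x) :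
    HasLim l fun i => f i (x i) := h.tendsto

/-- The determinants of the matrices `h i` have a nonzero limit. -/
def HasDetLim {ι : Type*} {d : ℕ} (l : Filter ι) (h : ι → Fin d → Fin d → ℝ) : Prop :=
  ∃ y, y ≠ 0 ∧ Tendsto (fun i => (Matrix.of (h i)).det) l (𝓝 y)

theorem HasDetLim.mono {ι : Type*} {d : ℕ} {l l' : Filter ι} {h : ι → Fin d → Fin d → ℝ}
    (hh : HasDetLim l h) (hl : l' ≤ l) : HasDetLim l' h :=
  hh.imp fun _ hy => ⟨hy.1, hy.2.mono_left hl⟩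

/-- Cramer's rule presents an entry of the inverse as a polynomial in the entries divided by the
determinant, the form to which closure under sums, products and reciprocals applies. -/
theorem invMetric_eq {d : ℕ} (h : Fin d → Fin d → ℝ) (A B : Fin d) :
    invMetric h A B = (Matrix.of h).det⁻¹ * ((Matrix.of h).updateRow B (Pi.single A 1)).det := by
  rw [invMetric, Matrix.inv_def, Ring.inverse_eq_inv', Matrix.smul_apply, Matrix.adjugate_apply,
    smul_eq_mul]

theorem tendsto_metricInner {ι : Type*} {d : ℕ} {l : Filter ι} {h : ι → Fin d → Fin d → ℝ}
    {v w : ι → Fin d → ℝ} {h₀ : Fin d → Fin d → ℝ} {v₀ w₀ : Fin d → ℝ}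
    (hh : Tendsto h l (𝓝 h₀)) (hv : Tendsto v l (𝓝 v₀)) (hw : Tendsto w l (𝓝 w₀)) :
    Tendsto (fun i => metricInner (h i) (v i) (w i)) l (𝓝 (metricInner h₀ v₀ w₀)) := by
  simp only [tendsto_pi_nhds] at hh hv hw
  exact tendsto_finsetSum _ fun A _ => tendsto_finsetSum _ fun B _ =>
    ((hh A B).mul (hv A)).mul (hw B)

theorem tendsto_det {ι : Type*} {d : ℕ} {l : Filter ι} {h : ι → Fin d → Fin d → ℝ}
    {h₀ : Fin d → Fin d → ℝ} (hh : Tendsto h l (𝓝 h₀)) :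
    Tendsto (fun i => (Matrix.of (h i)).det) l (𝓝 (Matrix.of h₀).det) :=
  ((continuous_id.matrix_det (A := fun M : Matrix (Fin d) (Fin d) ℝ => M)).tendsto
    (Matrix.of h₀)).comp hh

section Families

variable {ι : Type*} {l : Filter ι} {d m k : ℕ}

theorem ConvJet.det {x : ι → Fin m → ℝ} {M : ι → (Fin m → ℝ) → Matrix (Fin d) (Fin d) ℝ}
    (h : ∀ A B, ConvJet k l (fun i y => M i y A B) x) :
    ConvJet k l (fun i y => (M i y).det) x := by
  simp only [Matrix.det_apply']
  exact ConvJet.sum _ fun σ _ => (ConvJet.prod _ fun A _ => h _ _).const_mul _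

theorem ConvJet.invMetric {x : ι → Fin m → ℝ} {h : ι → (Fin m → ℝ) → Fin d → Fin d → ℝ}
    (hh : ∀ A B, ConvJet k l (fun i y => h i y A B) x) (hd : HasDetLim l fun i => h i (x i))
    (A B : Fin d) : ConvJet k l (fun i y => invMetric (h i y) A B) x := by
  obtain ⟨y, hy, ht⟩ := hd
  simp only [invMetric_eq]
  refine ((ConvJet.det (M := fun i y => Matrix.of (h i y)) hh).inv hy ht).mul
    (ConvJet.det fun C D => ?_)
  by_cases hC : C = B
  · subst hC
    simpa using ConvJet.const _
  · simpa [Matrix.updateRow_ne hC] using hh C D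

theorem HasLim.invMetric {h : ι → Fin d → Fin d → ℝ} (hh : ∀ A B, HasLim l fun i => h i A B)
    (hd : HasDetLim l h) (A B : Fin d) : HasLim l fun i => invMetric (h i) A B :=
  (ConvJet.invMetric (fun A B => (hh A B).convJet) hd A B).tendsto

variable {g : ι → MetricField d} {X : ι → Fin d → ℝ}

theorem ConvJet.christoffel (hg : ∀ A B, ConvJet (k + 1) l (fun i Y => g i Y A B) X)
    (hd : HasDetLim l fun i => g i (X i)) (L A B : Fin d) :
    ConvJet k l (fun i Y => christoffel (g i) Y L A B) X :=
  (ConvJet.sum _ fun M _ => (ConvJet.invMetric (fun A B => (hg A B).of_succ) hd L M).mul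
    ((((hg M B).pd A).add ((hg M A).pd B)).sub ((hg A B).pd M))).const_mul _

theorem ConvJet.ricci (hg : ∀ A B, ConvJet (k + 2) l (fun i Y => g i Y A B) X)
    (hd : HasDetLim l fun i => g i (X i)) (A B : Fin d) :
    ConvJet k l (fun i Y => ricci (g i) Y A B) X := by
  have h1 : ∀ L A B, ConvJet (k + 1) l (fun i Y => _root_.christoffel (g i) Y L A B) X :=
    ConvJet.christoffel hg hd
  exact ConvJet.sum _ fun L _ => (((h1 L A B).pd L).sub ((h1 L A L).pd B)).add
    (ConvJet.sum _ fun M _ => ((h1 L L M).of_succ.mul (h1 M A B).of_succ).sub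
      ((h1 L B M).of_succ.mul (h1 M A L).of_succ))

theorem ConvJet.einstein (hg : ∀ A B, ConvJet (k + 2) l (fun i Y => g i Y A B) X)
    (hd : HasDetLim l fun i => g i (X i)) (A B : Fin d) :
    ConvJet k l (fun i Y => einstein (g i) Y A B) X := by
  refine (ConvJet.ricci hg hd A B).sub (ConvJet.mul (ConvJet.const_mul _ ?_)
    ((hg A B).of_le (by omega)))
  exact ConvJet.sum _ fun C _ => ConvJet.sum _ fun D _ =>
    (ConvJet.invMetric (fun A B => (hg A B).of_le (by omega)) hd C D).mul
      (ConvJet.ricci hg hd C D)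

/-- The induced metric costs one derivative of the embedding and none of the bulk metric. The
Einstein tensor of the brane thus needs three derivatives of the embedding and two of the metric,
which is where `3 ≤ N` comes from. -/
theorem ConvJet.inducedMetric {f : ι → (Fin m → ℝ) → (Fin d → ℝ)} {x : ι → Fin m → ℝ}
    (hg : ∀ A B, ConvJet k l (fun i Y => g i Y A B) fun i => f i (x i))
    (hf : ConvJet (k + 1) l f x) (a b : Fin m) :
    ConvJet k l (fun i y => inducedMetric (g i) (f i) y a b) x := by
  simp only [_root_.inducedMetric, metricInner]
  exact ConvJet.sum _ fun A _ => ConvJet.sum _ fun B _ => (((hg A B).comp hf.of_succ).mul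
    ((hf.pd a).component A)).mul ((hf.pd b).component B)

theorem HasLim.extrinsicCurvature {f : ι → (Fin m → ℝ) → (Fin d → ℝ)} {x : ι → Fin m → ℝ}
    {n : ι → Fin d → ℝ}
    (hg : ∀ A B, ConvJet 1 l (fun i Y => g i Y A B) fun i => f i (x i))
    (hd : HasDetLim l fun i => g i (f i (x i))) {a b : Fin m}
    (hfa : HasLim l fun i => pd a (f i) (x i)) (hfb : HasLim l fun i => pd b (f i) (x i))
    (hfab : HasLim l fun i => pd a (pd b (f i)) (x i))
    (hn : HasLim l n) :
    HasLim l fun i => extrinsicCurvature (g i) (f i) (n i) (x i) a b :=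
  HasLim.metricInner (fun A B => (hg A B).tendsto) hn.apply fun L =>
    (hfab.apply L).add (HasLim.sum _ fun A => HasLim.sum _ fun B =>
      ((ConvJet.christoffel hg hd L A B).hasLim.mul (hfa.apply A)).mul
        (hfb.apply B))

theorem HasLim.traceReversed {h K : ι → Fin d → Fin d → ℝ} (hh : ∀ A B, HasLim l fun i => h i A B)
    (hd : HasDetLim l h) (hK : ∀ A B, HasLim l fun i => K i A B) (a b : Fin d) :
    HasLim l fun i => traceReversed (h i) (K i) a b :=
  (hK a b).sub ((hh a b).mul (HasLim.sum _ fun c => HasLim.sum _ fun e =>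
    (HasLim.invMetric hh hd c e).mul (hK c e)))

end Families

/-! ### Lorentzian forms -/

/-- The diagonal form equals its transpose, and the congruence can be cancelled because `P` is
invertible. -/
theorem IsLorentzian.symm {d : ℕ} {h : Fin (d + 1) → Fin (d + 1) → ℝ} (hh : IsLorentzian h)
    (A B : Fin (d + 1)) : h A B = h B A := by
  obtain ⟨P, hP, hD⟩ := hh
  have h1 : (Pᵀ * (Matrix.of h)ᵀ * P) = Pᵀ * Matrix.of h * P := by
    have := congrArg Matrix.transpose hD
    rw [Matrix.diagonal_transpose, ← hD] at this
    rw [← this]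
    simp [Matrix.transpose_mul, Matrix.mul_assoc]
  have hPt : IsUnit Pᵀ.det := by rwa [Matrix.det_transpose]
  have h2 : (Matrix.of h)ᵀ = Matrix.of h := by
    have h3 := congrArg (fun M => M * P⁻¹) h1
    simp only [Matrix.mul_nonsing_inv_cancel_right _ _ hP] at h3
    have h4 := congrArg (fun M => (Pᵀ)⁻¹ * M) h3
    simpa only [Matrix.nonsing_inv_mul_cancel_left _ _ hPt] using h4
  exact congrFun (congrFun h2 B) A

theorem IsLorentzian.det_ne_zero {d : ℕ} {h : Fin (d + 1) → Fin (d + 1) → ℝ}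
    (hh : IsLorentzian h) : (Matrix.of h).det ≠ 0 := by
  obtain ⟨P, hP, hD⟩ := hh
  have h1 := congrArg Matrix.det hD
  rw [Matrix.det_mul, Matrix.det_mul, Matrix.det_diagonal, Fin.prod_univ_succ] at h1
  intro h0
  rw [h0] at h1
  simp at h1

end

noncomputable section

/-! ### The turning angle of an embedded plane arc -/

/-- A continuous function on an interval with values in a discrete coset is constant. Every
comparison of two branches of an angle below reduces to this. -/
theorem eq_of_forall_exists_int_mul {w : ℝ → ℝ} {a b : ℝ} (hab : a ≤ b)
    (hw : ContinuousOn w (Icc a b)) (c : ℝ)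
    (h : ∀ s ∈ Icc a b, ∃ n : ℤ, w s = c + n * (2 * Real.pi)) : w a = w b := by
  have hT : IsDiscrete (AddSubgroup.zmultiples (2 * Real.pi) : Set ℝ) :=
    ⟨inferInstanceAs (DiscreteTopology (AddSubgroup.zmultiples (2 * Real.pi)))⟩
  have h1 := isPreconnected_Icc.constant_of_mapsTo hT (f := fun s => w s - c)
    (hw.sub continuousOn_const) (fun s hs => by
      obtain ⟨n, hn⟩ := h s hs
      exact ⟨n, by simp [hn]⟩) (left_mem_Icc.2 hab) (right_mem_Icc.2 hab)
  simpa using h1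

theorem exists_int_of_norm_mul_exp_eq {r₁ r₂ a b : ℝ} (h₁ : 0 < r₁) (h₂ : 0 < r₂)
    (h : (r₁ : ℂ) * Complex.exp (a * Complex.I) = r₂ * Complex.exp (b * Complex.I)) :
    ∃ n : ℤ, a = b + n * (2 * Real.pi) := by
  have hr : r₁ = r₂ := by
    have := congrArg norm h
    simpa [Complex.norm_exp_ofReal_mul_I, abs_of_pos h₁, abs_of_pos h₂] using this
  subst hr
  have h3 := mul_left_cancel₀ (by exact_mod_cast h₁.ne') h
  obtain ⟨n, hn⟩ := Complex.exp_eq_exp_iff_exists_int.1 h3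
  refine ⟨n, ?_⟩
  have := congrArg Complex.im hn
  simpa using this

/-- The plane is simply connected, so the normalised map to the circle lifts through the covering by
the exponential. -/
theorem exists_continuous_angle {f : ℝ × ℝ → ℂ} (hf : Continuous f) (h0 : ∀ p, f p ≠ 0) :
    ∃ Θ : ℝ × ℝ → ℝ, Continuous Θ ∧ ∀ p, (‖f p‖ : ℂ) * Complex.exp (Θ p * Complex.I) = f p := by
  let F : C(ℝ × ℝ, Circle) := ⟨fun p => ⟨f p / ‖f p‖, mem_sphere_zero_iff_norm.2 (by
    simp [h0 p])⟩, by
      refine Continuous.subtype_mk (hf.div (by fun_prop) fun p => ?_) _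
      simpa using h0 p⟩
  obtain ⟨Θ, ⟨-, hΘ⟩, -⟩ := Circle.isCoveringMap_exp.existsUnique_continuousMap_lifts F 0
    (Complex.arg (F 0)) (Circle.exp_arg _)
  refine ⟨Θ, Θ.continuous, fun p => ?_⟩
  have h1 : Circle.exp (Θ p) = F p := congrFun hΘ p
  have h2 := congrArg (fun c : Circle => (c : ℂ)) h1
  simp only [Circle.coe_exp] at h2
  rw [h2]
  have : (‖f p‖ : ℂ) ≠ 0 := by simpa using h0 p
  change (‖f p‖ : ℂ) * (f p / ‖f p‖) = f p
  field_simp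

/-- The angle of a nonvanishing plane vector field agrees, up to a constant, with the principal
argument relative to the direction `m` as long as the field stays in the half plane about `m`. -/
theorem angle_sub_arg_eq {c : ℝ → ℂ} {θ : ℝ → ℝ} {a b : ℝ} {m : ℂ} (hab : a ≤ b) (hm : m ≠ 0)
    (hc : ContinuousOn c (Icc a b)) (hθ : ContinuousOn θ (Icc a b))
    (h : ∀ s ∈ Icc a b, (‖c s‖ : ℂ) * Complex.exp (θ s * Complex.I) = c s)
    (hpos : ∀ s ∈ Icc a b, 0 < (c s / m).re) :
    θ b - θ a = Complex.arg (c b / m) - Complex.arg (c a / m) := by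
  have h1 : ContinuousOn (fun s => θ s - Complex.arg (c s / m)) (Icc a b) := by
    refine hθ.sub fun s hs => ?_
    exact ContinuousAt.comp_continuousWithinAt (f := fun s => c s / m)
      (Complex.continuousAt_arg (Or.inl (hpos s hs))) ((hc.div_const m) s hs)
  -- Both `θ` and `arg (c/m) + arg m` are angles of `c`, so their difference is a multiple of `2π`.
  -- It is continuous because `c/m` stays off the slit.
  have h2 := eq_of_forall_exists_int_mul hab h1 (Complex.arg m) fun s hs => by
    have hc0 : c s ≠ 0 := fun h0 => by simpa [h0] using hpos s hs
    have e1 : (‖c s‖ : ℂ) * Complex.exp (θ s * Complex.I)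
        = (‖c s‖ : ℝ) * Complex.exp (((Complex.arg (c s / m) + Complex.arg m : ℝ) : ℂ)
          * Complex.I) := by
      rw [h s hs]
      have e2 := Complex.norm_mul_exp_arg_mul_I (c s / m)
      have e3 := Complex.norm_mul_exp_arg_mul_I m
      have hm' : (‖m‖ : ℂ) ≠ 0 := by simpa using hm
      calc c s = (c s / m) * m := by field_simp
        _ = (‖c s / m‖ * Complex.exp (Complex.arg (c s / m) * Complex.I))
            * (‖m‖ * Complex.exp (Complex.arg m * Complex.I)) := by rw [e2, e3]
        _ = _ := by
          rw [norm_div]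
          push_cast
          rw [add_mul, Complex.exp_add]
          field_simp
    obtain ⟨n, hn⟩ := exists_int_of_norm_mul_exp_eq (norm_pos_iff.2 hc0) (norm_pos_iff.2 hc0) e1
    exact ⟨n, by rw [hn]; ring⟩
  linarith

/-- The difference quotient of a primitive of `G` is written as an average of `G`, so that it
extends continuously across the diagonal, where it equals `G`. -/
theorem continuous_secant {G : ℝ → ℂ} (hG : Continuous G) :
    Continuous fun p : ℝ × ℝ => ∫ u in (0 : ℝ)..1, G ((p.2 - p.1) * u + p.1) :=
  intervalIntegral.continuous_parametric_intervalIntegral_of_continuous' (by fun_prop) 0 1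

theorem secant_mul (G : ℝ → ℂ) (s t : ℝ) :
    ((t - s : ℝ) : ℂ) * (∫ u in (0 : ℝ)..1, G ((t - s) * u + s)) = ∫ u in s..t, G u := by
  have := intervalIntegral.smul_integral_comp_mul_add (a := 0) (b := 1) G (t - s) s
  rw [Complex.real_smul] at this
  rw [this]
  congr 1 <;> ring

/-- The turning angle of an embedded plane arc (with velocity `G`) whose ends and whose secants
from the two end points stay in a half plane. -/
theorem exists_angle_of_embedded {G : ℝ → ℂ} {r ρ : ℝ} {m : ℂ} (hG : Continuous G) (hρ : 0 < ρ)
    (hρr : ρ < r) (hm : m ≠ 0) (hG0 : ∀ s ∈ Icc (-r) r, G s ≠ 0)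
    (hinj : ∀ s t, -r ≤ s → s < t → t ≤ r → ∫ u in s..t, G u ≠ 0)
    (hpos : ∀ s, ρ ≤ |s| → |s| ≤ r → 0 < (G s / m).re)
    (hleft : ∀ t, -r < t → t ≤ r → 0 < ((∫ u in (-r)..t, G u) / m).re)
    (hright : ∀ s, -r ≤ s → s < r → 0 < ((∫ u in s..r, G u) / m).re) :
    ∃ θ : ℝ → ℝ, Continuous θ ∧
      (∀ s ∈ Icc (-r) r, (‖G s‖ : ℂ) * Complex.exp (θ s * Complex.I) = G s) ∧
      θ ρ - θ (-ρ) = Complex.arg (G ρ / m) - Complex.arg (G (-ρ) / m) := by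
  have hrr : -r ≤ r := by linarith
  set f : ℝ × ℝ → ℂ := fun p => ∫ u in (0 : ℝ)..1, G ((p.2 - p.1) * u + p.1) with hf
  have hfc : Continuous f := continuous_secant hG
  have hfd : ∀ s, f (s, s) = G s := fun s => by simp [hf]
  have hfm : ∀ s t, ((t - s : ℝ) : ℂ) * f (s, t) = ∫ u in s..t, G u := secant_mul G
  -- Off the diagonal this is injectivity of the arc, on it regularity; below it the secant is only
  -- traversed backwards, and the average is symmetric.
  have hf0 : ∀ s ∈ Icc (-r) r, ∀ t ∈ Icc (-r) r, f (s, t) ≠ 0 := by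
    intro s hs t ht h0
    rcases lt_trichotomy s t with hst | hst | hst
    · exact hinj s t hs.1 hst ht.2 (by rw [← hfm, h0, mul_zero])
    · subst hst
      exact hG0 s hs (by rw [← hfd, h0])
    · refine hinj t s ht.1 hst hs.2 ?_
      rw [intervalIntegral.integral_symm, ← hfm, h0, mul_zero, neg_zero]
  -- Clamping both parameters to `[-r, r]` gives a nonvanishing map on the whole plane, where the
  -- lifting lemma applies.
  let c : ℝ → ℝ := fun s => projIcc (-r) r hrr s
  have hc : Continuous c := continuous_subtype_val.comp continuous_projIcc
  have hcm : ∀ s, c s ∈ Icc (-r) r := fun s => (projIcc (-r) r hrr s).2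
  have hci : ∀ s ∈ Icc (-r) r, c s = s := fun s hs => by simp [c, projIcc_of_mem hrr hs]
  obtain ⟨Θ, hΘc, hΘ⟩ := exists_continuous_angle (f := fun p => f (c p.1, c p.2))
    (hfc.comp ((hc.comp continuous_fst).prodMk (hc.comp continuous_snd)))
    fun p => hf0 _ (hcm _) _ (hcm _)
  have hΘ' : ∀ s ∈ Icc (-r) r, ∀ t ∈ Icc (-r) r,
      (‖f (s, t)‖ : ℂ) * Complex.exp (Θ (s, t) * Complex.I) = f (s, t) := by
    intro s hs t ht
    have := hΘ (s, t)
    simpa only [hci s hs, hci t ht] using this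
  have hre : ∀ s t, s < t → 0 < ((∫ u in s..t, G u) / m).re → 0 < (f (s, t) / m).re := by
    intro s t hst h
    rw [← hfm, mul_div_assoc, Complex.re_ofReal_mul] at h
    exact pos_of_mul_pos_right h (by linarith)
  have hdpos : ∀ s, ρ ≤ |s| → |s| ≤ r → 0 < (f (s, s) / m).re := fun s h1 h2 => by
    rw [hfd]; exact hpos s h1 h2
  have hl : -r ∈ Icc (-r) r := left_mem_Icc.2 hrr
  have hr : r ∈ Icc (-r) r := right_mem_Icc.2 hrr
  -- Hopf's argument. From `(-ρ, -ρ)` to `(ρ, ρ)` the angle changes by as much as on the detour back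
  -- along the diagonal to `(-r, -r)`, along the edges to `(-r, r)` and `(r, r)`, and back along the
  -- diagonal. On each of these four pieces the secant stays in the half plane about `m`, so the
  -- change is a difference of principal arguments, and the sum telescopes.
  have e1 := angle_sub_arg_eq (c := fun s => f (s, s)) (θ := fun s => Θ (s, s)) (a := -r) (b := -ρ)
    (by linarith) hm (by fun_prop) (by fun_prop)
    (fun s hs => hΘ' s ⟨hs.1, by linarith [hs.2]⟩ s ⟨hs.1, by linarith [hs.2]⟩)
    (fun s hs => hdpos s (by rw [abs_of_neg (by linarith [hs.2])]; linarith [hs.2])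
      (by rw [abs_of_neg (by linarith [hs.2])]; linarith [hs.1]))
  have e2 := angle_sub_arg_eq (c := fun t => f (-r, t)) (θ := fun t => Θ (-r, t)) (a := -r) (b := r)
    hrr hm (by fun_prop) (by fun_prop) (fun t ht => hΘ' _ hl t ht) (fun t ht => by
      rcases ht.1.eq_or_lt with h | h
      · rw [← h]
        exact hdpos _ (by rw [abs_neg, abs_of_pos (by linarith)]; exact hρr.le)
          (by rw [abs_neg, abs_of_pos (by linarith)])
      · exact hre _ _ h (hleft t h ht.2))
  have e3 := angle_sub_arg_eq (c := fun s => f (s, r)) (θ := fun s => Θ (s, r)) (a := -r) (b := r)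
    hrr hm (by fun_prop) (by fun_prop) (fun t ht => hΘ' t ht _ hr) (fun t ht => by
      rcases ht.2.eq_or_lt with h | h
      · rw [h]
        exact hdpos _ (by rw [abs_of_pos (by linarith)]; exact hρr.le)
          (by rw [abs_of_pos (by linarith)])
      · exact hre _ _ h (hright t ht.1 h))
  have e4 := angle_sub_arg_eq (c := fun s => f (s, s)) (θ := fun s => Θ (s, s)) (a := ρ) (b := r)
    hρr.le hm (by fun_prop) (by fun_prop)
    (fun s hs => hΘ' s ⟨by linarith [hs.1], hs.2⟩ s ⟨by linarith [hs.1], hs.2⟩)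
    (fun s hs => hdpos s (by rw [abs_of_pos (by linarith [hs.1])]; exact hs.1)
      (by rw [abs_of_pos (by linarith [hs.1])]; exact hs.2))
  refine ⟨fun s => Θ (s, s), by fun_prop, fun s hs => ?_, ?_⟩
  · rw [← hfd s]; exact hΘ' s hs s hs
  · simp only [hfd] at e1 e2 e3 e4
    linarith

/-- The integral of `z' / z` is determined by a continuous angle of a nearby field `G`. -/
theorem im_integral_div_eq {G z z' : ℝ → ℂ} {θ : ℝ → ℝ} {a b : ℝ} (hab : a ≤ b)
    (hG : ContinuousOn G (Icc a b)) (hθ : ContinuousOn θ (Icc a b))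
    (hGθ : ∀ s ∈ Icc a b, (‖G s‖ : ℂ) * Complex.exp (θ s * Complex.I) = G s)
    (hz : ∀ s ∈ Icc a b, HasDerivAt z (z' s) s) (hz' : ContinuousOn z' (Icc a b))
    (hzG : ∀ s ∈ Icc a b, 0 < (z s / G s).re) :
    (∫ s in a..b, z' s / z s).im
      = θ b - θ a + (Complex.arg (z b / G b) - Complex.arg (z a / G a)) := by
  have hG0 : ∀ s ∈ Icc a b, G s ≠ 0 := fun s hs h0 => by simpa [h0] using hzG s hs
  have hz0 : ∀ s ∈ Icc a b, z s ≠ 0 := fun s hs h0 => by simpa [h0] using hzG s hs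
  have hzc : ContinuousOn z (Icc a b) := fun s hs => (hz s hs).continuousAt.continuousWithinAt
  have hqc : ContinuousOn (fun s => z' s / z s) (Icc a b) := hz'.div hzc hz0
  -- The clamped quotient is continuous on the whole line, which makes its primitive differentiable
  -- also at the end points.
  let q : ℝ → ℂ := fun s => z' (projIcc a b hab s) / z (projIcc a b hab s)
  have hq : Continuous q := hqc.comp_continuous
    (continuous_subtype_val.comp continuous_projIcc) fun s => (projIcc a b hab s).2
  have hqe : ∀ s ∈ Icc a b, q s = z' s / z s := fun s hs => by simp [q, projIcc_of_mem hab hs]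
  have hint : ∫ s in a..b, z' s / z s = ∫ s in a..b, q s :=
    intervalIntegral.integral_congr fun s hs => (hqe s (by rwa [uIcc_of_le hab] at hs)).symm
  set w : ℝ → ℂ := fun t => ∫ s in a..t, q s with hw
  have hwd : ∀ t, HasDerivAt w (q t) t := fun t => hq.integral_hasStrictDerivAt a t |>.hasDerivAt
  have hwc : ContinuousOn w (Icc a b) := fun t _ => (hwd t).continuousAt.continuousWithinAt
  have hwa : w a = 0 := by simp [hw]
  -- The primitive `w` is thereby a continuous logarithm of `z / z a`, without any choice of a
  -- branch.
  have hconst : ∀ s ∈ Icc a b, z s * Complex.exp (-w s) = z a := by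
    have h1 := constant_of_has_deriv_right_zero (f := fun s => z s * Complex.exp (-w s))
      (a := a) (b := b) (hzc.mul (Complex.continuous_exp.comp_continuousOn hwc.neg)) fun s hs => by
        have hs' : s ∈ Icc a b := Ico_subset_Icc_self hs
        have h2 := (hz s hs').mul (hwd s).neg.cexp
        refine (h2.congr_deriv ?_).hasDerivWithinAt
        rw [hqe s hs']
        field_simp [hz0 s hs']
        simp
    intro s hs
    simpa [hwa] using h1 s hs
  -- `θ + arg (z/G)` and `Im w` are both continuous angles of `z`, up to the constant `arg (z a)`.
  -- Their difference is therefore constant.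
  have hang : ContinuousOn (fun s => θ s + Complex.arg (z s / G s) - (w s).im) (Icc a b) := by
    refine (hθ.add fun s hs => ?_).sub (Complex.continuous_im.comp_continuousOn hwc)
    exact ContinuousAt.comp_continuousWithinAt (f := fun s => z s / G s)
      (Complex.continuousAt_arg (Or.inl (hzG s hs))) ((hzc.div hG hG0) s hs)
  have key := eq_of_forall_exists_int_mul hab hang (Complex.arg (z a)) fun s hs => by
    have ha : a ∈ Icc a b := left_mem_Icc.2 hab
    have e1 : (‖z s‖ * Real.exp (-(w s).re) : ℝ) * Complex.exp
        ((θ s + Complex.arg (z s / G s) - (w s).im : ℝ) * Complex.I)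
        = (‖z a‖ : ℝ) * Complex.exp ((Complex.arg (z a) : ℝ) * Complex.I) := by
      rw [Complex.norm_mul_exp_arg_mul_I, ← hconst s hs]
      have e2 := Complex.norm_mul_exp_arg_mul_I (z s / G s)
      have e3 := hGθ s hs
      have e5 : -w s = ((-(w s).re : ℝ) : ℂ) + ((-(w s).im : ℝ) : ℂ) * Complex.I := by
        apply Complex.ext <;> simp
      have hn : (‖G s‖ : ℂ) ≠ 0 := by simpa using hG0 s hs
      calc ((‖z s‖ * Real.exp (-(w s).re) : ℝ) : ℂ) * Complex.exp
            ((θ s + Complex.arg (z s / G s) - (w s).im : ℝ) * Complex.I)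
          = (‖z s / G s‖ * Complex.exp (Complex.arg (z s / G s) * Complex.I))
            * (‖G s‖ * Complex.exp (θ s * Complex.I)) * Complex.exp (-w s) := by
            rw [e5, Complex.exp_add, ← Complex.ofReal_exp, norm_div]
            push_cast
            rw [show ((θ s : ℂ) + Complex.arg (z s / G s) - (w s).im) * Complex.I
              = θ s * Complex.I + Complex.arg (z s / G s) * Complex.I + -(w s).im * Complex.I by
                ring, Complex.exp_add, Complex.exp_add]
            field_simp
        _ = (z s / G s) * G s * Complex.exp (-w s) := by rw [e2, e3]
        _ = _ := by rw [div_mul_cancel₀ _ (hG0 s hs)]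
    exact exists_int_of_norm_mul_exp_eq (mul_pos (norm_pos_iff.2 (hz0 s hs)) (Real.exp_pos _))
      (norm_pos_iff.2 (hz0 a ha)) e1
  rw [hwa] at key
  simp only [Complex.zero_im, sub_zero] at key
  rw [hint]
  change (w b).im = _
  linarith

end

noncomputable section

/-! ### Gaussian normal coordinates -/

theorem gnc_castSucc (χ : Fin 4 → ℝ) (τ : ℝ) (μ : Fin 4) : gnc χ τ μ.castSucc = χ μ :=
  Fin.snoc_castSucc (α := fun _ => ℝ) τ χ μ

theorem gnc_last (χ : Fin 4 → ℝ) (τ : ℝ) : gnc χ τ iτ = τ :=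
  Fin.snoc_last (α := fun _ => ℝ) τ χ

theorem init_gnc (χ : Fin 4 → ℝ) (τ : ℝ) : Fin.init (gnc χ τ) = χ :=
  Fin.init_snoc (α := fun _ => ℝ) τ χ

theorem gnc_init_last (x : Fin 5 → ℝ) : gnc (Fin.init x) (x iτ) = x :=
  Fin.snoc_init_self x

theorem gnc_ext {x y : Fin 5 → ℝ} (h : ∀ μ : Fin 4, x μ.castSucc = y μ.castSucc)
    (h' : x iτ = y iτ) : x = y := by
  funext a
  exact Fin.lastCases h' h a

theorem gnc_add_single_castSucc (χ : Fin 4 → ℝ) (τ t : ℝ) (μ : Fin 4) :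
    gnc χ τ + t • Pi.single μ.castSucc (1 : ℝ) = gnc (χ + t • Pi.single μ (1 : ℝ)) τ := by
  refine gnc_ext (fun ν => ?_) ?_
  · simp [-Fin.reduceLast, gnc_castSucc, Pi.single_apply]
  · simp [-Fin.reduceLast, gnc_last, (Fin.castSucc_lt_last μ).ne']

theorem gnc_add_single_last (χ : Fin 4 → ℝ) (τ t : ℝ) :
    gnc χ τ + t • Pi.single iτ (1 : ℝ) = gnc χ (τ + t) := by
  refine gnc_ext (fun ν => ?_) ?_
  · simp [-Fin.reduceLast, gnc_castSucc, (Fin.castSucc_lt_last ν).ne]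
  · simp [-Fin.reduceLast, gnc_last]

section

variable {F : Type*} [NormedAddCommGroup F] [NormedSpace ℝ F]

theorem pd_castSucc (μ : Fin 4) (f : (Fin 5 → ℝ) → F) (χ : Fin 4 → ℝ) (τ : ℝ) :
    pd μ.castSucc f (gnc χ τ) = pd μ (fun χ' => f (gnc χ' τ)) χ := by
  refine congrArg (fun u : ℝ → F => deriv u 0) (funext fun t => ?_)
  exact congrArg f (gnc_add_single_castSucc χ τ t μ)

theorem pd_last (f : (Fin 5 → ℝ) → F) (χ : Fin 4 → ℝ) (τ : ℝ) :
    pd iτ f (gnc χ τ) = deriv (fun s => f (gnc χ s)) τ := by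
  unfold pd lineDeriv
  simp only [gnc_add_single_last]
  rw [deriv_comp_const_add (fun s => f (gnc χ s)) τ 0, add_zero]

end

theorem continuous_gnc : Continuous fun p : (Fin 4 → ℝ) × ℝ => gnc p.1 p.2 := by
  refine continuous_pi fun a => ?_
  refine Fin.lastCases ?_ (fun μ => ?_) a
  · simpa only [gnc_last] using continuous_snd
  · simp only [gnc_castSucc]; fun_prop

theorem continuous_gnc_left (τ : ℝ) : Continuous fun χ => gnc χ τ :=
  continuous_gnc.comp (by fun_prop : Continuous fun χ : Fin 4 → ℝ => (χ, τ))

theorem continuous_gnc_right (χ : Fin 4 → ℝ) : Continuous fun τ => gnc χ τ :=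
  continuous_gnc.comp (by fun_prop : Continuous fun τ : ℝ => (χ, τ))

theorem hasDerivAt_gnc (χ : Fin 4 → ℝ) (τ : ℝ) :
    HasDerivAt (fun s => gnc χ s) (Pi.single iτ 1) τ := by
  refine hasDerivAt_pi.2 fun a => ?_
  refine Fin.lastCases ?_ (fun μ => ?_) a
  · simp only [gnc_last, Pi.single_eq_same]
    exact hasDerivAt_id τ
  · simpa only [gnc_castSucc, Pi.single_eq_of_ne (Fin.castSucc_lt_last μ).ne] using
      hasDerivAt_const τ (χ μ)

theorem hasDerivAt_comp_gnc {F : Type*} [NormedAddCommGroup F] [NormedSpace ℝ F]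
    {f : (Fin 5 → ℝ) → F} {χ : Fin 4 → ℝ} {τ : ℝ} (hf : DifferentiableAt ℝ f (gnc χ τ)) :
    HasDerivAt (fun s => f (gnc χ s)) (pd iτ f (gnc χ τ)) τ := by
  rw [pd_eq_fderiv hf]
  exact hf.hasFDerivAt.comp_hasDerivAt τ (hasDerivAt_gnc χ τ)

/-- The components of `h` along the leaves. -/
def leafBlock (h : Fin 5 → Fin 5 → ℝ) (μ ν : Fin 4) : ℝ := h μ.castSucc ν.castSucc

/-- The symmetric form `h` is in Gaussian normal form with nondegenerate leaf block. -/
structure IsGaussNormal (h : Fin 5 → Fin 5 → ℝ) : Prop where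
  symm : ∀ a b, h a b = h b a
  tt : h iτ iτ = 1
  tm : ∀ μ : Fin 4, h iτ μ.castSucc = 0
  det_ne_zero : (Matrix.of (leafBlock h)).det ≠ 0

namespace IsGaussNormal

variable {h : Fin 5 → Fin 5 → ℝ}

theorem mt (hh : IsGaussNormal h) (μ : Fin 4) : h μ.castSucc iτ = 0 := by rw [hh.symm, hh.tm]

theorem det_eq (hh : IsGaussNormal h) : (Matrix.of h).det = (Matrix.of (leafBlock h)).det := by
  rw [Matrix.det_succ_row (Matrix.of h) (Fin.last 4), Fin.sum_univ_castSucc]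
  simp only [Matrix.of_apply, hh.tm, hh.tt, mul_zero, zero_mul, Finset.sum_const_zero, zero_add]
  have : (Matrix.of h).submatrix (Fin.last 4).succAbove (Fin.last 4).succAbove
      = Matrix.of (leafBlock h) := by
    ext μ ν
    simp [-Fin.reduceLast, leafBlock, Fin.succAbove_last]
  rw [this]
  simp [-Fin.reduceLast]
  norm_num

theorem inv_eq (hh : IsGaussNormal h) : (Matrix.of h)⁻¹ = Matrix.of (fun a b => Fin.lastCases
    (motive := fun _ => ℝ) (Fin.lastCases (motive := fun _ => ℝ) 1 (fun _ => 0) b)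
    (fun μ => Fin.lastCases (motive := fun _ => ℝ) 0 (fun ν => invMetric (leafBlock h) μ ν) b) a) := by
  refine Matrix.inv_eq_right_inv ?_
  ext a b
  rw [Matrix.mul_apply, Fin.sum_univ_castSucc]
  have hmul := Matrix.mul_nonsing_inv (Matrix.of (leafBlock h))
    (isUnit_iff_ne_zero.2 hh.det_ne_zero)
  refine Fin.lastCases ?_ (fun μ => ?_) a
  · refine Fin.lastCases ?_ (fun ν => ?_) b
    · simp [-Fin.reduceLast, hh.tt]
    · simp [-Fin.reduceLast, hh.tm, hh.tt, (Fin.castSucc_lt_last ν).ne']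
  · refine Fin.lastCases ?_ (fun ν => ?_) b
    · simp [-Fin.reduceLast, hh.mt, (Fin.castSucc_lt_last μ).ne]
    · have := congrFun (congrFun hmul μ) ν
      rw [Matrix.mul_apply] at this
      simp only [Matrix.of_apply, Fin.lastCases_castSucc, Fin.lastCases_last, mul_zero, add_zero]
      rw [Matrix.one_apply] at this ⊢
      simpa [invMetric, leafBlock] using this

theorem invMetric_mm (hh : IsGaussNormal h) (μ ν : Fin 4) :
    invMetric h μ.castSucc ν.castSucc = invMetric (leafBlock h) μ ν := by
  rw [invMetric, hh.inv_eq]; simp [-Fin.reduceLast]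

theorem invMetric_tm (hh : IsGaussNormal h) (ν : Fin 4) : invMetric h iτ ν.castSucc = 0 := by
  rw [invMetric, hh.inv_eq]; simp [-Fin.reduceLast]

theorem invMetric_mt (hh : IsGaussNormal h) (ν : Fin 4) : invMetric h ν.castSucc iτ = 0 := by
  rw [invMetric, hh.inv_eq]; simp [-Fin.reduceLast]

theorem invMetric_tt (hh : IsGaussNormal h) : invMetric h iτ iτ = 1 := by
  rw [invMetric, hh.inv_eq]; simp [-Fin.reduceLast]

theorem trace_eq (hh : IsGaussNormal h) (K : Fin 5 → Fin 5 → ℝ) : ∑ a, ∑ b, invMetric h a b * K a b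
    = (∑ μ, ∑ ν, invMetric (leafBlock h) μ ν * leafBlock K μ ν) + K iτ iτ := by
  simp only [Fin.sum_univ_castSucc (n := 4), hh.invMetric_mm, hh.invMetric_mt, hh.invMetric_tm,
    hh.invMetric_tt, leafBlock]
  simp [-Fin.reduceLast]

end IsGaussNormal

/-- The `τ`-derivative of the components of `g` along the leaves. -/
def leafDeriv (g : MetricField 5) (Y : Fin 5 → ℝ) (μ ν : Fin 4) : ℝ :=
  pd iτ (fun Z => g Z μ.castSucc ν.castSucc) Y

/-- The leaf metric at fixed `τ`. -/
def leafMetric (g : MetricField 5) (τ : ℝ) : MetricField 4 := fun χ => leafBlock (g (gnc χ τ))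

/-- The mixed Christoffel symbols `Γ^λ_{τν}` in terms of `h` and `k = ∂_τ h`. -/
def gnMix (h k : Fin 4 → Fin 4 → ℝ) (lam ν : Fin 4) : ℝ :=
  (1 / 2) * ∑ σ, invMetric h lam σ * k σ ν

/-- The terms of the Ricci tensor along the leaves which are quadratic in `k = ∂_τ h`. -/
def gnQuad (h k : Fin 4 → Fin 4 → ℝ) (μ ν : Fin 4) : ℝ :=
  ∑ lam, (gnMix h k lam lam * (-(1 / 2) * k μ ν) - gnMix h k lam ν * (-(1 / 2) * k μ lam))
    - ∑ σ, -(1 / 2) * k ν σ * gnMix h k σ μ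

section GaussNormal

variable {g : MetricField 5} {O : Set (Fin 5 → ℝ)}

theorem pd_eq_zero_of_eqOn {F : Type*} [NormedAddCommGroup F] [NormedSpace ℝ F] (hO : IsOpen O)
    {f : (Fin 5 → ℝ) → F} {c : F} (hf : ∀ y ∈ O, f y = c) (a : Fin 5) {y : Fin 5 → ℝ}
    (hy : y ∈ O) : pd a f y = 0 := by
  have h1 : f =ᶠ[𝓝 y] fun _ => c := by
    filter_upwards [hO.mem_nhds hy] with z hz using hf z hz
  rw [(eventuallyEq_pd a h1).self_of_nhds, pd_const]

theorem pd_congr_of_eqOn {F : Type*} [NormedAddCommGroup F] [NormedSpace ℝ F] (hO : IsOpen O)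
    {f f' : (Fin 5 → ℝ) → F} (hf : ∀ y ∈ O, f y = f' y) (a : Fin 5) {y : Fin 5 → ℝ}
    (hy : y ∈ O) : pd a f y = pd a f' y := by
  have h1 : f =ᶠ[𝓝 y] f' := by
    filter_upwards [hO.mem_nhds hy] with z hz using hf z hz
  exact (eventuallyEq_pd a h1).self_of_nhds


/-- The components `g_{τB}` are constant on an open set, so their derivatives drop out, and the
inverse metric has no mixed components. -/
theorem christoffel_last (hO : IsOpen O) (hg : ∀ y ∈ O, IsGaussNormal (g y))
    {y : Fin 5 → ℝ} (hy : y ∈ O) (A B : Fin 5) :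
    christoffel g y iτ A B = -(1 / 2) * pd iτ (fun Y => g Y A B) y := by
  have h1 : ∀ B : Fin 5, ∀ a, pd a (fun Y => g Y iτ B) y = 0 := fun B a => by
    refine Fin.lastCases ?_ (fun ν => ?_) B
    · exact pd_eq_zero_of_eqOn hO (fun z hz => (hg z hz).tt) a hy
    · exact pd_eq_zero_of_eqOn hO (fun z hz => (hg z hz).tm ν) a hy
  rw [christoffel, Fin.sum_univ_castSucc]
  simp only [(hg y hy).invMetric_tm, (hg y hy).invMetric_tt, h1]
  simp [-Fin.reduceLast]

theorem christoffel_last_tm (hO : IsOpen O) (hg : ∀ y ∈ O, IsGaussNormal (g y))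
    {y : Fin 5 → ℝ} (hy : y ∈ O) (B : Fin 5) :
    christoffel g y iτ iτ B = 0 := by
  rw [christoffel_last hO hg hy]
  refine mul_eq_zero_of_right _ ?_
  refine Fin.lastCases ?_ (fun ν => ?_) B
  · exact pd_eq_zero_of_eqOn hO (fun z hz => (hg z hz).tt) _ hy
  · exact pd_eq_zero_of_eqOn hO (fun z hz => (hg z hz).tm ν) _ hy

theorem christoffel_last_mt (hO : IsOpen O) (hg : ∀ y ∈ O, IsGaussNormal (g y))
    {y : Fin 5 → ℝ} (hy : y ∈ O) (μ : Fin 4) :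
    christoffel g y iτ μ.castSucc iτ = 0 := by
  rw [christoffel_last hO hg hy]
  exact mul_eq_zero_of_right _ (pd_eq_zero_of_eqOn hO (fun z hz => (hg z hz).mt μ) _ hy)

theorem christoffel_castSucc (hg : ∀ y ∈ O, IsGaussNormal (g y))
    {y : Fin 5 → ℝ} (hy : y ∈ O) (lam : Fin 4) (A B : Fin 5) :
    christoffel g y lam.castSucc A B = (1 / 2) * ∑ σ : Fin 4, invMetric (leafBlock (g y)) lam σ *
      (pd A (fun Y => g Y σ.castSucc B) y + pd B (fun Y => g Y σ.castSucc A) y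
        - pd σ.castSucc (fun Y => g Y A B) y) := by
  rw [christoffel, Fin.sum_univ_castSucc]
  simp only [(hg y hy).invMetric_mt, (hg y hy).invMetric_mm]
  simp [-Fin.reduceLast]

theorem christoffel_castSucc_tt (hO : IsOpen O) (hg : ∀ y ∈ O, IsGaussNormal (g y))
    {y : Fin 5 → ℝ} (hy : y ∈ O) (lam : Fin 4) :
    christoffel g y lam.castSucc iτ iτ = 0 := by
  rw [christoffel_castSucc hg hy]
  have h1 : ∀ σ : Fin 4, ∀ a, pd a (fun Y => g Y σ.castSucc iτ) y = 0 := fun σ a =>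
    pd_eq_zero_of_eqOn hO (fun z hz => (hg z hz).mt σ) a hy
  have h2 : ∀ a, pd a (fun Y => g Y iτ iτ) y = 0 := fun a =>
    pd_eq_zero_of_eqOn hO (fun z hz => (hg z hz).tt) a hy
  simp [-Fin.reduceLast, h1, h2]

theorem christoffel_castSucc_tm (hO : IsOpen O) (hg : ∀ y ∈ O, IsGaussNormal (g y))
    {y : Fin 5 → ℝ} (hy : y ∈ O) (lam ν : Fin 4) :
    christoffel g y lam.castSucc iτ ν.castSucc = gnMix (leafBlock (g y)) (leafDeriv g y) lam ν := by
  rw [christoffel_castSucc hg hy]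
  have h1 : ∀ σ : Fin 4, ∀ a, pd a (fun Y => g Y σ.castSucc iτ) y = 0 := fun σ a =>
    pd_eq_zero_of_eqOn hO (fun z hz => (hg z hz).mt σ) a hy
  have h2 : ∀ σ : Fin 4, ∀ a, pd a (fun Y => g Y iτ σ.castSucc) y = 0 := fun σ a =>
    pd_eq_zero_of_eqOn hO (fun z hz => (hg z hz).tm σ) a hy
  simp [-Fin.reduceLast, h1, h2, gnMix, leafDeriv]

theorem christoffel_castSucc_mt (hO : IsOpen O) (hg : ∀ y ∈ O, IsGaussNormal (g y))
    {y : Fin 5 → ℝ} (hy : y ∈ O) (lam ν : Fin 4) :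
    christoffel g y lam.castSucc ν.castSucc iτ = gnMix (leafBlock (g y)) (leafDeriv g y) lam ν := by
  rw [christoffel_castSucc hg hy]
  have h1 : ∀ σ : Fin 4, ∀ a, pd a (fun Y => g Y σ.castSucc iτ) y = 0 := fun σ a =>
    pd_eq_zero_of_eqOn hO (fun z hz => (hg z hz).mt σ) a hy
  simp [-Fin.reduceLast, h1, gnMix, leafDeriv]

theorem christoffel_castSucc_mm (hg : ∀ y ∈ O, IsGaussNormal (g y))
    {χ : Fin 4 → ℝ} {τ : ℝ} (hy : gnc χ τ ∈ O) (lam μ ν : Fin 4) :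
    christoffel g (gnc χ τ) lam.castSucc μ.castSucc ν.castSucc
      = christoffel (leafMetric g τ) χ lam μ ν := by
  rw [christoffel_castSucc hg hy]
  simp only [pd_castSucc]
  rfl

theorem eventually_gnc_mem (hO : IsOpen O)
    {χ : Fin 4 → ℝ} {τ : ℝ} (hy : gnc χ τ ∈ O) :
    ∀ᶠ χ' in 𝓝 χ, gnc χ' τ ∈ O :=
  (continuous_gnc_left τ).continuousAt.eventually (hO.mem_nhds hy)

/-- This is the Gauss equation in coordinates. With an index `τ` only `Γ^τ_{μν}` and the mixed
symbols `Γ^λ_{τν}` survive, and of their derivatives only `∂_τ Γ^τ_{μν}` enters, the single term of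
second order in `∂_τ`. -/
theorem ricci_castSucc (hO : IsOpen O) (hg : ∀ y ∈ O, IsGaussNormal (g y))
    {χ : Fin 4 → ℝ} {τ : ℝ} (hy : gnc χ τ ∈ O) (μ ν : Fin 4) :
    ricci g (gnc χ τ) μ.castSucc ν.castSucc = ricci (leafMetric g τ) χ μ ν
      + pd iτ (fun Y => -(1 / 2) * leafDeriv g Y μ ν) (gnc χ τ)
      + gnQuad (leafBlock (g (gnc χ τ))) (leafDeriv g (gnc χ τ)) μ ν := by
  have d1 : ∀ κ lam μ ν : Fin 4,
      pd κ.castSucc (fun Y => christoffel g Y lam.castSucc μ.castSucc ν.castSucc) (gnc χ τ)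
      = pd κ (fun χ' => christoffel (leafMetric g τ) χ' lam μ ν) χ := by
    intro κ lam μ ν
    rw [pd_castSucc]
    refine (eventuallyEq_pd κ ?_).self_of_nhds
    filter_upwards [eventually_gnc_mem hO hy] with χ' hχ'
    exact christoffel_castSucc_mm hg hχ' lam μ ν
  have d2 : pd iτ (fun Y => christoffel g Y iτ μ.castSucc ν.castSucc) (gnc χ τ)
      = pd iτ (fun Y => -(1 / 2) * leafDeriv g Y μ ν) (gnc χ τ) :=
    pd_congr_of_eqOn hO (fun y hy => christoffel_last hO hg hy _ _) _ hy
  have d3 : pd ν.castSucc (fun Y => christoffel g Y iτ μ.castSucc iτ) (gnc χ τ) = 0 :=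
    pd_eq_zero_of_eqOn hO (fun y hy => christoffel_last_mt hO hg hy _) _ hy
  have d4 : ∀ μ ν : Fin 4, christoffel g (gnc χ τ) iτ μ.castSucc ν.castSucc
      = -(1 / 2) * leafDeriv g (gnc χ τ) μ ν := fun μ ν => christoffel_last hO hg hy _ _
  rw [ricci]
  simp only [Fin.sum_univ_castSucc (n := 4), d1, d2, d3, d4, christoffel_castSucc_mm hg hy,
    christoffel_castSucc_mt hO hg hy, christoffel_last_tm hO hg hy,
    christoffel_last_mt hO hg hy]
  rw [ricci, gnQuad]
  simp only [Finset.sum_add_distrib, Finset.sum_sub_distrib]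
  simp [-Fin.reduceLast]
  ring

/-- The second `τ`-derivatives all sit in the derivative of `Γ^λ_{τλ}`. It is left unexpanded
because its sum over `λ` is the derivative of the trace of the leaf curvature up to sign. -/
theorem ricci_last (hO : IsOpen O) (hg : ∀ y ∈ O, IsGaussNormal (g y))
    {χ : Fin 4 → ℝ} {τ : ℝ} (hy : gnc χ τ ∈ O) :
    ricci g (gnc χ τ) iτ iτ
      = -∑ lam, pd iτ (fun Y => gnMix (leafBlock (g Y)) (leafDeriv g Y) lam lam) (gnc χ τ)
        - ∑ lam, ∑ σ, gnMix (leafBlock (g (gnc χ τ))) (leafDeriv g (gnc χ τ)) lam σ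
          * gnMix (leafBlock (g (gnc χ τ))) (leafDeriv g (gnc χ τ)) σ lam := by
  have d1 : ∀ lam : Fin 4, pd lam.castSucc (fun Y => christoffel g Y lam.castSucc iτ iτ) (gnc χ τ)
      = 0 := fun lam =>
    pd_eq_zero_of_eqOn hO (fun y hy => christoffel_castSucc_tt hO hg hy _) _ hy
  have d2 : ∀ lam : Fin 4, pd iτ (fun Y => christoffel g Y lam.castSucc iτ lam.castSucc) (gnc χ τ)
      = pd iτ (fun Y => gnMix (leafBlock (g Y)) (leafDeriv g Y) lam lam) (gnc χ τ) := fun lam =>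
    pd_congr_of_eqOn hO (fun y hy => christoffel_castSucc_tm hO hg hy _ _) _ hy
  rw [ricci]
  simp only [Fin.sum_univ_castSucc (n := 4), d1, d2, christoffel_castSucc_tt hO hg hy,
    christoffel_castSucc_tm hO hg hy, christoffel_last_tm hO hg hy]
  simp only [Finset.sum_add_distrib, Finset.sum_sub_distrib]
  simp [-Fin.reduceLast]
  ring

end GaussNormal

end

/-! ### The Einstein tensor of a metric in Gaussian normal form -/

noncomputable section

/-- A family indexed by one point turns the convergence lemma into a smoothness lemma, since
convergence of jets records differentiability as well. -/
theorem contDiffAt_invMetric {d m k : ℕ} {h : (Fin m → ℝ) → Fin d → Fin d → ℝ} {y : Fin m → ℝ}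
    (hh : ∀ A B, ContDiffAt ℝ k (fun Y => h Y A B) y) (hd : (Matrix.of (h y)).det ≠ 0)
    (A B : Fin d) : ContDiffAt ℝ k (fun Y => invMetric (h Y) A B) y := by
  have h1 : ∀ A B, ConvJet k (pure ()) (fun _ Y => h Y A B) fun _ => y := fun A B =>
    ConvJet.of_contDiffAt (hh A B) tendsto_const_nhds
  have h2 := (ConvJet.invMetric (h := fun _ => h) h1 ⟨_, hd, tendsto_const_nhds⟩ A B).contDiffAt
  simpa using h2

/-- Differentiating `h⁻¹ h = 1` gives `∂(h⁻¹) = -h⁻¹ (∂h) h⁻¹`. -/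
theorem pd_invMetric {d m : ℕ} {h : (Fin m → ℝ) → Fin d → Fin d → ℝ} {y : Fin m → ℝ} (a : Fin m)
    (hh : ∀ A B, ContDiffAt ℝ (1 : ℕ) (fun Y => h Y A B) y) (hd : (Matrix.of (h y)).det ≠ 0)
    (A B : Fin d) : pd a (fun Y => invMetric (h Y) A B) y
      = -∑ C, ∑ D, invMetric (h y) A C * pd a (fun Y => h Y C D) y * invMetric (h y) D B := by
  have hi := contDiffAt_invMetric hh hd
  have hhd : ∀ A B, DifferentiableAt ℝ (fun Y => h Y A B) y := fun A B =>
    (hh A B).differentiableAt (by simp)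
  have hid : ∀ A B, DifferentiableAt ℝ (fun Y => invMetric (h Y) A B) y := fun A B =>
    (hi A B).differentiableAt (by simp)
  have hne : ∀ᶠ Y in 𝓝 y, (Matrix.of (h Y)).det ≠ 0 := by
    have hc : Tendsto h (𝓝 y) (𝓝 (h y)) :=
      tendsto_pi_nhds.2 fun A => tendsto_pi_nhds.2 fun B => (hh A B).continuousAt
    exact (tendsto_det hc).eventually_ne hd
  let H : Matrix (Fin d) (Fin d) ℝ := (Matrix.of (h y))⁻¹
  let dH : Matrix (Fin d) (Fin d) ℝ := Matrix.of fun A B => pd a (fun Y => invMetric (h Y) A B) y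
  let dh : Matrix (Fin d) (Fin d) ℝ := Matrix.of fun A B => pd a (fun Y => h Y A B) y
  have e1 : dH * Matrix.of (h y) + H * dh = 0 := by
    ext A B
    have e2 : (fun Y => ∑ C, invMetric (h Y) A C * h Y C B) =ᶠ[𝓝 y]
        fun _ => (1 : Matrix (Fin d) (Fin d) ℝ) A B := by
      filter_upwards [hne] with Y hY
      have := congrFun (congrFun (Matrix.nonsing_inv_mul (Matrix.of (h Y))
        (isUnit_iff_ne_zero.2 hY)) A) B
      rw [Matrix.mul_apply] at this
      simpa [invMetric] using this
    have e3 := (eventuallyEq_pd a e2).self_of_nhds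
    rw [pd_const, pd_sum a _ fun C _ => (hid A C).fun_mul (hhd C B)] at e3
    simp only [pd_mul a (hid A _) (hhd _ B)] at e3
    rw [Finset.sum_add_distrib] at e3
    rw [Matrix.add_apply, Matrix.mul_apply, Matrix.mul_apply]
    exact e3
  have e4 : dH = -(H * dh * H) := by
    have e5 : Matrix.of (h y) * H = 1 :=
      Matrix.mul_nonsing_inv _ (isUnit_iff_ne_zero.2 hd)
    calc dH = dH * (Matrix.of (h y) * H) := by rw [e5, mul_one]
      _ = (dH * Matrix.of (h y) + H * dh) * H - H * dh * H := by
        rw [add_mul, add_sub_cancel_right, mul_assoc]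
      _ = _ := by rw [e1]; simp
  have e6 := congrFun (congrFun e4 A) B
  rw [Matrix.neg_apply, Matrix.mul_apply] at e6
  simp only [Matrix.mul_apply, Finset.sum_mul] at e6
  rw [Finset.sum_comm] at e6
  exact e6

/-- The part of the Einstein tensor along the leaves of a metric in Gaussian normal form which
contains no second derivatives with respect to `τ`, as a function of the leaf metric `h`, of
`k = ∂_τ h` and of the Ricci tensor `R` of the leaf. -/
def gnRest (h k R : Fin 4 → Fin 4 → ℝ) (μ ν : Fin 4) : ℝ :=
  R μ ν + gnQuad h k μ ν + k μ ν * (∑ c, ∑ e, invMetric h c e * (-(1 / 2) * k c e))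
    - (1 / 2) * h μ ν * ((∑ c, ∑ e, invMetric h c e * (R c e + gnQuad h k c e))
      - (∑ c, ∑ e, gnMix h k c e * gnMix h k e c)
      + ∑ c, ∑ e, (∑ p, ∑ q, invMetric h c p * k p q * invMetric h q e) * (-(1 / 2) * k c e))

section GaussNormal

variable {g : MetricField 5} {O : Set (Fin 5 → ℝ)}

/-- Write `κ = -k/2` for the leaf curvature and `T` for its trace. `R_{μν}` contributes `∂_τ
κ_{μν}`, while `R_{ττ}` and the leaf trace of the Ricci tensor contribute `∂_τ T` each, up to terms
quadratic in `k`. Half the scalar curvature thus supplies `-h_{μν} ∂_τ T`, and the second order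
terms assemble into `∂_τ (κ_{μν} - h_{μν} T)` up to `k_{μν} T`. That they form a total derivative is
what allows the integration across the ribbon. -/
theorem einstein_castSucc (hO : IsOpen O) (hg : ∀ y ∈ O, IsGaussNormal (g y)) {χ : Fin 4 → ℝ}
    {τ : ℝ} (hy : gnc χ τ ∈ O) (hc : ∀ a b, ContDiffAt ℝ (2 : ℕ) (fun Y => g Y a b) (gnc χ τ))
    (μ ν : Fin 4) : einstein g (gnc χ τ) μ.castSucc ν.castSucc
      = pd iτ (fun Y => traceReversed (leafBlock (g Y)) (fun α β => -(1 / 2) * leafDeriv g Y α β)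
          μ ν) (gnc χ τ)
        + gnRest (leafBlock (g (gnc χ τ))) (leafDeriv g (gnc χ τ)) (ricci (leafMetric g τ) χ)
          μ ν := by
  set y := gnc χ τ with hydef
  have hc1 : ∀ a b, ContDiffAt ℝ (1 : ℕ) (fun Y => g Y a b) y := fun a b =>
    (hc a b).of_le (by norm_num)
  have hk : ∀ α β, DifferentiableAt ℝ (fun Y => leafDeriv g Y α β) y := fun α β =>
    ((hc α.castSucc β.castSucc).pd (k := 1) iτ).differentiableAt (by simp)
  have hK : ∀ α β, DifferentiableAt ℝ (fun Y => -(1 / 2) * leafDeriv g Y α β) y := fun α β =>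
    (hk α β).const_mul _
  have hh : ∀ α β, DifferentiableAt ℝ (fun Y => leafBlock (g Y) α β) y := fun α β =>
    (hc1 _ _).differentiableAt (by simp)
  have hi : ∀ α β, DifferentiableAt ℝ (fun Y => invMetric (leafBlock (g Y)) α β) y := fun α β =>
    (contDiffAt_invMetric (h := fun Y => leafBlock (g Y)) (fun A B => hc1 _ _)
      (hg y hy).det_ne_zero α β).differentiableAt (by simp)
  have dinv : ∀ α β, pd iτ (fun Y => invMetric (leafBlock (g Y)) α β) y
      = -∑ p, ∑ q, invMetric (leafBlock (g y)) α p * leafDeriv g y p q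
        * invMetric (leafBlock (g y)) q β := fun α β =>
    pd_invMetric (h := fun Y => leafBlock (g Y)) iτ (fun A B => hc1 _ _)
      (hg y hy).det_ne_zero α β
  set T : (Fin 5 → ℝ) → ℝ := fun Y =>
    ∑ c, ∑ e, invMetric (leafBlock (g Y)) c e * (-(1 / 2) * leafDeriv g Y c e) with hT
  have hTd : DifferentiableAt ℝ T y :=
    DifferentiableAt.fun_sum fun c _ => DifferentiableAt.fun_sum fun e _ => (hi c e).fun_mul (hK c e)
  have dT : pd iτ T y = ∑ c, ∑ e, (pd iτ (fun Y => invMetric (leafBlock (g Y)) c e) y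
      * (-(1 / 2) * leafDeriv g y c e) + invMetric (leafBlock (g y)) c e
      * pd iτ (fun Y => -(1 / 2) * leafDeriv g Y c e) y) := by
    rw [hT, pd_sum iτ _ fun c _ => DifferentiableAt.fun_sum fun e _ => (hi c e).fun_mul (hK c e)]
    refine Finset.sum_congr rfl fun c _ => ?_
    rw [pd_sum iτ _ fun e _ => (hi c e).fun_mul (hK c e)]
    exact Finset.sum_congr rfl fun e _ => pd_mul iτ (hi c e) (hK c e)
  have hks : ∀ Y ∈ O, ∀ α β, leafDeriv g Y α β = leafDeriv g Y β α := fun Y hY α β =>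
    pd_congr_of_eqOn hO (fun z hz => (hg z hz).symm _ _) _ hY
  have hmd : ∀ lam, DifferentiableAt ℝ
      (fun Y => gnMix (leafBlock (g Y)) (leafDeriv g Y) lam lam) y := fun lam =>
    (DifferentiableAt.fun_sum fun σ _ => (hi lam σ).mul (hk σ lam)).const_mul _
  have dmix : ∑ lam, pd iτ (fun Y => gnMix (leafBlock (g Y)) (leafDeriv g Y) lam lam) y
      = -pd iτ T y := by
    rw [← pd_sum iτ _ fun lam _ => hmd lam]
    have : ∀ Y ∈ O, ∑ lam, gnMix (leafBlock (g Y)) (leafDeriv g Y) lam lam = (-1) * T Y := by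
      intro Y hY
      simp only [gnMix, hT, Finset.mul_sum]
      refine Finset.sum_congr rfl fun lam _ => Finset.sum_congr rfl fun σ _ => ?_
      rw [hks Y hY σ lam]; ring
    rw [pd_congr_of_eqOn hO this iτ hy, pd_mul iτ (differentiableAt_const _) hTd, pd_const]
    ring
  have dS : pd iτ (fun Y => traceReversed (leafBlock (g Y))
      (fun α β => -(1 / 2) * leafDeriv g Y α β) μ ν) y
      = pd iτ (fun Y => -(1 / 2) * leafDeriv g Y μ ν) y
        - (leafDeriv g y μ ν * T y + leafBlock (g y) μ ν * pd iτ T y) := by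
    have e1 : (fun Y => traceReversed (leafBlock (g Y))
        (fun α β => -(1 / 2) * leafDeriv g Y α β) μ ν)
        = fun Y => -(1 / 2) * leafDeriv g Y μ ν + (-1) * (leafBlock (g Y) μ ν * T Y) := by
      funext Y; simp only [traceReversed, hT]; ring
    rw [e1, pd_add iτ (hK μ ν) (((hh μ ν).fun_mul hTd).const_mul (-1)),
      pd_mul iτ (differentiableAt_const _) ((hh μ ν).fun_mul hTd), pd_const,
      pd_mul iτ (hh μ ν) hTd]
    have : pd iτ (fun Y => leafBlock (g Y) μ ν) y = leafDeriv g y μ ν := rfl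
    rw [this]; ring
  have hR : ∀ α β : Fin 4, leafBlock (fun a b => ricci g y a b) α β
      = ricci (leafMetric g τ) χ α β + pd iτ (fun Y => -(1 / 2) * leafDeriv g Y α β) y
        + gnQuad (leafBlock (g y)) (leafDeriv g y) α β := fun α β => ricci_castSucc hO hg hy α β
  have hRtt : ricci g y iτ iτ = _ := ricci_last hO hg hy
  have hsum : ∑ c, ∑ e, invMetric (leafBlock (g y)) c e
      * pd iτ (fun Y => -(1 / 2) * leafDeriv g Y c e) y
      = pd iτ T y + ∑ c, ∑ e, (∑ p, ∑ q, invMetric (leafBlock (g y)) c p * leafDeriv g y p q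
        * invMetric (leafBlock (g y)) q e) * (-(1 / 2) * leafDeriv g y c e) := by
    rw [dT]
    simp only [Finset.sum_add_distrib, dinv, neg_mul, Finset.sum_neg_distrib]
    ring
  have hscal : scalarCurv g y = 2 * pd iτ T y
      + (∑ c, ∑ e, invMetric (leafBlock (g y)) c e * (ricci (leafMetric g τ) χ c e
        + gnQuad (leafBlock (g y)) (leafDeriv g y) c e))
      - (∑ c, ∑ e, gnMix (leafBlock (g y)) (leafDeriv g y) c e
        * gnMix (leafBlock (g y)) (leafDeriv g y) e c)
      + ∑ c, ∑ e, (∑ p, ∑ q, invMetric (leafBlock (g y)) c p * leafDeriv g y p q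
        * invMetric (leafBlock (g y)) q e) * (-(1 / 2) * leafDeriv g y c e) := by
    have e1 : scalarCurv g y = _ := (hg y hy).trace_eq (fun a b => ricci g y a b)
    rw [e1, hRtt, ← hydef, dmix]
    simp only [hR]
    have e2 : ∀ c e : Fin 4, invMetric (leafBlock (g y)) c e * (ricci (leafMetric g τ) χ c e
        + pd iτ (fun Y => -(1 / 2) * leafDeriv g Y c e) y
        + gnQuad (leafBlock (g y)) (leafDeriv g y) c e)
        = invMetric (leafBlock (g y)) c e * (ricci (leafMetric g τ) χ c e
          + gnQuad (leafBlock (g y)) (leafDeriv g y) c e) + invMetric (leafBlock (g y)) c e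
          * pd iτ (fun Y => -(1 / 2) * leafDeriv g Y c e) y := fun c e => by ring
    simp only [e2]
    rw [show (∑ c, ∑ e, (invMetric (leafBlock (g y)) c e * (ricci (leafMetric g τ) χ c e
          + gnQuad (leafBlock (g y)) (leafDeriv g y) c e) + invMetric (leafBlock (g y)) c e
          * pd iτ (fun Y => -(1 / 2) * leafDeriv g Y c e) y)) = (∑ c, ∑ e,
          invMetric (leafBlock (g y)) c e * (ricci (leafMetric g τ) χ c e
          + gnQuad (leafBlock (g y)) (leafDeriv g y) c e)) + ∑ c, ∑ e,
          invMetric (leafBlock (g y)) c e * pd iτ (fun Y => -(1 / 2) * leafDeriv g Y c e) y by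
        simp only [Finset.sum_add_distrib], hsum]
    ring
  have hRmn : ricci g y μ.castSucc ν.castSucc = _ := hR μ ν
  rw [einstein, hscal, hRmn, dS, gnRest]
  have : g y μ.castSucc ν.castSucc = leafBlock (g y) μ ν := rfl
  rw [this]
  ring

theorem traceReversed_castSucc {h K : Fin 5 → Fin 5 → ℝ} (hh : IsGaussNormal h) (μ ν : Fin 4) :
    traceReversed h K μ.castSucc ν.castSucc
      = traceReversed (leafBlock h) (leafBlock K) μ ν - leafBlock h μ ν * K iτ iτ := by
  rw [traceReversed, hh.trace_eq, traceReversed]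
  simp only [leafBlock]
  ring

/-- The leaf is affine in the coordinates and its normal is the constant vector along `τ`, so only
`Γ^τ_{μν}` contributes. -/
theorem leafCurvature_eq {g : MetricField 6} {φ : (Fin 5 → ℝ) → (Fin 6 → ℝ)} (hO : IsOpen O)
    (hg : ∀ y ∈ O, IsGaussNormal (inducedMetric g φ y)) {χ : Fin 4 → ℝ} {τ : ℝ}
    (hy : gnc χ τ ∈ O) (μ ν : Fin 4) :
    leafCurvature g φ χ τ μ ν = -(1 / 2) * leafDeriv (inducedMetric g φ) (gnc χ τ) μ ν := by
  have d1 : ∀ μ : Fin 4, pd μ (fun χ' => gnc χ' τ)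
      = fun _ => (Pi.single μ.castSucc (1 : ℝ) : Fin 5 → ℝ) := by
    intro μ
    funext χ'
    have h1 := pd_castSucc μ (fun x : Fin 5 → ℝ => x) χ' τ
    rw [← h1, pd_eq_fderiv differentiableAt_fun_id]
    simp
  have h2 := christoffel_last hO hg hy μ.castSucc ν.castSucc
  rw [leafCurvature, extrinsicCurvature, metricInner]
  simp only [d1, pd_const]
  rw [Fin.sum_univ_castSucc]
  rw [Finset.sum_eq_zero fun α _ => Finset.sum_eq_zero fun b _ => by
    rw [Pi.single_eq_of_ne (Fin.castSucc_lt_last α).ne]; ring]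
  rw [Fin.sum_univ_castSucc]
  simp only [(hg _ hy).tm, (hg _ hy).tt]
  simp [-Fin.reduceLast, Pi.single_apply]
  rw [h2]
  simp [leafDeriv]

theorem leafMetric_inducedMetric (g : MetricField 6) (φ : (Fin 5 → ℝ) → (Fin 6 → ℝ)) (τ : ℝ) :
    leafMetric (inducedMetric g φ) τ = inducedMetric g (leaf φ τ) := by
  funext χ μ ν
  simp only [leafMetric, leafBlock, inducedMetric, pd_castSucc]
  rfl

end GaussNormal

end

noncomputable section

/-! ### Oriented frames at the codimension-2 brane -/

section MetricInner

variable {d : ℕ} (h : Fin d → Fin d → ℝ)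

theorem metricInner_eq_dotProduct (v w : Fin d → ℝ) :
    metricInner h v w = v ⬝ᵥ (Matrix.of h *ᵥ w) := by
  simp only [metricInner, dotProduct, Matrix.mulVec, Matrix.of_apply, Finset.mul_sum]
  exact Finset.sum_congr rfl fun A _ => Finset.sum_congr rfl fun B _ => by ring

theorem metricInner_add_left (u v w : Fin d → ℝ) :
    metricInner h (u + v) w = metricInner h u w + metricInner h v w := by
  simp only [metricInner_eq_dotProduct, add_dotProduct]

theorem metricInner_smul_left (c : ℝ) (v w : Fin d → ℝ) :
    metricInner h (c • v) w = c * metricInner h v w := by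
  simp only [metricInner_eq_dotProduct, smul_dotProduct, smul_eq_mul]

theorem metricInner_sub_left (u v w : Fin d → ℝ) :
    metricInner h (u - v) w = metricInner h u w - metricInner h v w := by
  simp only [metricInner_eq_dotProduct, sub_dotProduct]

theorem metricInner_neg_left (v w : Fin d → ℝ) :
    metricInner h (-v) w = -metricInner h v w := by
  simp only [metricInner_eq_dotProduct, neg_dotProduct]

theorem metricInner_sum_left {κ : Type*} (s : Finset κ) (v : κ → Fin d → ℝ) (w : Fin d → ℝ) :
    metricInner h (∑ j ∈ s, v j) w = ∑ j ∈ s, metricInner h (v j) w := by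
  simp only [metricInner_eq_dotProduct, sum_dotProduct]

variable {h}

theorem metricInner_comm (hs : ∀ A B, h A B = h B A) (v w : Fin d → ℝ) :
    metricInner h v w = metricInner h w v := by
  rw [metricInner, Finset.sum_comm]
  exact Finset.sum_congr rfl fun A _ => Finset.sum_congr rfl fun B _ => by rw [hs]; ring

end MetricInner

theorem det_eq_of_last_row {k : ℕ} (M : Matrix (Fin (k + 1)) (Fin (k + 1)) ℝ)
    (h0 : ∀ i : Fin k, M (Fin.last k) i.castSucc = 0) (h1 : M (Fin.last k) (Fin.last k) = 1) :
    M.det = (M.submatrix Fin.castSucc Fin.castSucc).det := by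
  rw [Matrix.det_succ_row M (Fin.last k), Fin.sum_univ_castSucc]
  have : M.submatrix (Fin.last k).succAbove (Fin.last k).succAbove
      = M.submatrix Fin.castSucc Fin.castSucc := by
    ext i j
    simp [Fin.succAbove_last]
  simp only [h0, h1, mul_zero, zero_mul, Finset.sum_const_zero, zero_add, this]
  simp [← two_mul]

/-- The square matrix with rows `v 0, …, v (m-1), n`. -/
def frameMatrix {m : ℕ} (v : Fin m → Fin (m + 1) → ℝ) (n : Fin (m + 1) → ℝ) :
    Matrix (Fin (m + 1)) (Fin (m + 1)) ℝ :=
  Matrix.of (Fin.snoc (α := fun _ => Fin (m + 1) → ℝ) v n)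

section FrameMatrix

variable {m : ℕ} {v : Fin m → Fin (m + 1) → ℝ} {n : Fin (m + 1) → ℝ}

theorem frameMatrix_castSucc (a : Fin m) : frameMatrix v n a.castSucc = v a :=
  Fin.snoc_castSucc (α := fun _ => Fin (m + 1) → ℝ) n v a

theorem frameMatrix_last : frameMatrix v n (Fin.last m) = n :=
  Fin.snoc_last (α := fun _ => Fin (m + 1) → ℝ) n v

theorem frameMatrix_updateRow_last (w : Fin (m + 1) → ℝ) :
    (frameMatrix v n).updateRow (Fin.last m) w = frameMatrix v w := by
  ext a B
  refine Fin.lastCases ?_ (fun a => ?_) a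
  · rw [Matrix.updateRow_self, frameMatrix_last]
  · rw [Matrix.updateRow_ne (Fin.castSucc_lt_last a).ne, frameMatrix_castSucc,
      frameMatrix_castSucc]

theorem tendsto_frameMatrix_det {ι : Type*} {l : Filter ι} {v : ι → Fin m → Fin (m + 1) → ℝ}
    {n : ι → Fin (m + 1) → ℝ} {v₀ : Fin m → Fin (m + 1) → ℝ} {n₀ : Fin (m + 1) → ℝ}
    (hv : Tendsto v l (𝓝 v₀)) (hn : Tendsto n l (𝓝 n₀)) :
    Tendsto (fun i => (frameMatrix (v i) (n i)).det) l (𝓝 (frameMatrix v₀ n₀).det) := by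
  refine tendsto_det (h := fun i => Fin.snoc (α := fun _ => Fin (m + 1) → ℝ) (v i) (n i))
    (h₀ := Fin.snoc (α := fun _ => Fin (m + 1) → ℝ) v₀ n₀) (tendsto_pi_nhds.2 fun a => ?_)
  refine Fin.lastCases ?_ (fun a => ?_) a
  · simpa only [Fin.snoc_last] using hn
  · simpa only [Fin.snoc_castSucc] using tendsto_pi_nhds.1 hv a

end FrameMatrix

/-- A hypersurface frame `v` in Gaussian normal form together with its oriented unit normal `n`. -/
structure IsRidgeFrame (ε : ℝ) (h : Fin 6 → Fin 6 → ℝ) (v : Fin 5 → Fin 6 → ℝ)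
    (n : Fin 6 → ℝ) : Prop where
  symm : ∀ A B, h A B = h B A
  det_ne_zero : (Matrix.of h).det ≠ 0
  gram : IsGaussNormal fun a b => metricInner h (v a) (v b)
  normal : ∀ a, metricInner h n (v a) = 0
  unit : metricInner h n n = 1
  oriented : 0 < ε * (frameMatrix v n).det

namespace IsRidgeFrame

variable {ε : ℝ} {h : Fin 6 → Fin 6 → ℝ} {v v' : Fin 5 → Fin 6 → ℝ} {n n' : Fin 6 → ℝ}

theorem frame_det_ne_zero (hf : IsRidgeFrame ε h v n) : (frameMatrix v n).det ≠ 0 := fun h0 => by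
  have := hf.oriented
  simp [h0] at this

theorem mulVec_apply (h : Fin 6 → Fin 6 → ℝ) (M : Matrix (Fin 6) (Fin 6) ℝ) (w : Fin 6 → ℝ)
    (A : Fin 6) : (M *ᵥ (Matrix.of h *ᵥ w)) A = metricInner h (M A) w := by
  rw [metricInner_eq_dotProduct]; rfl

theorem eq_zero (hf : IsRidgeFrame ε h v n) {w : Fin 6 → ℝ}
    (hv : ∀ a, metricInner h w (v a) = 0) (hn : metricInner h w n = 0) : w = 0 := by
  have h1 : frameMatrix v n *ᵥ (Matrix.of h *ᵥ w) = 0 := by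
    funext A
    rw [mulVec_apply, metricInner_comm hf.symm]
    refine Fin.lastCases ?_ (fun a => ?_) A
    · rw [frameMatrix_last, hn]; rfl
    · rw [frameMatrix_castSucc, hv]; rfl
  exact Matrix.eq_zero_of_mulVec_eq_zero hf.det_ne_zero
    (Matrix.eq_zero_of_mulVec_eq_zero hf.frame_det_ne_zero h1)

/-- The Gram matrix of the full frame has last row `(0, …, 0, 1)`, because `n` is a unit vector
orthogonal to the rest. -/
theorem det_sq (hf : IsRidgeFrame ε h v n) : (frameMatrix v n).det ^ 2 * (Matrix.of h).det
    = (Matrix.of fun a b => metricInner h (v a) (v b)).det := by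
  have e1 : ∀ A B, (frameMatrix v n * Matrix.of h * (frameMatrix v n)ᵀ) A B = metricInner h (frameMatrix v n B) (frameMatrix v n A) := by
    intro A B
    rw [metricInner_comm hf.symm, metricInner_eq_dotProduct, Matrix.mul_assoc]
    rfl
  have e2 : (frameMatrix v n * Matrix.of h * (frameMatrix v n)ᵀ).det = (frameMatrix v n).det ^ 2 * (Matrix.of h).det := by
    rw [Matrix.det_mul, Matrix.det_mul, Matrix.det_transpose]; ring
  rw [← e2, det_eq_of_last_row]
  · congr 1
    ext a b
    rw [Matrix.submatrix_apply, e1, frameMatrix_castSucc, frameMatrix_castSucc,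
      metricInner_comm hf.symm]
    rfl
  · intro a
    rw [e1, frameMatrix_castSucc, frameMatrix_last, metricInner_comm hf.symm, hf.normal]
  · rw [e1, frameMatrix_last, hf.unit]

/-- The frame matrix sends the covector of `n` to the last basis vector, and the adjugate inverts
this up to the determinant. The result is the generalised cross product of the tangent vectors, in
which `n` no longer occurs. -/
theorem smul_mulVec_eq (hf : IsRidgeFrame ε h v n) : (frameMatrix v n).det • (Matrix.of h *ᵥ n)
    = fun M => (frameMatrix v (Pi.single M 1)).det := by
  have e1 : frameMatrix v n *ᵥ (Matrix.of h *ᵥ n) = Pi.single (Fin.last 5) 1 := by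
    funext A
    rw [mulVec_apply, metricInner_comm hf.symm]
    refine Fin.lastCases ?_ (fun a => ?_) A
    · rw [frameMatrix_last, hf.unit, Pi.single_eq_same]
    · rw [frameMatrix_castSucc, hf.normal, Pi.single_eq_of_ne (Fin.castSucc_lt_last a).ne]
  funext M
  have e2 : (frameMatrix v n).adjugate *ᵥ (frameMatrix v n *ᵥ (Matrix.of h *ᵥ n))
      = (frameMatrix v n).det • (Matrix.of h *ᵥ n) := by
    rw [Matrix.mulVec_mulVec, Matrix.adjugate_mul, Matrix.smul_mulVec, Matrix.one_mulVec]
  rw [← e2, e1, Matrix.mulVec_single_one, Matrix.col_apply, Matrix.adjugate_apply,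
    frameMatrix_updateRow_last]

theorem normal_eq (hf : IsRidgeFrame ε h v n) : n = (frameMatrix v n).det⁻¹ •
    ((Matrix.of h)⁻¹ *ᵥ fun M => (frameMatrix v (Pi.single M 1)).det) := by
  rw [← hf.smul_mulVec_eq, Matrix.mulVec_smul, Matrix.mulVec_mulVec,
    Matrix.nonsing_inv_mul _ (isUnit_iff_ne_zero.2 hf.det_ne_zero), Matrix.one_mulVec, smul_smul,
    inv_mul_cancel₀ hf.frame_det_ne_zero, one_smul]

/-- The Gram identity gives the square of the determinant and the orientation its sign. The
determinant is then a continuous function of the metric and the tangent vectors alone, so the cross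
product formula makes the unit normal one too. -/
theorem frame_det_eq (hf : IsRidgeFrame ε h v n) : (frameMatrix v n).det = SignType.sign ε *
    √((Matrix.of fun a b => metricInner h (v a) (v b)).det / (Matrix.of h).det) := by
  have e1 : (Matrix.of fun a b => metricInner h (v a) (v b)).det / (Matrix.of h).det
      = (frameMatrix v n).det ^ 2 := by
    rw [← hf.det_sq, mul_div_assoc, div_self hf.det_ne_zero, mul_one]
  rw [e1, Real.sqrt_sq_eq_abs]
  have := hf.oriented
  rcases lt_trichotomy ε 0 with h0 | h0 | h0
  · have h1 : (frameMatrix v n).det < 0 := by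
      by_contra hc
      nlinarith
    rw [abs_of_neg h1, sign_neg h0]; simp
  · simp [h0] at this
  · have h1 : 0 < (frameMatrix v n).det := pos_of_mul_pos_right this h0.le
    rw [abs_of_pos h1, sign_pos h0]; simp

/-- The normals of a convergent family of hypersurface frames converge. -/
theorem exists_tendsto_normal {ι : Type*} {l : Filter ι} [l.NeBot] {h : ι → Fin 6 → Fin 6 → ℝ}
    {v : ι → Fin 5 → Fin 6 → ℝ} {n : ι → Fin 6 → ℝ} {h₀ : Fin 6 → Fin 6 → ℝ}
    {v₀ : Fin 5 → Fin 6 → ℝ} (hf : ∀ᶠ i in l, IsRidgeFrame ε (h i) (v i) (n i))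
    (hh : Tendsto h l (𝓝 h₀)) (hv : Tendsto v l (𝓝 v₀)) (h₀d : (Matrix.of h₀).det ≠ 0)
    (hg : (Matrix.of (leafBlock fun a b => metricInner h₀ (v₀ a) (v₀ b))).det ≠ 0) :
    ∃ n₀, Tendsto n l (𝓝 n₀) ∧ IsRidgeFrame ε h₀ v₀ n₀ := by
  have hhc : ∀ A B, Tendsto (fun i => h i A B) l (𝓝 (h₀ A B)) := fun A B =>
    tendsto_pi_nhds.1 (tendsto_pi_nhds.1 hh A) B
  have hvc := tendsto_pi_nhds.1 hv
  have hgram : ∀ a b, Tendsto (fun i => metricInner (h i) (v i a) (v i b)) l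
      (𝓝 (metricInner h₀ (v₀ a) (v₀ b))) := fun a b => tendsto_metricInner hh (hvc a) (hvc b)
  have hgram₀ : IsGaussNormal fun a b => metricInner h₀ (v₀ a) (v₀ b) := by
    refine ⟨fun a b => ?_, ?_, fun μ => ?_, hg⟩
    · refine tendsto_nhds_unique (hgram a b) ((hgram b a).congr' ?_)
      filter_upwards [hf] with i hi using (hi.gram.symm a b).symm
    · refine tendsto_nhds_unique ((hgram iτ iτ).congr' ?_) tendsto_const_nhds
      filter_upwards [hf] with i hi using hi.gram.tt
    · refine tendsto_nhds_unique ((hgram iτ μ.castSucc).congr' ?_) tendsto_const_nhds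
      filter_upwards [hf] with i hi using hi.gram.tm μ
  set G₀ := (Matrix.of fun a b => metricInner h₀ (v₀ a) (v₀ b)).det with hG₀
  have hG0 : G₀ ≠ 0 := by rw [hG₀, hgram₀.det_eq]; exact hg
  have hGt : Tendsto (fun i => (Matrix.of fun a b => metricInner (h i) (v i a) (v i b)).det) l
      (𝓝 G₀) := tendsto_det (tendsto_pi_nhds.2 fun a => tendsto_pi_nhds.2 fun b => hgram a b)
  have hdt : Tendsto (fun i => (frameMatrix (v i) (n i)).det) l
      (𝓝 (SignType.sign ε * √(G₀ / (Matrix.of h₀).det))) := by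
    refine Tendsto.congr' (f₁ := fun i => (SignType.sign ε : ℝ) *
      √((Matrix.of fun a b => metricInner (h i) (v i a) (v i b)).det / (Matrix.of (h i)).det)) ?_
      (((hGt.div (tendsto_det hh) h₀d).sqrt).const_mul _)
    filter_upwards [hf] with i hi using hi.frame_det_eq.symm
  have hε : ε ≠ 0 := by
    obtain ⟨i, hi⟩ := hf.exists
    rintro rfl
    simpa using hi.oriented
  -- The quotients are squares of frame determinants, so their limit is nonnegative; it is nonzero
  -- since both Gram and metric determinants are. Hence the frame does not degenerate and its
  -- orientation survives the limit.
  have hpos : 0 < G₀ / (Matrix.of h₀).det := by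
    refine lt_of_le_of_ne ?_ (div_ne_zero hG0 h₀d).symm
    refine ge_of_tendsto (hGt.div (tendsto_det hh) h₀d) ?_
    filter_upwards [hf] with i hi
    rw [Pi.div_apply, ← hi.det_sq, mul_div_assoc, div_self hi.det_ne_zero, mul_one]
    positivity
  have hd0 : (SignType.sign ε : ℝ) * √(G₀ / (Matrix.of h₀).det) ≠ 0 := by
    refine mul_ne_zero ?_ (Real.sqrt_pos.2 hpos).ne'
    rcases hε.lt_or_gt with h0 | h0 <;> simp [h0]
  have hlim : HasLim l n := by
    refine HasLim.congr (f := fun i => (frameMatrix (v i) (n i)).det⁻¹ •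
      ((Matrix.of (h i))⁻¹ *ᵥ fun M => (frameMatrix (v i) (Pi.single M 1)).det)) ?_ ?_
    · refine HasLim.pi fun A => ?_
      simp only [Pi.smul_apply, smul_eq_mul, Matrix.mulVec, dotProduct]
      refine HasLim.mul (⟨_, hdt.inv₀ hd0⟩) (HasLim.sum _ fun B => HasLim.mul ?_ ?_)
      · exact HasLim.invMetric (fun A B => ⟨_, hhc A B⟩) ⟨_, h₀d, tendsto_det hh⟩ A B
      · exact ⟨_, tendsto_frameMatrix_det hv tendsto_const_nhds⟩
    · filter_upwards [hf] with i hi using hi.normal_eq.symm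
  obtain ⟨n₀, hn⟩ := hlim
  refine ⟨n₀, hn, ⟨fun A B => ?_, h₀d, hgram₀, fun a => ?_, ?_, ?_⟩⟩
  · refine tendsto_nhds_unique (hhc A B) ((hhc B A).congr' ?_)
    filter_upwards [hf] with i hi using (hi.symm A B).symm
  · refine tendsto_nhds_unique ((tendsto_metricInner hh hn (hvc a)).congr' ?_) tendsto_const_nhds
    filter_upwards [hf] with i hi using hi.normal a
  · refine tendsto_nhds_unique ((tendsto_metricInner hh hn hn).congr' ?_) tendsto_const_nhds
    filter_upwards [hf] with i hi using hi.unit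
  · rw [tendsto_nhds_unique (tendsto_frameMatrix_det hv hn) hdt]
    refine lt_of_le_of_ne ?_ (mul_ne_zero hε hd0).symm
    refine ge_of_tendsto (hdt.const_mul ε) ?_
    filter_upwards [hf] with i hi using hi.oriented.le

theorem eq_smul_add_smul (hf : IsRidgeFrame ε h v n) {w : Fin 6 → ℝ}
    (hw : ∀ μ : Fin 4, metricInner h w (v μ.castSucc) = 0) :
    w = metricInner h w (v iτ) • v iτ + metricInner h w n • n := by
  have h1 := hf.eq_zero (w := w - (metricInner h w (v iτ) • v iτ + metricInner h w n • n))
    (fun a => ?_) ?_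
  · exact sub_eq_zero.1 h1
  · rw [metricInner_sub_left, metricInner_add_left, metricInner_smul_left, metricInner_smul_left,
      hf.normal]
    refine Fin.lastCases ?_ (fun μ => ?_) a
    · have : metricInner h (v iτ) (v iτ) = 1 := hf.gram.tt
      rw [this]; ring
    · have : metricInner h (v iτ) (v μ.castSucc) = 0 := hf.gram.tm μ
      rw [this, hw]; ring
  · rw [metricInner_sub_left, metricInner_add_left, metricInner_smul_left, metricInner_smul_left,
      metricInner_comm hf.symm (v iτ), hf.normal, hf.unit]; ring

end IsRidgeFrame

/-- The determinant is bilinear and alternating in its last two rows, so a change of these rows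
multiplies it by a `2 × 2` determinant. -/
theorem det_two_rows_comb (w : Fin 4 → Fin 6 → ℝ) (x y : Fin 6 → ℝ) (a b c d : ℝ) :
    (frameMatrix (Fin.snoc (α := fun _ => Fin 6 → ℝ) w (a • x + b • y)) (c • x + d • y)).det
      = (a * d - b * c) * (frameMatrix (Fin.snoc (α := fun _ => Fin 6 → ℝ) w x) y).det := by
  let D : (Fin 6 → ℝ) → (Fin 6 → ℝ) → ℝ := fun x y =>
    (frameMatrix (Fin.snoc (α := fun _ => Fin 6 → ℝ) w x) y).det
  have hlast : ∀ x y z, (frameMatrix (Fin.snoc (α := fun _ => Fin 6 → ℝ) w x) y).updateRow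
      (Fin.last 5) z = frameMatrix (Fin.snoc (α := fun _ => Fin 6 → ℝ) w x) z := fun x y z =>
    frameMatrix_updateRow_last z
  have hsnd : ∀ x y z, (frameMatrix (Fin.snoc (α := fun _ => Fin 6 → ℝ) w x) y).updateRow
      (Fin.last 4).castSucc z = frameMatrix (Fin.snoc (α := fun _ => Fin 6 → ℝ) w z) y := by
    intro x y z
    ext A B
    refine Fin.lastCases ?_ (fun A => ?_) A
    · rw [Matrix.updateRow_ne (Fin.castSucc_lt_last _).ne', frameMatrix_last, frameMatrix_last]
    · refine Fin.lastCases ?_ (fun A => ?_) A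
      · rw [Matrix.updateRow_self, frameMatrix_castSucc, Fin.snoc_last]
      · rw [Matrix.updateRow_ne, frameMatrix_castSucc, frameMatrix_castSucc, Fin.snoc_castSucc,
          Fin.snoc_castSucc]
        exact fun h => (Fin.castSucc_lt_last A).ne (Fin.castSucc_injective _ h)
  have add_r : ∀ x y z, D x (y + z) = D x y + D x z := fun x y z => by
    have := Matrix.det_updateRow_add (frameMatrix (Fin.snoc (α := fun _ => Fin 6 → ℝ) w x) 0)
      (Fin.last 5) y z
    simpa only [hlast] using this
  have smul_r : ∀ x y (t : ℝ), D x (t • y) = t * D x y := fun x y t => by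
    have := Matrix.det_updateRow_smul (frameMatrix (Fin.snoc (α := fun _ => Fin 6 → ℝ) w x) 0)
      (Fin.last 5) t y
    simpa only [hlast] using this
  have add_l : ∀ x y z, D (x + y) z = D x z + D y z := fun x y z => by
    have := Matrix.det_updateRow_add (frameMatrix (Fin.snoc (α := fun _ => Fin 6 → ℝ) w 0) z)
      (Fin.last 4).castSucc x y
    simpa only [hsnd] using this
  have smul_l : ∀ x y (t : ℝ), D (t • x) y = t * D x y := fun x y t => by
    have := Matrix.det_updateRow_smul (frameMatrix (Fin.snoc (α := fun _ => Fin 6 → ℝ) w 0) y)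
      (Fin.last 4).castSucc t x
    simpa only [hsnd] using this
  have alt : ∀ x, D x x = 0 := fun x => by
    refine Matrix.det_zero_of_row_eq (i := (Fin.last 4).castSucc) (j := Fin.last 5)
      (Fin.castSucc_lt_last _).ne ?_
    rw [frameMatrix_castSucc, frameMatrix_last, Fin.snoc_last]
  have swap : D y x = -D x y := by
    have := alt (x + y)
    rw [add_l, add_r, add_r, alt, alt] at this
    linarith
  change D (a • x + b • y) (c • x + d • y) = (a * d - b * c) * D x y
  rw [add_l, add_r, add_r, smul_l, smul_l, smul_l, smul_l, smul_r, smul_r, smul_r, smul_r, alt,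
    alt, swap]
  ring

/-- Two oriented hypersurface frames which share the tangent space of the codimension-2 brane
differ by a rotation. -/
theorem IsRidgeFrame.exists_rotation {ε : ℝ} {h : Fin 6 → Fin 6 → ℝ} {v v' : Fin 5 → Fin 6 → ℝ}
    {n n' : Fin 6 → ℝ} (hf : IsRidgeFrame ε h v n) (hf' : IsRidgeFrame ε h v' n')
    (he : ∀ μ : Fin 4, v' μ.castSucc = v μ.castSucc) :
    ∃ a b : ℝ, a ^ 2 + b ^ 2 = 1 ∧ v' iτ = a • v iτ + b • n ∧ n' = -b • v iτ + a • n := by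
  obtain ⟨a, ha⟩ : ∃ a, metricInner h (v' iτ) (v iτ) = a := ⟨_, rfl⟩
  obtain ⟨b, hb⟩ : ∃ b, metricInner h (v' iτ) n = b := ⟨_, rfl⟩
  obtain ⟨c, hc⟩ : ∃ c, metricInner h n' (v iτ) = c := ⟨_, rfl⟩
  obtain ⟨d, hd⟩ : ∃ d, metricInner h n' n = d := ⟨_, rfl⟩
  have e1 : v' iτ = a • v iτ + b • n := by
    rw [← ha, ← hb]
    exact hf.eq_smul_add_smul fun μ => by rw [← he μ]; exact hf'.gram.tm μ
  have e2 : n' = c • v iτ + d • n := by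
    rw [← hc, ← hd]
    exact hf.eq_smul_add_smul fun μ => by rw [← he μ]; exact hf'.normal _
  have f1 : a ^ 2 + b ^ 2 = 1 := by
    have : metricInner h (v' iτ) (v' iτ) = 1 := hf'.gram.tt
    nth_rewrite 1 [e1] at this
    rw [metricInner_add_left, metricInner_smul_left, metricInner_smul_left,
      metricInner_comm hf.symm (v iτ), metricInner_comm hf.symm n, ha, hb] at this
    linarith
  have f2 : c ^ 2 + d ^ 2 = 1 := by
    have := hf'.unit
    nth_rewrite 1 [e2] at this
    rw [metricInner_add_left, metricInner_smul_left, metricInner_smul_left,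
      metricInner_comm hf.symm (v iτ), metricInner_comm hf.symm n, hc, hd] at this
    linarith
  -- The common orientation is used here: it leaves rotations and excludes reflections of the normal
  -- plane.
  have f3 : 0 < a * d - b * c := by
    have g1 : ∀ v : Fin 5 → Fin 6 → ℝ,
        v = Fin.snoc (α := fun _ => Fin 6 → ℝ) (fun μ : Fin 4 => v μ.castSucc) (v iτ) := fun v =>
      (Fin.snoc_init_self (α := fun _ => Fin 6 → ℝ) v).symm
    have g2 : (frameMatrix v' n').det = (a * d - b * c) * (frameMatrix v n).det := by
      rw [g1 v', g1 v]
      simp only [he]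
      rw [e1, e2, det_two_rows_comb]
    have o1 := hf.oriented
    have o2 := hf'.oriented
    rw [g2] at o2
    have : 0 < (a * d - b * c) * (ε * (frameMatrix v n).det) := by linarith
    exact pos_of_mul_pos_left this o1.le
  have f4 : a * c + b * d = 0 := by
    have : metricInner h (v' iτ) n' = 0 := by
      rw [metricInner_comm hf.symm]; exact hf'.normal _
    rw [e1, metricInner_add_left, metricInner_smul_left, metricInner_smul_left,
      metricInner_comm hf.symm (v iτ), metricInner_comm hf.symm n, hc, hd] at this
    linarith
  have f5 : (a * d - b * c) ^ 2 = 1 := by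
    have : (a * d - b * c) ^ 2 = (a ^ 2 + b ^ 2) * (c ^ 2 + d ^ 2) - (a * c + b * d) ^ 2 := by ring
    rw [this, f1, f2, f4]; norm_num
  have f6 : a * d - b * c = 1 := by nlinarith
  -- The sum `(a - d)² + (b + c)²` equals `a² + b² + c² + d² - 2 (ad - bc) = 0`.
  have f7 : d = a := by nlinarith [sq_nonneg (a - d), sq_nonneg (b + c)]
  have f8 : c = -b := by nlinarith [sq_nonneg (a - d), sq_nonneg (b + c)]
  exact ⟨a, b, f1, e1, by rw [e2, f7, f8]⟩

end

/-! ### The oriented angle between the two faces -/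

noncomputable section

theorem neg_sign_mul_arccos {α : ℝ} (h1 : -Real.pi < α) (h2 : α < Real.pi) :
    -(SignType.sign (Real.sin α) : ℝ) * Real.arccos (Real.cos α) = -α := by
  rcases lt_trichotomy α 0 with h | h | h
  · rw [sign_neg (Real.sin_neg_of_neg_of_neg_pi_lt h h1), ← Real.cos_neg α,
      Real.arccos_cos (by linarith) (by linarith)]
    simp
  · simp [h]
  · rw [sign_pos (Real.sin_pos_of_pos_of_lt_pi h h2), Real.arccos_cos h.le h2.le]
    simp

/-- The solutions are `π + α + 2πk`, and `π + α` lies in `(0, 2π)`, so the next smaller one is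
negative. -/
theorem isLeast_sector_angle {α : ℝ} (h1 : -Real.pi < α) (h2 : α < Real.pi) :
    IsLeast {θ : ℝ | 0 < θ ∧ Real.cos θ = -Real.cos α ∧ Real.sin θ = -Real.sin α}
      (Real.pi + α) := by
  refine ⟨⟨by linarith, ?_, ?_⟩, fun θ hθ => ?_⟩
  · rw [add_comm, Real.cos_add_pi]
  · rw [add_comm, Real.sin_add_pi]
  · obtain ⟨h0, hc, hs⟩ := hθ
    have h3 : (θ : Real.Angle) = ((α + Real.pi : ℝ) : Real.Angle) :=
      Real.Angle.cos_sin_inj (by rw [hc, Real.cos_add_pi]) (by rw [hs, Real.sin_add_pi])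
    obtain ⟨k, hk⟩ := Real.Angle.angle_eq_iff_two_pi_dvd_sub.1 h3
    by_contra hlt
    push Not at hlt
    have hk1 : (k : ℝ) < 0 := by
      by_contra hk0
      push Not at hk0
      nlinarith [Real.pi_pos]
    have hk2 : (k : ℝ) ≤ -1 := by
      have : k < 0 := by exact_mod_cast hk1
      exact_mod_cast (by omega : k ≤ -1)
    nlinarith [Real.pi_pos]

/-- The angle by which the frame turns across the codimension-2 brane. -/
theorem exists_ridge_angle {ε : ℝ} {h : Fin 6 → Fin 6 → ℝ} {v v' : Fin 5 → Fin 6 → ℝ}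
    {n n' : Fin 6 → ℝ} (hf : IsRidgeFrame ε h v n) (hf' : IsRidgeFrame ε h v' n')
    (he : ∀ μ : Fin 4, v' μ.castSucc = v μ.castSucc) (hcusp : n ≠ -n') :
    ∃ α : ℝ, -Real.pi < α ∧ α < Real.pi ∧
      v' iτ = Real.cos α • v iτ + Real.sin α • n ∧
      -(SignType.sign (metricInner h (v' iτ) n) : ℝ) * Real.arccos (metricInner h n' n) = -α ∧
      sInf {θ : ℝ | 0 < θ ∧ Real.cos θ • v iτ + Real.sin θ • n = -v' iτ} = Real.pi + α := by
  obtain ⟨a, b, hab, hN, hn⟩ := hf.exists_rotation hf' he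
  set c : ℂ := ⟨a, b⟩ with hc
  have hnorm : ‖c‖ = 1 := by
    rw [Complex.norm_def, Complex.normSq_mk, ← sq, ← sq, hab, Real.sqrt_one]
  have hc0 : c ≠ 0 := fun h0 => by simp [h0] at hnorm
  set α := Complex.arg c with hα
  have hcos : Real.cos α = a := by rw [hα, Complex.cos_arg hc0, hnorm]; simp [hc]
  have hsin : Real.sin α = b := by rw [hα, Complex.sin_arg, hnorm]; simp [hc]
  have i1 : metricInner h (v iτ) (v iτ) = 1 := hf.gram.tt
  have i2 : metricInner h n (v iτ) = 0 := hf.normal iτ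
  have i3 : metricInner h (v iτ) n = 0 := by rw [metricInner_comm hf.symm, i2]
  have hα1 : -Real.pi < α := Complex.neg_pi_lt_arg c
  -- The principal argument already excludes `-π`; the value `π` would make the two normals
  -- opposite, which is a cusp.
  have hα2 : α < Real.pi := by
    refine lt_of_le_of_ne (Complex.arg_le_pi c) fun h0 => hcusp ?_
    change α = Real.pi at h0
    rw [h0, Real.cos_pi] at hcos
    rw [h0, Real.sin_pi] at hsin
    rw [hn, ← hcos, ← hsin]
    simp
  have m1 : metricInner h (v' iτ) n = Real.sin α := by
    rw [hN, metricInner_add_left, metricInner_smul_left, metricInner_smul_left, i3, hf.unit, hsin]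
    ring
  have m2 : metricInner h n' n = Real.cos α := by
    rw [hn, metricInner_add_left, metricInner_smul_left, metricInner_smul_left, i3, hf.unit, hcos]
    ring
  refine ⟨α, hα1, hα2, by rw [hcos, hsin, hN], ?_, ?_⟩
  · rw [m1, m2, neg_sign_mul_arccos hα1 hα2]
  · rw [← (isLeast_sector_angle hα1 hα2).csInf_eq]
    congr 1
    ext θ
    refine and_congr_right fun _ => ⟨fun hθ => ⟨?_, ?_⟩, fun hθ => ?_⟩
    · have := congrArg (fun w => metricInner h w (v iτ)) hθ
      simp only [hN, metricInner_add_left, metricInner_smul_left, metricInner_neg_left, i1, i2]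
        at this
      rw [hcos]; linarith
    · have := congrArg (fun w => metricInner h w n) hθ
      simp only [hN, metricInner_add_left, metricInner_smul_left, metricInner_neg_left, i3,
        hf.unit] at this
      rw [hsin]; linarith
    · rw [hθ.1, hθ.2, hN, hcos, hsin, neg_smul, neg_smul, neg_add]

end

noncomputable section

/-! ### The approximating configurations together with their limit -/

/-- The family `f` completed by its limit `f₀` at the parameter `0`. -/
def withLimit {α : Type*} (f : ℝ → α) (f₀ : α) (ρ : ℝ) : α := if ρ = 0 then f₀ else f ρ

section WithLimit

variable {α : Type*} {f : ℝ → α} {f₀ : α}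

theorem withLimit_zero : withLimit f f₀ 0 = f₀ := if_pos rfl

theorem withLimit_of_ne {ρ : ℝ} (h : ρ ≠ 0) : withLimit f f₀ ρ = f ρ := if_neg h

/-- Uniform convergence together with continuity of the limit gives convergence at moving points.
The parameter may take the value `0`, where the two functions coincide. -/
theorem tendsto_withLimit {ι X E : Type*} [TopologicalSpace X] [PseudoMetricSpace E]
    {F : ℝ → X → E} {F₀ : X → E} {S : Set X} (hF : TendstoUniformlyOn F F₀ (𝓝[>] 0) S)
    {l : Filter ι} {r : ι → ℝ} {x : ι → X} {x₀ : X} (hr : Tendsto r l (𝓝[≥] 0))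
    (hx : Tendsto x l (𝓝 x₀)) (hxS : ∀ᶠ i in l, x i ∈ S) (hc : ContinuousAt F₀ x₀) :
    Tendsto (fun i => withLimit F F₀ (r i) (x i)) l (𝓝 (F₀ x₀)) := by
  have h1 : Tendsto (fun i => F₀ (x i)) l (𝓝 (F₀ x₀)) := hc.tendsto.comp hx
  refine Metric.tendsto_nhds.2 fun e he => ?_
  have h2 : ∀ᶠ ρ in 𝓝[≥] (0 : ℝ), ∀ y ∈ S, dist (withLimit F F₀ ρ y) (F₀ y) < e / 2 := by
    have h3 := Metric.tendstoUniformlyOn_iff.1 hF (e / 2) (by positivity)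
    rw [eventually_nhdsWithin_iff] at h3 ⊢
    filter_upwards [h3] with ρ hρ hρ0 y hy
    rcases eq_or_lt_of_le (show (0 : ℝ) ≤ ρ from hρ0) with h | h
    · rw [← h, withLimit_zero, dist_self]; positivity
    · rw [withLimit_of_ne h.ne', dist_comm]; exact hρ h y hy
  filter_upwards [hr.eventually h2, hxS, Metric.tendsto_nhds.1 h1 (e / 2) (by positivity)]
    with i hi hiS hi'
  calc dist (withLimit F F₀ (r i) (x i)) (F₀ x₀)
      ≤ dist (withLimit F F₀ (r i) (x i)) (F₀ (x i)) + dist (F₀ (x i)) (F₀ x₀) :=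
        dist_triangle _ _ _
    _ < e := by linarith [hi _ hiS]

end WithLimit

/-- The filter `𝓝[≥] 0` contains the base point, so a limit along it can only be the value at `0`.
Existence of a limit, which the jet calculus supplies, thereby also identifies it with the limit
configuration. -/
theorem HasLim.tendsto_right {E : Type*} [TopologicalSpace E] [T2Space E] {f : ℝ → E}
    (hf : HasLim (𝓝[≥] 0) f) : Tendsto f (𝓝[>] 0) (𝓝 (f 0)) := by
  obtain ⟨y, hy⟩ := hf
  have h1 : f 0 = y := tendsto_nhds_unique (tendsto_pure_nhds f 0)
    (hy.mono_left (pure_le_nhdsWithin (mem_Ici.2 le_rfl)))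
  rw [h1]
  exact hy.mono_left (nhdsWithin_mono _ Ioi_subset_Ici_self)

theorem pd_eq_iteratedFDeriv {d : ℕ} {F : Type*} [NormedAddCommGroup F] [NormedSpace ℝ F]
    {i : Fin d} {f : (Fin d → ℝ) → F} {x : Fin d → ℝ} (h : DifferentiableAt ℝ f x) :
    pd i f x = iteratedFDeriv ℝ 1 f x fun _ => Pi.single i 1 := by
  rw [pd_eq_fderiv h, iteratedFDeriv_one_apply]

theorem tendsto_of_iteratedFDeriv_zero {ι E F : Type*} [NormedAddCommGroup E] [NormedSpace ℝ E]
    [NormedAddCommGroup F] [NormedSpace ℝ F] {l : Filter ι} {f : ι → E → F} {x : ι → E}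
    {f₀ : E → F} {x₀ : E}
    (h : Tendsto (fun i => iteratedFDeriv ℝ 0 (f i) (x i)) l (𝓝 (iteratedFDeriv ℝ 0 f₀ x₀))) :
    Tendsto (fun i => f i (x i)) l (𝓝 (f₀ x₀)) := by
  have := ((ContinuousMultilinearMap.apply ℝ (fun _ : Fin 0 => E) F 0).continuous.tendsto _).comp h
  simpa [Function.comp_def] using this

theorem tendsto_pd_of_iteratedFDeriv_one {ι F : Type*} {d : ℕ} [NormedAddCommGroup F]
    [NormedSpace ℝ F] {l : Filter ι} {f : ι → (Fin d → ℝ) → F} {x : ι → Fin d → ℝ} {D}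
    (hf : ∀ᶠ i in l, DifferentiableAt ℝ (f i) (x i))
    (h : Tendsto (fun i => iteratedFDeriv ℝ 1 (f i) (x i)) l (𝓝 D)) (a : Fin d) :
    Tendsto (fun i => pd a (f i) (x i)) l (𝓝 (D fun _ => Pi.single a 1)) := by
  have h1 := ((ContinuousMultilinearMap.apply ℝ (fun _ : Fin 1 => Fin d → ℝ) F
    fun _ => Pi.single a 1).continuous.tendsto _).comp h
  refine h1.congr' ?_
  filter_upwards [hf] with i hi
  rw [pd_eq_iteratedFDeriv hi]; rfl

theorem mem_slab_gnc {U : Set (Fin 4 → ℝ)} {l : ℝ} {χ : Fin 4 → ℝ} {τ : ℝ} :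
    gnc χ τ ∈ slab U l ↔ χ ∈ U ∧ |τ| < l := by
  rw [slab, mem_ofPred_eq, init_gnc, gnc_last]

theorem continuous_init : Continuous fun x : Fin 5 → ℝ => (Fin.init x : Fin 4 → ℝ) :=
  continuous_pi fun μ => continuous_apply μ.castSucc

theorem isOpen_slab {U : Set (Fin 4 → ℝ)} (hU : IsOpen U) (l : ℝ) : IsOpen (slab U l) :=
  (hU.preimage continuous_init).inter
    (isOpen_lt (continuous_abs.comp (continuous_apply iτ)) continuous_const)

theorem leafBlock_inducedMetric (g : MetricField 6) (φ : (Fin 5 → ℝ) → (Fin 6 → ℝ))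
    (x : Fin 5 → ℝ) :
    leafBlock (inducedMetric g φ x) = inducedMetric g (leaf φ (x iτ)) (Fin.init x) := by
  have := congrFun (leafMetric_inducedMetric g φ (x iτ)) (Fin.init x)
  rw [leafMetric, gnc_init_last] at this
  exact this

/-- The points at which the configuration with parameter `ρ` is smooth; `ρ = 0` stands for the
limit configuration. -/
structure IsRegularPoint (U : Set (Fin 4 → ℝ)) (l ρ : ℝ) (x : Fin 5 → ℝ) : Prop where
  mem : x ∈ slab U l
  nonneg : 0 ≤ ρ
  lt : ρ < l
  ne : ρ = 0 → x iτ ≠ 0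

namespace ThinLimitAnsatz

variable {N : ℕ} {U : Set (Fin 4 → ℝ)} {l : ℝ} {V : Set (Fin 6 → ℝ)} {ε : ℝ}
  {g : ℝ → MetricField 6} {φ n : ℝ → (Fin 5 → ℝ) → (Fin 6 → ℝ)}
  {g₀ : MetricField 6} {φ₀ n₀ : (Fin 5 → ℝ) → (Fin 6 → ℝ)}

theorem eventually_lt (h : ThinLimitAnsatz N U l V ε g φ n g₀ φ₀ n₀) {ι : Type*} {L : Filter ι}
    {r : ι → ℝ} (hr : Tendsto r L (𝓝[≥] 0)) : ∀ᶠ i in L, 0 ≤ r i ∧ r i < l := by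
  have h1 : ∀ᶠ ρ in 𝓝[≥] (0 : ℝ), 0 ≤ ρ ∧ ρ < l := by
    filter_upwards [self_mem_nhdsWithin, mem_nhdsWithin_of_mem_nhds (Iio_mem_nhds h.l_pos)]
      with ρ h1 h2 using ⟨h1, h2⟩
  exact hr.eventually h1

theorem metric_contDiffAt (h : ThinLimitAnsatz N U l V ε g φ n g₀ φ₀ n₀) {ρ : ℝ} (h0 : 0 ≤ ρ)
    (hl : ρ < l) {X : Fin 6 → ℝ} (hX : X ∈ V) : ContDiffAt ℝ N (withLimit g g₀ ρ) X := by
  rcases h0.eq_or_lt with h1 | h1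
  · subst h1
    rw [withLimit_zero]
    exact h.lim_metric_smooth.contDiffAt (h.isOpen_V.mem_nhds hX)
  · rw [withLimit_of_ne h1.ne']
    exact (h.metric_smooth ρ ⟨h1, hl⟩).contDiffAt (h.isOpen_V.mem_nhds hX)

theorem metric_isLorentzian (h : ThinLimitAnsatz N U l V ε g φ n g₀ φ₀ n₀) {ρ : ℝ} (h0 : 0 ≤ ρ)
    (hl : ρ < l) {X : Fin 6 → ℝ} (hX : X ∈ V) : IsLorentzian (withLimit g g₀ ρ X) := by
  rcases h0.eq_or_lt with h1 | h1
  · subst h1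
    rw [withLimit_zero]
    exact h.lim_metric_lorentzian X hX
  · rw [withLimit_of_ne h1.ne']
    exact h.metric_lorentzian ρ ⟨h1, hl⟩ X hX

theorem brane_mem (h : ThinLimitAnsatz N U l V ε g φ n g₀ φ₀ n₀) {ρ : ℝ} (h0 : 0 ≤ ρ)
    (hl : ρ < l) {x : Fin 5 → ℝ} (hx : x ∈ slab U l) : withLimit φ φ₀ ρ x ∈ V := by
  rcases h0.eq_or_lt with h1 | h1
  · subst h1
    rw [withLimit_zero]
    exact h.lim_brane_mapsTo hx
  · rw [withLimit_of_ne h1.ne']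
    exact h.brane_mapsTo ρ ⟨h1, hl⟩ hx

theorem leaf_isLorentzian (h : ThinLimitAnsatz N U l V ε g φ n g₀ φ₀ n₀) {ρ : ℝ} (h0 : 0 ≤ ρ)
    (hl : ρ < l) {χ : Fin 4 → ℝ} (hχ : χ ∈ U) {τ : ℝ} (hτ : |τ| < l) :
    IsLorentzian (inducedMetric (withLimit g g₀ ρ) (leaf (withLimit φ φ₀ ρ) τ) χ) := by
  rcases h0.eq_or_lt with h1 | h1
  · subst h1
    rw [withLimit_zero, withLimit_zero]
    exact h.lim_leaf_lorentzian χ hχ τ hτ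
  · rw [withLimit_of_ne h1.ne', withLimit_of_ne h1.ne']
    exact h.leaf_lorentzian ρ ⟨h1, hl⟩ χ hχ τ hτ

theorem contDiff_gnc (τ : ℝ) {k : WithTop ℕ∞} : ContDiff ℝ k fun χ : Fin 4 → ℝ => gnc χ τ := by
  refine contDiff_pi.2 fun a => ?_
  refine Fin.lastCases ?_ (fun μ => ?_) a
  · simpa only [gnc_last] using contDiff_const
  · simpa only [gnc_castSucc] using contDiff_apply ℝ ℝ μ

theorem leaf_contDiffAt (h : ThinLimitAnsatz N U l V ε g φ n g₀ φ₀ n₀) {ρ : ℝ} (h0 : 0 ≤ ρ)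
    (hl : ρ < l) {χ : Fin 4 → ℝ} (hχ : χ ∈ U) {τ : ℝ} (hτ : |τ| < l) :
    ContDiffAt ℝ N (leaf (withLimit φ φ₀ ρ) τ) χ := by
  rcases h0.eq_or_lt with h1 | h1
  · subst h1
    rw [withLimit_zero]
    exact (h.lim_brane_smooth_par τ hτ).contDiffAt (h.isOpen_U.mem_nhds hχ)
  · rw [withLimit_of_ne h1.ne']
    have h2 : ContDiffAt ℝ N (φ ρ) (gnc χ τ) := (h.brane_smooth ρ ⟨h1, hl⟩).contDiffAt
      ((isOpen_slab h.isOpen_U l).mem_nhds (mem_slab_gnc.2 ⟨hχ, hτ⟩))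
    exact h2.comp χ (contDiff_gnc τ).contDiffAt

theorem isOpen_slab_diff (h : ThinLimitAnsatz N U l V ε g φ n g₀ φ₀ n₀) :
    IsOpen (slab U l ∩ {x | x iτ ≠ 0}) :=
  (isOpen_slab h.isOpen_U l).inter (isOpen_ne_fun (continuous_apply iτ) continuous_const)

theorem eventually_isRegularPoint (h : ThinLimitAnsatz N U l V ε g φ n g₀ φ₀ n₀) {ρ : ℝ}
    {x : Fin 5 → ℝ} (hx : IsRegularPoint U l ρ x) : ∀ᶠ y in 𝓝 x, IsRegularPoint U l ρ y := by
  by_cases h0 : ρ = 0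
  · filter_upwards [h.isOpen_slab_diff.mem_nhds ⟨hx.mem, hx.ne h0⟩] with y hy
    exact ⟨hy.1, hx.nonneg, hx.lt, fun _ => hy.2⟩
  · filter_upwards [(isOpen_slab h.isOpen_U l).mem_nhds hx.mem] with y hy
    exact ⟨hy, hx.nonneg, hx.lt, fun h => absurd h h0⟩

theorem isOpen_regular (h : ThinLimitAnsatz N U l V ε g φ n g₀ φ₀ n₀) (ρ : ℝ) :
    IsOpen {x | IsRegularPoint U l ρ x} :=
  isOpen_iff_mem_nhds.2 fun _ hx => h.eventually_isRegularPoint hx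

theorem brane_contDiffAt (h : ThinLimitAnsatz N U l V ε g φ n g₀ φ₀ n₀) {ρ : ℝ}
    {x : Fin 5 → ℝ} (hx : IsRegularPoint U l ρ x) : ContDiffAt ℝ N (withLimit φ φ₀ ρ) x := by
  rcases hx.nonneg.eq_or_lt with h1 | h1
  · rw [← h1, withLimit_zero]
    exact h.lim_brane_smooth.contDiffAt (h.isOpen_slab_diff.mem_nhds ⟨hx.mem, hx.ne h1.symm⟩)
  · rw [withLimit_of_ne h1.ne']
    exact (h.brane_smooth ρ ⟨h1, hx.lt⟩).contDiffAt ((isOpen_slab h.isOpen_U l).mem_nhds hx.mem)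

/-! #### Convergence of the jets -/

theorem tendsto_metric_jet (h : ThinLimitAnsatz N U l V ε g φ n g₀ φ₀ n₀) {ι : Type*}
    {L : Filter ι} {r : ι → ℝ} {X : ι → Fin 6 → ℝ} {X₀ : Fin 6 → ℝ} (hr : Tendsto r L (𝓝[≥] 0))
    (hX : Tendsto X L (𝓝 X₀)) (hX₀ : X₀ ∈ V) {k : ℕ} (hk : k ≤ N) :
    Tendsto (fun i => iteratedFDeriv ℝ k (withLimit g g₀ (r i)) (X i)) L
      (𝓝 (iteratedFDeriv ℝ k g₀ X₀)) := by
  have h1 : ContinuousAt (iteratedFDeriv ℝ k g₀) X₀ :=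
    (h.lim_metric_smooth.contDiffAt (h.isOpen_V.mem_nhds hX₀)).continuousAt_iteratedFDeriv
      (by exact_mod_cast hk)
  have h2 := tendsto_withLimit (h.metric_conv k hk) hr hX (hX.eventually (h.isOpen_V.mem_nhds hX₀))
    h1
  refine h2.congr fun i => ?_
  unfold withLimit
  split_ifs <;> rfl

theorem convJet_metric (h : ThinLimitAnsatz N U l V ε g φ n g₀ φ₀ n₀) {ι : Type*}
    {L : Filter ι} {r : ι → ℝ} {X : ι → Fin 6 → ℝ} {X₀ : Fin 6 → ℝ} (hr : Tendsto r L (𝓝[≥] 0))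
    (hX : Tendsto X L (𝓝 X₀)) (hX₀ : X₀ ∈ V) {k : ℕ} (hk : k ≤ N) (A B : Fin 6) :
    ConvJet k L (fun i Y => withLimit g g₀ (r i) Y A B) X := by
  refine (ConvJet.of_iteratedFDeriv ?_ fun j hj =>
    ⟨_, h.tendsto_metric_jet hr hX hX₀ (hj.trans hk)⟩ :
      ConvJet k L (fun i => withLimit g g₀ (r i)) X).component₂ A B
  filter_upwards [h.eventually_lt hr, hX.eventually (h.isOpen_V.mem_nhds hX₀)] with i hi hi'
  exact (h.metric_contDiffAt hi.1 hi.2 hi').of_le (by exact_mod_cast hk)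

theorem tendsto_metric (h : ThinLimitAnsatz N U l V ε g φ n g₀ φ₀ n₀) {ι : Type*}
    {L : Filter ι} {r : ι → ℝ} {X : ι → Fin 6 → ℝ} {X₀ : Fin 6 → ℝ} (hr : Tendsto r L (𝓝[≥] 0))
    (hX : Tendsto X L (𝓝 X₀)) (hX₀ : X₀ ∈ V) :
    Tendsto (fun i => withLimit g g₀ (r i) (X i)) L (𝓝 (g₀ X₀)) :=
  tendsto_of_iteratedFDeriv_zero (h.tendsto_metric_jet hr hX hX₀ (Nat.zero_le _))

theorem hasDetLim_metric (h : ThinLimitAnsatz N U l V ε g φ n g₀ φ₀ n₀) {ι : Type*}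
    {L : Filter ι} {r : ι → ℝ} {X : ι → Fin 6 → ℝ} {X₀ : Fin 6 → ℝ} (hr : Tendsto r L (𝓝[≥] 0))
    (hX : Tendsto X L (𝓝 X₀)) (hX₀ : X₀ ∈ V) :
    HasDetLim L fun i => withLimit g g₀ (r i) (X i) :=
  ⟨_, (h.lim_metric_lorentzian X₀ hX₀).det_ne_zero, tendsto_det (h.tendsto_metric hr hX hX₀)⟩

/-- A uniform limit of uniformly Lipschitz maps is continuous. This gives joint continuity across `τ
= 0`, where the limit brane is only assumed smooth along the leaf. -/
theorem continuousAt_parDeriv (h : ThinLimitAnsatz N U l V ε g φ n g₀ φ₀ n₀) {x₀ : Fin 5 → ℝ}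
    (hx₀ : x₀ ∈ slab U l) {k : ℕ} (hk : k ≤ N) : ContinuousAt (parDeriv k φ₀) x₀ := by
  obtain ⟨C, hC⟩ := h.brane_lipschitz
  have h1 : ContinuousOn (parDeriv k φ₀) (slab U l) := (h.brane_conv_par k hk).continuousOn
    (hC.mono fun ρ hρ => (hρ k hk).continuousOn).frequently
  exact h1.continuousAt ((isOpen_slab h.isOpen_U l).mem_nhds hx₀)

theorem tendsto_leaf_jet (h : ThinLimitAnsatz N U l V ε g φ n g₀ φ₀ n₀) {ι : Type*}
    {L : Filter ι} {r : ι → ℝ} {x : ι → Fin 5 → ℝ} {x₀ : Fin 5 → ℝ} (hr : Tendsto r L (𝓝[≥] 0))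
    (hx : Tendsto x L (𝓝 x₀)) (hx₀ : x₀ ∈ slab U l) {k : ℕ} (hk : k ≤ N) :
    Tendsto (fun i => iteratedFDeriv ℝ k (leaf (withLimit φ φ₀ (r i)) (x i iτ)) (Fin.init (x i))) L
      (𝓝 (iteratedFDeriv ℝ k (leaf φ₀ (x₀ iτ)) (Fin.init x₀))) := by
  have h2 := tendsto_withLimit (h.brane_conv_par k hk) hr hx
    (hx.eventually ((isOpen_slab h.isOpen_U l).mem_nhds hx₀)) (h.continuousAt_parDeriv hx₀ hk)
  refine h2.congr fun i => ?_
  unfold withLimit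
  split_ifs <;> rfl

theorem convJet_leaf (h : ThinLimitAnsatz N U l V ε g φ n g₀ φ₀ n₀) {ι : Type*}
    {L : Filter ι} {r : ι → ℝ} {x : ι → Fin 5 → ℝ} {x₀ : Fin 5 → ℝ} (hr : Tendsto r L (𝓝[≥] 0))
    (hx : Tendsto x L (𝓝 x₀)) (hx₀ : x₀ ∈ slab U l) {k : ℕ} (hk : k ≤ N) :
    ConvJet k L (fun i => leaf (withLimit φ φ₀ (r i)) (x i iτ)) fun i => Fin.init (x i) := by
  refine ConvJet.of_iteratedFDeriv ?_ fun j hj => ⟨_, h.tendsto_leaf_jet hr hx hx₀ (hj.trans hk)⟩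
  filter_upwards [h.eventually_lt hr, hx.eventually ((isOpen_slab h.isOpen_U l).mem_nhds hx₀)]
    with i hi hi'
  exact (h.leaf_contDiffAt hi.1 hi.2 hi'.1 hi'.2).of_le (by exact_mod_cast hk)

theorem tendsto_brane (h : ThinLimitAnsatz N U l V ε g φ n g₀ φ₀ n₀) {ι : Type*}
    {L : Filter ι} {r : ι → ℝ} {x : ι → Fin 5 → ℝ} {x₀ : Fin 5 → ℝ} (hr : Tendsto r L (𝓝[≥] 0))
    (hx : Tendsto x L (𝓝 x₀)) (hx₀ : x₀ ∈ slab U l) :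
    Tendsto (fun i => withLimit φ φ₀ (r i) (x i)) L (𝓝 (φ₀ x₀)) := by
  have := tendsto_of_iteratedFDeriv_zero (h.tendsto_leaf_jet hr hx hx₀ (Nat.zero_le _))
  simpa only [leaf, gnc_init_last] using this

theorem pd_castSucc_eq_leaf (f : (Fin 5 → ℝ) → (Fin 6 → ℝ)) (μ : Fin 4) (x : Fin 5 → ℝ) :
    pd μ.castSucc f x = pd μ (leaf f (x iτ)) (Fin.init x) := by
  conv_lhs => rw [← gnc_init_last x]
  exact pd_castSucc μ f _ _

theorem tendsto_pd_castSucc (h : ThinLimitAnsatz N U l V ε g φ n g₀ φ₀ n₀) (hN : 3 ≤ N)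
    {ι : Type*} {L : Filter ι} {r : ι → ℝ} {x : ι → Fin 5 → ℝ} {x₀ : Fin 5 → ℝ}
    (hr : Tendsto r L (𝓝[≥] 0)) (hx : Tendsto x L (𝓝 x₀)) (hx₀ : x₀ ∈ slab U l) (μ : Fin 4) :
    Tendsto (fun i => pd μ.castSucc (withLimit φ φ₀ (r i)) (x i)) L
      (𝓝 (pd μ (leaf φ₀ (x₀ iτ)) (Fin.init x₀))) := by
  simp only [pd_castSucc_eq_leaf]
  have h0 : DifferentiableAt ℝ (leaf φ₀ (x₀ iτ)) (Fin.init x₀) :=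
    ((h.lim_brane_smooth_par _ hx₀.2).contDiffAt
      (h.isOpen_U.mem_nhds hx₀.1)).differentiableAt (by norm_cast; omega)
  rw [pd_eq_iteratedFDeriv h0]
  refine tendsto_pd_of_iteratedFDeriv_one ?_ (h.tendsto_leaf_jet hr hx hx₀ (by omega)) μ
  filter_upwards [h.eventually_lt hr, hx.eventually ((isOpen_slab h.isOpen_U l).mem_nhds hx₀)]
    with i hi hi'
  exact (h.leaf_contDiffAt hi.1 hi.2 hi'.1 hi'.2).differentiableAt (by norm_cast; omega)

/-- Away from the codimension-2 brane all derivatives converge. -/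
theorem tendsto_brane_jet (h : ThinLimitAnsatz N U l V ε g φ n g₀ φ₀ n₀) {x : Fin 5 → ℝ}
    (hx : x ∈ slab U l) (hx0 : x iτ ≠ 0) {k : ℕ} (hk : k ≤ N) :
    Tendsto (fun ρ => iteratedFDeriv ℝ k (withLimit φ φ₀ ρ) x) (𝓝[≥] 0)
      (𝓝 (iteratedFDeriv ℝ k φ₀ x)) := by
  refine Metric.tendsto_nhds.2 fun e he => ?_
  obtain ⟨δ, hδ, H⟩ := h.brane_conv_ext k hk e he
  have h1 : ∀ᶠ ρ in 𝓝[≥] (0 : ℝ), ρ < min δ |x iτ| :=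
    mem_nhdsWithin_of_mem_nhds (Iio_mem_nhds (lt_min hδ (abs_pos.2 hx0)))
  filter_upwards [h1, self_mem_nhdsWithin] with ρ hρ hρ0
  rcases (show (0 : ℝ) ≤ ρ from hρ0).eq_or_lt with h2 | h2
  · rw [← h2, withLimit_zero, dist_self]; exact he
  · rw [withLimit_of_ne h2.ne', dist_eq_norm]
    exact H ρ ⟨h2, hρ.trans_le (min_le_left _ _)⟩ x hx (hρ.trans_le (min_le_right _ _)).le

theorem convJet_brane (h : ThinLimitAnsatz N U l V ε g φ n g₀ φ₀ n₀) {x : Fin 5 → ℝ}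
    (hx : x ∈ slab U l) (hx0 : x iτ ≠ 0) {k : ℕ} (hk : k ≤ N) :
    ConvJet k (𝓝[≥] 0) (fun ρ => withLimit φ φ₀ ρ) fun _ => x := by
  refine ConvJet.of_iteratedFDeriv ?_ fun j hj => ⟨_, h.tendsto_brane_jet hx hx0 (hj.trans hk)⟩
  filter_upwards [h.eventually_lt tendsto_id] with ρ hρ
  exact (h.brane_contDiffAt ⟨hx, hρ.1, hρ.2, fun _ => hx0⟩).of_le (by exact_mod_cast hk)

/-! #### Frames -/

theorem gauss_lim (h : ThinLimitAnsatz N U l V ε g φ n g₀ φ₀ n₀) (hN : 3 ≤ N) {x : Fin 5 → ℝ}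
    (hx : x ∈ slab U l) (hx0 : x iτ ≠ 0) (a b : Fin 5) :
    Tendsto (fun ρ => inducedMetric (g ρ) (φ ρ) x a b) (𝓝[>] 0)
      (𝓝 (inducedMetric g₀ φ₀ x a b)) := by
  have h1 : HasLim (𝓝[≥] 0) fun ρ =>
      inducedMetric (withLimit g g₀ ρ) (withLimit φ φ₀ ρ) x a b :=
    (ConvJet.inducedMetric (k := 0) (h.convJet_metric tendsto_id
      (h.tendsto_brane tendsto_id tendsto_const_nhds hx) (h.lim_brane_mapsTo hx) (Nat.zero_le _))
      (h.convJet_brane hx hx0 (by omega)) a b).hasLim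
  have h2 := h1.tendsto_right
  rw [withLimit_zero, withLimit_zero] at h2
  refine h2.congr' ?_
  filter_upwards [self_mem_nhdsWithin] with ρ hρ
  rw [withLimit_of_ne (ne_of_gt hρ), withLimit_of_ne (ne_of_gt hρ)]

/-- For the limit configuration the gauge conditions are not assumed but inherited pointwise from
the approximating branes. Nondegeneracy comes from the Lorentzian leaves. -/
theorem isGaussNormal (h : ThinLimitAnsatz N U l V ε g φ n g₀ φ₀ n₀) (hN : 3 ≤ N) {ρ : ℝ}
    {x : Fin 5 → ℝ} (hx : IsRegularPoint U l ρ x) :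
    IsGaussNormal (inducedMetric (withLimit g g₀ ρ) (withLimit φ φ₀ ρ) x) := by
  refine ⟨fun a b => metricInner_comm (h.metric_isLorentzian hx.nonneg hx.lt
    (h.brane_mem hx.nonneg hx.lt hx.mem)).symm _ _, ?_, fun μ => ?_, ?_⟩
  · rcases hx.nonneg.eq_or_lt with h1 | h1
    · rw [← h1, withLimit_zero, withLimit_zero]
      refine tendsto_nhds_unique (h.gauss_lim hN hx.mem (hx.ne h1.symm) iτ iτ)
        (tendsto_const_nhds.congr' ?_)
      filter_upwards [Ioo_mem_nhdsGT h.l_pos] with ρ' hρ' using (h.gauss_tt ρ' hρ' x hx.mem).symm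
    · rw [withLimit_of_ne h1.ne', withLimit_of_ne h1.ne']
      exact h.gauss_tt ρ ⟨h1, hx.lt⟩ x hx.mem
  · rcases hx.nonneg.eq_or_lt with h1 | h1
    · rw [← h1, withLimit_zero, withLimit_zero]
      refine tendsto_nhds_unique (h.gauss_lim hN hx.mem (hx.ne h1.symm) iτ μ.castSucc)
        (tendsto_const_nhds.congr' ?_)
      filter_upwards [Ioo_mem_nhdsGT h.l_pos] with ρ' hρ'
        using (h.gauss_tm ρ' hρ' x hx.mem μ).symm
    · rw [withLimit_of_ne h1.ne', withLimit_of_ne h1.ne']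
      exact h.gauss_tm ρ ⟨h1, hx.lt⟩ x hx.mem μ
  · rw [leafBlock_inducedMetric]
    exact (h.leaf_isLorentzian hx.nonneg hx.lt hx.mem.1 hx.mem.2).det_ne_zero

theorem isRidgeFrame (h : ThinLimitAnsatz N U l V ε g φ n g₀ φ₀ n₀) (hN : 3 ≤ N) {ρ : ℝ}
    {x : Fin 5 → ℝ} (hx : IsRegularPoint U l ρ x) :
    IsRidgeFrame ε (withLimit g g₀ ρ (withLimit φ φ₀ ρ x))
      (fun a => pd a (withLimit φ φ₀ ρ) x) (withLimit n n₀ ρ x) := by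
  have hL := h.metric_isLorentzian hx.nonneg hx.lt (h.brane_mem hx.nonneg hx.lt hx.mem)
  have hn : IsOrientedUnitNormal ε (withLimit g g₀ ρ) (withLimit φ φ₀ ρ) x
      (withLimit n n₀ ρ x) := by
    rcases hx.nonneg.eq_or_lt with h1 | h1
    · rw [← h1, withLimit_zero, withLimit_zero, withLimit_zero]
      exact h.lim_normal x hx.mem (hx.ne h1.symm)
    · rw [withLimit_of_ne h1.ne', withLimit_of_ne h1.ne', withLimit_of_ne h1.ne']
      exact h.normal ρ ⟨h1, hx.lt⟩ x hx.mem
  exact ⟨hL.symm, hL.det_ne_zero, h.isGaussNormal hN hx, hn.normal, hn.unit, hn.oriented⟩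

/-- The frame at the codimension-2 brane with `τ`-direction `v`. -/
def ridgeVectors (φ₀ : (Fin 5 → ℝ) → (Fin 6 → ℝ)) (χ : Fin 4 → ℝ) (v : Fin 6 → ℝ) :
    Fin 5 → Fin 6 → ℝ :=
  Fin.snoc (α := fun _ => Fin 6 → ℝ) (fun μ => pd μ (leaf φ₀ 0) χ) v

theorem ridgeVectors_castSucc (χ : Fin 4 → ℝ) (v : Fin 6 → ℝ) (μ : Fin 4) :
    ridgeVectors φ₀ χ v μ.castSucc = pd μ (leaf φ₀ 0) χ :=
  Fin.snoc_castSucc (α := fun _ => Fin 6 → ℝ) _ _ _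

theorem ridgeVectors_last (χ : Fin 4 → ℝ) (v : Fin 6 → ℝ) : ridgeVectors φ₀ χ v iτ = v :=
  Fin.snoc_last (α := fun _ => Fin 6 → ℝ) _ _

/-- Near the codimension-2 brane the normals converge whenever the tangent vectors `∂_τ φ` do. -/
theorem exists_tendsto_normal (h : ThinLimitAnsatz N U l V ε g φ n g₀ φ₀ n₀) (hN : 3 ≤ N)
    {ι : Type*} {L : Filter ι} [L.NeBot] {r : ι → ℝ} {x : ι → Fin 5 → ℝ} {χ : Fin 4 → ℝ}
    (hχ : χ ∈ U) (hr : Tendsto r L (𝓝[≥] 0)) (hx : Tendsto x L (𝓝 (gnc χ 0)))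
    (hreg : ∀ᶠ i in L, r i = 0 → x i iτ ≠ 0) {v : Fin 6 → ℝ}
    (hv : Tendsto (fun i => pd iτ (withLimit φ φ₀ (r i)) (x i)) L (𝓝 v)) :
    ∃ w, Tendsto (fun i => withLimit n n₀ (r i) (x i)) L (𝓝 w) ∧
      IsRidgeFrame ε (g₀ (leaf φ₀ 0 χ)) (ridgeVectors φ₀ χ v) w := by
  have hx₀ : gnc χ 0 ∈ slab U l := mem_slab_gnc.2 ⟨hχ, by simpa using h.l_pos⟩
  have hV : leaf φ₀ 0 χ ∈ V := h.lim_brane_mapsTo hx₀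
  refine IsRidgeFrame.exists_tendsto_normal
    (h := fun i => withLimit g g₀ (r i) (withLimit φ φ₀ (r i) (x i)))
    (v := fun i a => pd a (withLimit φ φ₀ (r i)) (x i)) ?_
    (h.tendsto_metric hr (h.tendsto_brane hr hx hx₀) hV) (tendsto_pi_nhds.2 fun a => ?_)
    (h.lim_metric_lorentzian _ hV).det_ne_zero ?_
  · filter_upwards [h.eventually_lt hr, hx.eventually ((isOpen_slab h.isOpen_U l).mem_nhds hx₀),
      hreg] with i h1 h2 h3
    exact h.isRidgeFrame hN ⟨h2, h1.1, h1.2, h3⟩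
  · refine Fin.lastCases ?_ (fun μ => ?_) a
    · rw [ridgeVectors_last]; exact hv
    · rw [ridgeVectors_castSucc]
      have := h.tendsto_pd_castSucc hN hr hx hx₀ μ
      rwa [gnc_last, init_gnc] at this
  · have h1 := (h.lim_leaf_lorentzian χ hχ 0 (by simpa using h.l_pos)).det_ne_zero
    have h2 : (leafBlock fun a b => metricInner (g₀ (leaf φ₀ 0 χ)) (ridgeVectors φ₀ χ v a)
        (ridgeVectors φ₀ χ v b)) = inducedMetric g₀ (leaf φ₀ 0) χ := by
      funext μ ν
      simp only [leafBlock, ridgeVectors_castSucc, inducedMetric]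
    rw [h2]; exact h1

end ThinLimitAnsatz

end

/-! ### One-sided limits at the ridge and limits away from it -/

noncomputable section

theorem HasLim.tendsto_pure {ι E : Type*} [TopologicalSpace E] [T2Space E] {L : Filter ι}
    {f : ι → E} (hf : HasLim L f) {i₀ : ι} (hi : pure i₀ ≤ L) : Tendsto f L (𝓝 (f i₀)) := by
  obtain ⟨y, hy⟩ := hf
  rwa [tendsto_nhds_unique (tendsto_pure_nhds f i₀) (hy.mono_left hi)]

/-- The statement serves two purposes: convergence for `ρ → 0⁺` at a fixed point, with `i₀` the
limit configuration, and continuity in the point at fixed `ρ`. Convergence of the normals is derived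
from the frames in both cases. -/
theorem tendsto_israelLHS {ι : Type*} {L : Filter ι} {ε : ℝ} {g : ι → MetricField 6}
    {φ n : ι → (Fin 5 → ℝ) → (Fin 6 → ℝ)} {x : ι → Fin 5 → ℝ}
    (hg : ∀ A B, ConvJet 2 L (fun i Y => g i Y A B) fun i => φ i (x i)) (hφ : ConvJet 3 L φ x)
    (hf : ∀ᶠ i in L, IsRidgeFrame ε (g i (φ i (x i))) (fun a => pd a (φ i) (x i)) (n i (x i)))
    {i₀ : ι} (hi₀ : pure i₀ ≤ L) (M₆ M₅ : ℝ) (a b : Fin 5) :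
    Tendsto (fun i => n i (x i)) L (𝓝 (n i₀ (x i₀))) ∧
    Tendsto (fun i => israelLHS M₆ M₅ (g i) (φ i) (n i) (x i) a b) L
      (𝓝 (israelLHS M₆ M₅ (g i₀) (φ i₀) (n i₀) (x i₀) a b)) := by
  have hne : L.NeBot := NeBot.mono (pure_neBot) hi₀
  have hf₀ : IsRidgeFrame ε (g i₀ (φ i₀ (x i₀))) (fun a => pd a (φ i₀) (x i₀)) (n i₀ (x i₀)) :=
    (hf.filter_mono hi₀ : ∀ᶠ i in pure i₀, _)
  have hgt : Tendsto (fun i => g i (φ i (x i))) L (𝓝 (g i₀ (φ i₀ (x i₀)))) :=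
    tendsto_pi_nhds.2 fun A => tendsto_pi_nhds.2 fun B =>
      HasLim.tendsto_pure (f := fun i => g i (φ i (x i)) A B) (hg A B).hasLim hi₀
  have hgd : HasDetLim L fun i => g i (φ i (x i)) := ⟨_, hf₀.det_ne_zero, tendsto_det hgt⟩
  have hv : Tendsto (fun i a => pd a (φ i) (x i)) L (𝓝 fun a => pd a (φ i₀) (x i₀)) :=
    tendsto_pi_nhds.2 fun a =>
      HasLim.tendsto_pure (f := fun i => pd a (φ i) (x i)) (hφ.pd a).hasLim hi₀
  obtain ⟨w, hw, -⟩ := IsRidgeFrame.exists_tendsto_normal hf hgt hv hf₀.det_ne_zero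
    hf₀.gram.det_ne_zero
  have hwn := HasLim.tendsto_pure ⟨w, hw⟩ hi₀
  have hind : ∀ a b, ConvJet 2 L (fun i y => inducedMetric (g i) (φ i) y a b) x :=
    ConvJet.inducedMetric hg hφ
  have hit : Tendsto (fun i => inducedMetric (g i) (φ i) (x i)) L
      (𝓝 (inducedMetric (g i₀) (φ i₀) (x i₀))) :=
    tendsto_pi_nhds.2 fun a => tendsto_pi_nhds.2 fun b =>
      HasLim.tendsto_pure (f := fun i => inducedMetric (g i) (φ i) (x i) a b) (hind a b).hasLim hi₀
  have hid : HasDetLim L fun i => inducedMetric (g i) (φ i) (x i) :=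
    ⟨_, by rw [IsGaussNormal.det_eq (h := inducedMetric (g i₀) (φ i₀) (x i₀)) hf₀.gram]
           exact hf₀.gram.det_ne_zero, tendsto_det hit⟩
  refine ⟨hwn, HasLim.tendsto_pure (f := fun i => israelLHS M₆ M₅ (g i) (φ i) (n i) (x i) a b)
    (HasLim.add (HasLim.const_mul _ ?_) (HasLim.const_mul _ ?_)) hi₀⟩
  · exact HasLim.traceReversed (fun a b => (hind a b).hasLim) hid (fun a b =>
      HasLim.extrinsicCurvature (fun A B => (hg A B).of_succ) hgd (hφ.pd a).hasLim (hφ.pd b).hasLim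
        ((hφ.pd b).pd a).hasLim ⟨_, hwn⟩) a b
  · exact (ConvJet.einstein (k := 0) hind hid a b).hasLim

/-- The parameters `(ρ, τ)` outside the ribbon, on the side selected by `F`. -/
def outside (F : Filter ℝ) : Filter (ℝ × ℝ) := (𝓝[≥] 0 ×ˢ F) ⊓ 𝓟 {p | p.1 ≤ |p.2|}

section Outside

variable {F : Filter ℝ}

theorem tendsto_fst_outside : Tendsto Prod.fst (outside F) (𝓝[≥] 0) :=
  tendsto_fst.mono_left inf_le_left

theorem tendsto_snd_outside : Tendsto Prod.snd (outside F) F :=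
  tendsto_snd.mono_left inf_le_left

theorem tendsto_zero_outside : Tendsto (fun τ : ℝ => ((0 : ℝ), τ)) F (outside F) := by
  exact tendsto_inf.2 ⟨((tendsto_const_pure (a := F)).mono_right
    (pure_le_nhdsWithin (mem_Ici.2 le_rfl))).prodMk tendsto_id,
    tendsto_principal.2 (Eventually.of_forall fun τ => abs_nonneg τ)⟩

theorem side_le_ne (hF : F = 𝓝[>] 0 ∨ F = 𝓝[<] 0) : F ≤ 𝓝[≠] 0 := by
  rcases hF with rfl | rfl
  · exact nhdsWithin_mono _ fun x hx => ne_of_gt hx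
  · exact nhdsWithin_mono _ fun x hx => ne_of_lt hx

theorem side_neBot (hF : F = 𝓝[>] 0 ∨ F = 𝓝[<] 0) : F.NeBot := by
  rcases hF with rfl | rfl <;> infer_instance

theorem tendsto_gnc_outside (hF : F = 𝓝[>] 0 ∨ F = 𝓝[<] 0) (χ : Fin 4 → ℝ) :
    Tendsto (fun p : ℝ × ℝ => gnc χ p.2) (outside F) (𝓝 (gnc χ 0)) :=
  ((continuous_gnc_right χ).tendsto 0).comp (tendsto_snd_outside.mono_right
    ((side_le_ne hF).trans nhdsWithin_le_nhds))

theorem tendsto_right_outside :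
    Tendsto (fun ρ : ℝ => (ρ, ρ)) (𝓝[>] 0) (outside (𝓝[>] 0)) := by
  refine tendsto_inf.2 ⟨Tendsto.prodMk (tendsto_id.mono_right
    (nhdsWithin_mono _ Ioi_subset_Ici_self)) tendsto_id,
    tendsto_principal.2 (Eventually.of_forall fun τ => le_abs_self τ)⟩

theorem tendsto_neg_side : Tendsto (fun ρ : ℝ => -ρ) (𝓝[>] 0) (𝓝[<] 0) := by
  simpa using tendsto_neg_nhdsGT_neg (a := (0 : ℝ))

theorem tendsto_neg_side' : Tendsto (fun ρ : ℝ => -ρ) (𝓝[<] 0) (𝓝[>] 0) := by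
  simpa using tendsto_neg_nhdsLT_neg (a := (0 : ℝ))

theorem tendsto_left_outside :
    Tendsto (fun ρ : ℝ => (ρ, -ρ)) (𝓝[>] 0) (outside (𝓝[<] 0)) := by
  refine tendsto_inf.2 ⟨Tendsto.prodMk (tendsto_id.mono_right
    (nhdsWithin_mono _ Ioi_subset_Ici_self)) tendsto_neg_side,
    tendsto_principal.2 (Eventually.of_forall fun τ => ?_)⟩
  simpa using le_abs_self τ

end Outside

namespace ThinLimitAnsatz

variable {N : ℕ} {U : Set (Fin 4 → ℝ)} {l : ℝ} {V : Set (Fin 6 → ℝ)} {ε : ℝ}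
  {g : ℝ → MetricField 6} {φ n : ℝ → (Fin 5 → ℝ) → (Fin 6 → ℝ)}
  {g₀ : MetricField 6} {φ₀ n₀ : (Fin 5 → ℝ) → (Fin 6 → ℝ)} {F : Filter ℝ} {χ : Fin 4 → ℝ}

theorem ridge_mem (h : ThinLimitAnsatz N U l V ε g φ n g₀ φ₀ n₀) (hχ : χ ∈ U) :
    gnc χ 0 ∈ slab U l := mem_slab_gnc.2 ⟨hχ, by simpa using h.l_pos⟩

/-- The point with `|τ| = ρ` still belongs to the closed region of uniform convergence, so the
limits assumed at the ribbon edges pass to the limit brane. -/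
theorem tendsto_lim_jet_aux (h : ThinLimitAnsatz N U l V ε g φ n g₀ φ₀ n₀) (hχ : χ ∈ U) {k : ℕ}
    (hk : k ≤ N) {σ : ℝ → ℝ} (hσ : ∀ ρ, |σ ρ| = |ρ|) {D}
    (hD : Tendsto (fun ρ => iteratedFDeriv ℝ k (φ ρ) (gnc χ (σ ρ))) (𝓝[>] 0) (𝓝 D)) :
    Tendsto (fun ρ => iteratedFDeriv ℝ k φ₀ (gnc χ (σ ρ))) (𝓝[>] 0) (𝓝 D) := by
  refine hD.congr_dist (Metric.tendsto_nhds.2 fun e he => ?_)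
  obtain ⟨δ, hδ, H⟩ := h.brane_conv_ext k hk e he
  filter_upwards [Ioo_mem_nhdsGT (lt_min hδ h.l_pos)] with ρ hρ
  have hl : ρ < l := hρ.2.trans_le (min_le_right _ _)
  have hδ' : ρ < δ := hρ.2.trans_le (min_le_left _ _)
  have := H ρ ⟨hρ.1, hδ'⟩ (gnc χ (σ ρ)) (mem_slab_gnc.2 ⟨hχ, by rw [hσ, abs_of_pos hρ.1]; exact hl⟩)
    (by rw [gnc_last, hσ, abs_of_pos hρ.1])
  rw [Real.dist_0_eq_abs, abs_of_nonneg dist_nonneg, dist_eq_norm]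
  exact this

theorem hasLim_lim_jet (h : ThinLimitAnsatz N U l V ε g φ n g₀ φ₀ n₀) (hχ : χ ∈ U)
    (hF : F = 𝓝[>] 0 ∨ F = 𝓝[<] 0) {k : ℕ} (hk : k ≤ N) :
    HasLim F fun τ => iteratedFDeriv ℝ k φ₀ (gnc χ τ) := by
  rcases hF with rfl | rfl
  · obtain ⟨D, hD⟩ := h.brane_lim_pos k hk χ hχ
    exact ⟨D, h.tendsto_lim_jet_aux hχ hk (σ := fun ρ => ρ) (fun ρ => rfl) hD⟩
  · obtain ⟨D, hD⟩ := h.brane_lim_neg k hk χ hχ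
    refine ⟨D, ((h.tendsto_lim_jet_aux hχ hk (σ := fun ρ => -ρ) abs_neg hD).comp
      tendsto_neg_side').congr fun τ => ?_⟩
    simp

/-- Outside the ribbon the jets differ from those of the limit brane at the same point by a
uniformly small amount, and the latter have one-sided limits. -/
theorem hasLim_outside_jet (h : ThinLimitAnsatz N U l V ε g φ n g₀ φ₀ n₀) (hχ : χ ∈ U)
    (hF : F = 𝓝[>] 0 ∨ F = 𝓝[<] 0) {k : ℕ} (hk : k ≤ N) :
    HasLim (outside F) fun p => iteratedFDeriv ℝ k (withLimit φ φ₀ p.1) (gnc χ p.2) := by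
  obtain ⟨D, hD⟩ := h.hasLim_lim_jet hχ hF hk
  refine ⟨D, (hD.comp tendsto_snd_outside).congr_dist (Metric.tendsto_nhds.2 fun e he => ?_)⟩
  obtain ⟨δ, hδ, H⟩ := h.brane_conv_ext k hk e he
  have h1 : ∀ᶠ p in outside F, p.1 ≤ |p.2| := mem_inf_of_right (mem_principal_self _)
  have h2 : ∀ᶠ p in outside F, 0 ≤ p.1 := tendsto_fst_outside.eventually self_mem_nhdsWithin
  have h3 : ∀ᶠ p in outside F, p.1 < δ :=
    tendsto_fst_outside.eventually (mem_nhdsWithin_of_mem_nhds (Iio_mem_nhds hδ))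
  have h4 := (tendsto_gnc_outside hF χ).eventually
    ((isOpen_slab h.isOpen_U l).mem_nhds (h.ridge_mem hχ))
  filter_upwards [h1, h2, h3, h4] with p p1 p2 p3 p4
  rw [Real.dist_0_eq_abs, abs_of_nonneg dist_nonneg, dist_comm, dist_eq_norm]
  rcases p2.eq_or_lt with h5 | h5
  · rw [← h5, withLimit_zero, Function.comp_apply, sub_self, norm_zero]; exact he
  · rw [withLimit_of_ne h5.ne']
    exact H p.1 ⟨h5, p3⟩ _ p4 (by rw [gnc_last]; exact p1)

theorem eventually_regular_outside (h : ThinLimitAnsatz N U l V ε g φ n g₀ φ₀ n₀) (hχ : χ ∈ U)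
    (hF : F = 𝓝[>] 0 ∨ F = 𝓝[<] 0) :
    ∀ᶠ p in outside F, IsRegularPoint U l p.1 (gnc χ p.2) := by
  filter_upwards [h.eventually_lt tendsto_fst_outside, (tendsto_gnc_outside hF χ).eventually
    ((isOpen_slab h.isOpen_U l).mem_nhds (h.ridge_mem hχ)),
    tendsto_snd_outside.eventually (side_le_ne hF self_mem_nhdsWithin)] with p h1 h2 h3
  exact ⟨h2, h1.1, h1.2, fun _ => by rw [gnc_last]; exact h3⟩

theorem convJet_outside (h : ThinLimitAnsatz N U l V ε g φ n g₀ φ₀ n₀) (hχ : χ ∈ U)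
    (hF : F = 𝓝[>] 0 ∨ F = 𝓝[<] 0) {k : ℕ} (hk : k ≤ N) :
    ConvJet k (outside F) (fun p => withLimit φ φ₀ p.1) fun p => gnc χ p.2 := by
  refine ConvJet.of_iteratedFDeriv ?_ fun j hj => h.hasLim_outside_jet hχ hF (hj.trans hk)
  filter_upwards [h.eventually_regular_outside hχ hF] with p hp
  exact (h.brane_contDiffAt hp).of_le (by exact_mod_cast hk)

/-- The filter contains both the approach of the limit brane to the ridge, at parameter `0`, and the
ribbon edges. The one-sided limit of the limit configuration is therefore also the limit of the
boundary values at `±ρ`. -/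
theorem tendsto_tangent (h : ThinLimitAnsatz N U l V ε g φ n g₀ φ₀ n₀) (hN : 3 ≤ N) (hχ : χ ∈ U)
    (hF : F = 𝓝[>] 0 ∨ F = 𝓝[<] 0) :
    Tendsto (fun p => pd iτ (withLimit φ φ₀ p.1) (gnc χ p.2)) (outside F)
      (𝓝 (tangentSide φ₀ F χ)) := by
  have := side_neBot hF
  obtain ⟨v, hv⟩ := ((h.convJet_outside hχ hF (k := 1) (by omega)).pd iτ).hasLim
  have h1 := hv.comp tendsto_zero_outside
  simp only [Function.comp_def, withLimit_zero] at h1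
  rwa [tangentSide, h1.limUnder_eq]

theorem normal_outside (h : ThinLimitAnsatz N U l V ε g φ n g₀ φ₀ n₀) (hN : 3 ≤ N) (hχ : χ ∈ U)
    (hF : F = 𝓝[>] 0 ∨ F = 𝓝[<] 0) :
    Tendsto (fun p => withLimit n n₀ p.1 (gnc χ p.2)) (outside F) (𝓝 (normalSide n₀ F χ)) ∧
      IsRidgeFrame ε (g₀ (leaf φ₀ 0 χ)) (ridgeVectors φ₀ χ (tangentSide φ₀ F χ))
        (normalSide n₀ F χ) := by
  have := side_neBot hF
  have hne : (outside F).NeBot := (tendsto_zero_outside (F := F)).neBot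
  obtain ⟨w, hw, hf⟩ := h.exists_tendsto_normal hN hχ tendsto_fst_outside
    (tendsto_gnc_outside hF χ) ((h.eventually_regular_outside hχ hF).mono fun p hp => hp.ne)
    (h.tendsto_tangent hN hχ hF)
  have h1 := hw.comp tendsto_zero_outside
  simp only [Function.comp_def, withLimit_zero] at h1
  rw [normalSide, h1.limUnder_eq]
  exact ⟨hw, hf⟩

theorem leafCurvature_eq (h : ThinLimitAnsatz N U l V ε g φ n g₀ φ₀ n₀) (hN : 3 ≤ N) {ρ τ : ℝ}
    (hx : IsRegularPoint U l ρ (gnc χ τ)) (μ ν : Fin 4) :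
    leafCurvature (withLimit g g₀ ρ) (withLimit φ φ₀ ρ) χ τ μ ν = -(1 / 2) *
      leafDeriv (inducedMetric (withLimit g g₀ ρ) (withLimit φ φ₀ ρ)) (gnc χ τ) μ ν :=
  _root_.leafCurvature_eq (h.isOpen_regular ρ) (fun _ hy => h.isGaussNormal hN hy) hx μ ν

theorem tendsto_leafCurvature (h : ThinLimitAnsatz N U l V ε g φ n g₀ φ₀ n₀) (hN : 3 ≤ N)
    (hχ : χ ∈ U) (hF : F = 𝓝[>] 0 ∨ F = 𝓝[<] 0) :
    Tendsto (fun p => leafCurvature (withLimit g g₀ p.1) (withLimit φ φ₀ p.1) χ p.2) (outside F)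
      (𝓝 (cod2Curvature g₀ φ₀ F χ)) := by
  have := side_neBot hF
  have h1 : HasLim (outside F) fun p =>
      leafCurvature (withLimit g g₀ p.1) (withLimit φ φ₀ p.1) χ p.2 := by
    have h2 : ∀ μ ν, HasLim (outside F) fun p =>
        leafCurvature (withLimit g g₀ p.1) (withLimit φ φ₀ p.1) χ p.2 μ ν := fun μ ν => by
      have h3 : ConvJet 1 (outside F) (fun p y => inducedMetric (withLimit g g₀ p.1)
          (withLimit φ φ₀ p.1) y μ.castSucc ν.castSucc) fun p => gnc χ p.2 :=
        ConvJet.inducedMetric (h.convJet_metric tendsto_fst_outside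
          (h.tendsto_brane tendsto_fst_outside (tendsto_gnc_outside hF χ) (h.ridge_mem hχ))
          (h.lim_brane_mapsTo (h.ridge_mem hχ)) (by omega))
          (h.convJet_outside hχ hF (by omega)) _ _
      refine ((h3.pd iτ).hasLim.const_mul (-(1 / 2))).congr ?_
      filter_upwards [h.eventually_regular_outside hχ hF] with p hp
      exact (h.leafCurvature_eq hN hp μ ν).symm
    choose y hy using h2
    exact ⟨y, tendsto_pi_nhds.2 fun μ => tendsto_pi_nhds.2 fun ν => hy μ ν⟩
  obtain ⟨K, hK⟩ := h1
  have h2 := hK.comp tendsto_zero_outside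
  simp only [Function.comp_def, withLimit_zero] at h2
  rwa [cod2Curvature, h2.limUnder_eq]

/-- The one-sided limits at the codimension-2 brane exist. -/
theorem tendsto_sides (h : ThinLimitAnsatz N U l V ε g φ n g₀ φ₀ n₀) (hN : 3 ≤ N) (hχ : χ ∈ U)
    (hF : F = 𝓝[>] 0 ∨ F = 𝓝[<] 0) :
    Tendsto (fun τ => pd iτ φ₀ (gnc χ τ)) F (𝓝 (tangentSide φ₀ F χ)) ∧
      Tendsto (fun τ => n₀ (gnc χ τ)) F (𝓝 (normalSide n₀ F χ)) ∧
      Tendsto (fun τ => leafCurvature g₀ φ₀ χ τ) F (𝓝 (cod2Curvature g₀ φ₀ F χ)) := by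
  have h1 := (h.tendsto_tangent hN hχ hF).comp tendsto_zero_outside
  have h2 := (h.normal_outside hN hχ hF).1.comp tendsto_zero_outside
  have h3 := (h.tendsto_leafCurvature hN hχ hF).comp tendsto_zero_outside
  simp only [Function.comp_def, withLimit_zero] at h1 h2 h3
  exact ⟨h1, h2, h3⟩

/-- The turning angle `α = -Ω` of the frame across the codimension-2 brane. -/
theorem exists_angle (h : ThinLimitAnsatz N U l V ε g φ n g₀ φ₀ n₀) (hN : 3 ≤ N) (hχ : χ ∈ U) :
    ∃ α : ℝ, -Real.pi < α ∧ α < Real.pi ∧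
      tangentSide φ₀ (𝓝[<] 0) χ = Real.cos α • tangentSide φ₀ (𝓝[>] 0) χ
        + Real.sin α • normalSide n₀ (𝓝[>] 0) χ ∧
      orientedDihedralAngle g₀ φ₀ n₀ χ = -α ∧ sectorAngle φ₀ n₀ χ = Real.pi + α := by
  obtain ⟨α, h1, h2, h3, h4, h5⟩ := exists_ridge_angle (h.normal_outside hN hχ (Or.inl rfl)).2
    (h.normal_outside hN hχ (Or.inr rfl)).2
    (fun μ => by rw [ridgeVectors_castSucc, ridgeVectors_castSucc]) (h.no_cusp χ hχ)
  simp only [ridgeVectors_last] at h3 h4 h5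
  exact ⟨α, h1, h2, h3, h4, h5⟩

theorem deficitAngle_eq (h : ThinLimitAnsatz N U l V ε g φ n g₀ φ₀ n₀) (hN : 3 ≤ N)
    (hχ : χ ∈ U) : deficitAngle φ₀ n₀ χ = 2 * orientedDihedralAngle g₀ φ₀ n₀ χ := by
  obtain ⟨α, -, -, -, h4, h5⟩ := h.exists_angle hN hχ
  rw [deficitAngle, h4, h5]; ring

theorem einstein_eq_zero (h : ThinLimitAnsatz N U l V ε g φ n g₀ φ₀ n₀) (hN : 3 ≤ N)
    {X : Fin 6 → ℝ} (hX : X ∈ V) (h0 : ∀ᶠ ρ in 𝓝[>] 0, ∀ A B, einstein (g ρ) X A B = 0)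
    (A B : Fin 6) : einstein g₀ X A B = 0 := by
  have h1 : HasLim (𝓝[≥] 0) fun ρ => einstein (withLimit g g₀ ρ) X A B :=
    (ConvJet.einstein (k := 0) (h.convJet_metric tendsto_id tendsto_const_nhds hX (by omega))
      (h.hasDetLim_metric tendsto_id tendsto_const_nhds hX) A B).hasLim
  have h2 := h1.tendsto_right
  rw [withLimit_zero] at h2
  refine tendsto_nhds_unique h2 (tendsto_const_nhds.congr' ?_)
  filter_upwards [h0, self_mem_nhdsWithin] with ρ hρ hρ0
  rw [withLimit_of_ne (ne_of_gt hρ0), hρ]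

theorem tendsto_israelLHS (h : ThinLimitAnsatz N U l V ε g φ n g₀ φ₀ n₀) (hN : 3 ≤ N)
    {x : Fin 5 → ℝ} (hx : x ∈ slab U l) (hx0 : x iτ ≠ 0) (M₆ M₅ : ℝ) (a b : Fin 5) :
    Tendsto (fun ρ => israelLHS M₆ M₅ (g ρ) (φ ρ) (n ρ) x a b) (𝓝[>] 0)
      (𝓝 (israelLHS M₆ M₅ g₀ φ₀ n₀ x a b)) := by
  have h1 := (_root_.tendsto_israelLHS (L := 𝓝[≥] 0) (i₀ := 0) (ε := ε)
    (g := withLimit g g₀) (φ := withLimit φ φ₀) (n := withLimit n n₀) (x := fun _ => x)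
    (h.convJet_metric tendsto_id (h.tendsto_brane tendsto_id tendsto_const_nhds hx)
      (h.lim_brane_mapsTo hx) (by omega)) (h.convJet_brane hx hx0 hN) (by
        filter_upwards [h.eventually_lt tendsto_id] with ρ hρ
        exact h.isRidgeFrame hN ⟨hx, hρ.1, hρ.2, fun _ => hx0⟩)
    (pure_le_nhdsWithin (mem_Ici.2 le_rfl)) M₆ M₅ a b).2.mono_left
    (nhdsWithin_mono _ Ioi_subset_Ici_self : 𝓝[>] (0 : ℝ) ≤ 𝓝[≥] 0)
  simp only [withLimit_zero] at h1
  refine h1.congr' ?_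
  filter_upwards [self_mem_nhdsWithin] with ρ hρ
  rw [withLimit_of_ne (ne_of_gt hρ), withLimit_of_ne (ne_of_gt hρ), withLimit_of_ne (ne_of_gt hρ)]

end ThinLimitAnsatz

end

noncomputable section

/-! ### Bounded families -/

section Bounded

variable {ι E : Type*} [NormedAddCommGroup E] {L : Filter ι} {f : ι → E}

theorem HasLim.of_norm_le [ProperSpace E] {𝒰 : Ultrafilter ι} (h𝒰 : ↑𝒰 ≤ L) {C : ℝ} (hf : ∀ᶠ i in L, ‖f i‖ ≤ C) :
    HasLim (𝒰 : Filter ι) f := by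
  obtain ⟨y, -, hy⟩ := (isCompact_closedBall (0 : E) C).ultrafilter_le_nhds (𝒰.map f)
    (le_principal_iff.2 (mem_map.2 (by
      filter_upwards [hf.filter_mono h𝒰] with i hi
      simpa using hi)))
  exact ⟨y, hy⟩

/-- An unbounded family has an ultrafilter along which its norm tends to infinity, so it cannot
converge there. Uniform bounds thus follow from the algebra of limits, applied after bounded
ingredients have been made convergent along the ultrafilter. -/
theorem exists_norm_le_of_ultrafilter
    (hf : ∀ 𝒰 : Ultrafilter ι, ↑𝒰 ≤ L → HasLim (𝒰 : Filter ι) f) :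
    ∃ C, ∀ᶠ i in L, ‖f i‖ ≤ C := by
  by_contra! H
  have h1 : (L ⊓ comap (fun i => ‖f i‖) atTop).NeBot := by
    rw [inf_neBot_iff_frequently_right]
    intro p hp
    obtain ⟨s, hs, hsp⟩ := mem_comap.1 hp
    obtain ⟨C, hC⟩ := mem_atTop_sets.1 hs
    exact (H C).mono fun i hi => hsp (hC _ hi.le)
  have h2 := Ultrafilter.of_le (L ⊓ comap (fun i => ‖f i‖) atTop)
  obtain ⟨y, hy⟩ := hf _ (h2.trans inf_le_left)
  refine not_tendsto_nhds_of_tendsto_atTop ?_ _ hy.norm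
  exact tendsto_comap.mono_left (h2.trans inf_le_right)

end Bounded

theorem norm_single_one {d : ℕ} (i : Fin d) : ‖(Pi.single i 1 : Fin d → ℝ)‖ = 1 := by
  rw [Pi.norm_single, norm_one]

theorem norm_pd_le_of_lipschitzOn {d : ℕ} {F : Type*} [NormedAddCommGroup F] [NormedSpace ℝ F]
    {f : (Fin d → ℝ) → F} {x : Fin d → ℝ} {S : Set (Fin d → ℝ)} {C : ℝ≥0} (hS : S ∈ 𝓝 x)
    (hf : LipschitzOnWith C f S) (i : Fin d) : ‖pd i f x‖ ≤ C := by
  have h1 := norm_lineDeriv_le_of_lipschitzOn ℝ hS hf (v := Pi.single i 1)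
  rwa [norm_single_one, mul_one] at h1

theorem norm_gnc_sub (χ : Fin 4 → ℝ) (s t : ℝ) : ‖gnc χ s - gnc χ t‖ = |s - t| := by
  refine le_antisymm ((pi_norm_le_iff_of_nonneg (abs_nonneg _)).2 fun a => ?_) ?_
  · refine Fin.lastCases ?_ (fun μ => ?_) a
    · simp only [Pi.sub_apply, gnc_last, Real.norm_eq_abs, le_refl]
    · simp [gnc_castSucc]
  · have := norm_le_pi_norm (gnc χ s - gnc χ t) iτ
    simpa only [Pi.sub_apply, gnc_last, Real.norm_eq_abs] using this

theorem pd_pd_castSucc_eq_leaf (f : (Fin 5 → ℝ) → (Fin 6 → ℝ)) (μ ν : Fin 4) (x : Fin 5 → ℝ) :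
    pd μ.castSucc (pd ν.castSucc f) x = pd μ (pd ν (leaf f (x iτ))) (Fin.init x) := by
  conv_lhs => rw [← gnc_init_last x]
  rw [pd_castSucc]
  simp only [pd_castSucc]
  rfl

/-- The partial derivatives of an induced metric. -/
theorem pd_inducedMetric {m d : ℕ} {g : MetricField d} {f : (Fin m → ℝ) → (Fin d → ℝ)}
    {x : Fin m → ℝ} (hg : ∀ A B, DifferentiableAt ℝ (fun Y => g Y A B) (f x))
    (hf : ContDiffAt ℝ (2 : ℕ) f x) (c a b : Fin m) :
    pd c (fun y => inducedMetric g f y a b) x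
      = metricInner (fun A B => ∑ C, pd c f x C * pd C (fun Y => g Y A B) (f x))
          (pd a f x) (pd b f x)
        + metricInner (g (f x)) (pd c (pd a f) x) (pd b f x)
        + metricInner (g (f x)) (pd a f x) (pd c (pd b f) x) := by
  have h0 : DifferentiableAt ℝ f x := hf.differentiableAt (by simp)
  have h1 : ∀ a, DifferentiableAt ℝ (pd a f) x := fun a =>
    (ContDiffAt.pd (k := 1) a hf).differentiableAt (by simp)
  have h2 : ∀ a A, DifferentiableAt ℝ (fun y => pd a f y A) x := fun a A =>
    differentiableAt_pi.1 (h1 a) A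
  have h3 : ∀ A B, DifferentiableAt ℝ (fun y => g (f y) A B) x := fun A B => (hg A B).comp x h0
  simp only [inducedMetric, metricInner]
  rw [pd_sum _ _ fun A _ => DifferentiableAt.fun_sum fun B _ =>
    ((h3 A B).fun_mul (h2 a A)).fun_mul (h2 b B), ← Finset.sum_add_distrib,
    ← Finset.sum_add_distrib]
  refine Finset.sum_congr rfl fun A _ => ?_
  rw [pd_sum _ _ fun B _ => ((h3 A B).fun_mul (h2 a A)).fun_mul (h2 b B),
    ← Finset.sum_add_distrib, ← Finset.sum_add_distrib]
  refine Finset.sum_congr rfl fun B _ => ?_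
  rw [pd_mul c ((h3 A B).fun_mul (h2 a A)) (h2 b B), pd_mul c (h3 A B) (h2 a A),
    pd_comp c (hg A B) h0, pd_component c (h1 a), pd_component c (h1 b)]
  simp only [smul_eq_mul]
  ring

/-- The pairs `(ρ, x)` with `ρ → 0⁺` and `x` close to the codimension-2 brane. -/
def ribbon (χ : Fin 4 → ℝ) : Filter (ℝ × (Fin 5 → ℝ)) := 𝓝[>] 0 ×ˢ 𝓝 (gnc χ 0)

theorem tendsto_fst_ribbon {χ : Fin 4 → ℝ} : Tendsto Prod.fst (ribbon χ) (𝓝[≥] 0) :=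
  tendsto_fst.mono_right (nhdsWithin_mono _ Ioi_subset_Ici_self)

theorem tendsto_snd_ribbon {χ : Fin 4 → ℝ} : Tendsto Prod.snd (ribbon χ) (𝓝 (gnc χ 0)) :=
  tendsto_snd

namespace ThinLimitAnsatz

variable {N : ℕ} {U : Set (Fin 4 → ℝ)} {l : ℝ} {V : Set (Fin 6 → ℝ)} {ε : ℝ}
  {g : ℝ → MetricField 6} {φ n : ℝ → (Fin 5 → ℝ) → (Fin 6 → ℝ)}
  {g₀ : MetricField 6} {φ₀ n₀ : (Fin 5 → ℝ) → (Fin 6 → ℝ)} {χ : Fin 4 → ℝ}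

theorem eventually_ribbon (h : ThinLimitAnsatz N U l V ε g φ n g₀ φ₀ n₀) (hχ : χ ∈ U) :
    ∀ᶠ p in ribbon χ, p.1 ∈ Ioo 0 l ∧ p.2 ∈ slab U l := by
  filter_upwards [tendsto_fst.eventually (Ioo_mem_nhdsGT h.l_pos),
    tendsto_snd_ribbon.eventually ((isOpen_slab h.isOpen_U l).mem_nhds (h.ridge_mem hχ))]
    with p h1 h2 using ⟨h1, h2⟩

theorem isRegularPoint (_ : ThinLimitAnsatz N U l V ε g φ n g₀ φ₀ n₀) {ρ : ℝ} (hρ : ρ ∈ Ioo 0 l)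
    {x : Fin 5 → ℝ} (hx : x ∈ slab U l) : IsRegularPoint U l ρ x :=
  ⟨hx, hρ.1.le, hρ.2, fun h0 => absurd h0 hρ.1.ne'⟩

theorem approx_isRidgeFrame (h : ThinLimitAnsatz N U l V ε g φ n g₀ φ₀ n₀) (hN : 3 ≤ N) {ρ : ℝ}
    (hρ : ρ ∈ Ioo 0 l) {x : Fin 5 → ℝ} (hx : x ∈ slab U l) :
    IsRidgeFrame ε (g ρ (φ ρ x)) (fun a => pd a (φ ρ) x) (n ρ x) := by
  have := h.isRidgeFrame hN (h.isRegularPoint hρ hx)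
  rwa [withLimit_of_ne hρ.1.ne', withLimit_of_ne hρ.1.ne', withLimit_of_ne hρ.1.ne'] at this

theorem approx_contDiffAt (h : ThinLimitAnsatz N U l V ε g φ n g₀ φ₀ n₀) (hN : 3 ≤ N) {ρ : ℝ}
    (hρ : ρ ∈ Ioo 0 l) {x : Fin 5 → ℝ} (hx : x ∈ slab U l) : ContDiffAt ℝ (3 : ℕ) (φ ρ) x :=
  ((h.brane_smooth ρ hρ).contDiffAt ((isOpen_slab h.isOpen_U l).mem_nhds hx)).of_le
    (by exact_mod_cast hN)

theorem approx_metric_contDiffAt (h : ThinLimitAnsatz N U l V ε g φ n g₀ φ₀ n₀) (hN : 3 ≤ N)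
    {ρ : ℝ} (hρ : ρ ∈ Ioo 0 l) {x : Fin 5 → ℝ} (hx : x ∈ slab U l) (A B : Fin 6) :
    ContDiffAt ℝ (3 : ℕ) (fun Y => g ρ Y A B) (φ ρ x) :=
  contDiffAt_pi.1 (contDiffAt_pi.1 (((h.metric_smooth ρ hρ).contDiffAt
    (h.isOpen_V.mem_nhds (h.brane_mapsTo ρ hρ hx))).of_le (by exact_mod_cast hN)) A) B

/-! #### Convergence at the ribbon -/

theorem tendsto_ribbon_brane (h : ThinLimitAnsatz N U l V ε g φ n g₀ φ₀ n₀) (hχ : χ ∈ U) :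
    Tendsto (fun p => φ p.1 p.2) (ribbon χ) (𝓝 (leaf φ₀ 0 χ)) := by
  refine (h.tendsto_brane tendsto_fst_ribbon tendsto_snd_ribbon (h.ridge_mem hχ)).congr' ?_
  filter_upwards [h.eventually_ribbon hχ] with p hp
  rw [withLimit_of_ne hp.1.1.ne']

theorem convJet_ribbon_metric (h : ThinLimitAnsatz N U l V ε g φ n g₀ φ₀ n₀) (hN : 3 ≤ N)
    (hχ : χ ∈ U) (A B : Fin 6) :
    ConvJet 3 (ribbon χ) (fun p Y => g p.1 Y A B) fun p => φ p.1 p.2 := by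
  refine (h.convJet_metric tendsto_fst_ribbon (h.tendsto_ribbon_brane hχ)
    (h.lim_brane_mapsTo (h.ridge_mem hχ)) hN A B).congr ?_
  filter_upwards [h.eventually_ribbon hχ] with p hp
  rw [withLimit_of_ne hp.1.1.ne']

theorem tendsto_ribbon_metric (h : ThinLimitAnsatz N U l V ε g φ n g₀ φ₀ n₀) (hχ : χ ∈ U) :
    Tendsto (fun p => g p.1 (φ p.1 p.2)) (ribbon χ) (𝓝 (g₀ (leaf φ₀ 0 χ))) := by
  refine (h.tendsto_metric tendsto_fst_ribbon (h.tendsto_ribbon_brane hχ)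
    (h.lim_brane_mapsTo (h.ridge_mem hχ))).congr' ?_
  filter_upwards [h.eventually_ribbon hχ] with p hp
  rw [withLimit_of_ne hp.1.1.ne']

theorem hasDetLim_ribbon_metric (h : ThinLimitAnsatz N U l V ε g φ n g₀ φ₀ n₀) (hχ : χ ∈ U) :
    HasDetLim (ribbon χ) fun p => g p.1 (φ p.1 p.2) :=
  ⟨_, (h.lim_metric_lorentzian _ (h.lim_brane_mapsTo (h.ridge_mem hχ))).det_ne_zero,
    tendsto_det (h.tendsto_ribbon_metric hχ)⟩

theorem tendsto_ribbon_par (h : ThinLimitAnsatz N U l V ε g φ n g₀ φ₀ n₀) (hN : 3 ≤ N)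
    (hχ : χ ∈ U) (μ : Fin 4) :
    Tendsto (fun p => pd μ.castSucc (φ p.1) p.2) (ribbon χ) (𝓝 (pd μ (leaf φ₀ 0) χ)) := by
  have h1 := h.tendsto_pd_castSucc hN tendsto_fst_ribbon tendsto_snd_ribbon (h.ridge_mem hχ) μ
  rw [gnc_last, init_gnc] at h1
  refine h1.congr' ?_
  filter_upwards [h.eventually_ribbon hχ] with p hp
  rw [withLimit_of_ne hp.1.1.ne']

theorem convJet_ribbon_leaf (h : ThinLimitAnsatz N U l V ε g φ n g₀ φ₀ n₀) (hN : 3 ≤ N)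
    (hχ : χ ∈ U) :
    ConvJet 3 (ribbon χ) (fun p => leaf (φ p.1) (p.2 iτ)) fun p => Fin.init p.2 := by
  refine (h.convJet_leaf tendsto_fst_ribbon tendsto_snd_ribbon (h.ridge_mem hχ) hN).congr ?_
  filter_upwards [h.eventually_ribbon hχ] with p hp
  rw [withLimit_of_ne hp.1.1.ne']

theorem hasLim_ribbon_par_par (h : ThinLimitAnsatz N U l V ε g φ n g₀ φ₀ n₀) (hN : 3 ≤ N)
    (hχ : χ ∈ U) (μ ν : Fin 4) :
    HasLim (ribbon χ) fun p => pd μ.castSucc (pd ν.castSucc (φ p.1)) p.2 := by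
  simp only [pd_pd_castSucc_eq_leaf]
  exact (((h.convJet_ribbon_leaf hN hχ).pd ν).pd μ).hasLim

theorem convJet_ribbon_leafMetric (h : ThinLimitAnsatz N U l V ε g φ n g₀ φ₀ n₀) (hN : 3 ≤ N)
    (hχ : χ ∈ U) (μ ν : Fin 4) :
    ConvJet 2 (ribbon χ) (fun p y => leafMetric (inducedMetric (g p.1) (φ p.1)) (p.2 iτ) y μ ν)
      fun p => Fin.init p.2 := by
  simp only [leafMetric_inducedMetric]
  refine ConvJet.inducedMetric (fun A B => ?_) (h.convJet_ribbon_leaf hN hχ) μ ν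
  simp only [leaf, gnc_init_last]
  exact (h.convJet_ribbon_metric hN hχ A B).of_succ

theorem tendsto_ribbon_leafBlock (h : ThinLimitAnsatz N U l V ε g φ n g₀ φ₀ n₀) (hN : 3 ≤ N)
    (hχ : χ ∈ U) : Tendsto (fun p => leafBlock (inducedMetric (g p.1) (φ p.1) p.2)) (ribbon χ)
      (𝓝 (cod2Metric g₀ φ₀ χ)) :=
  tendsto_pi_nhds.2 fun μ => tendsto_pi_nhds.2 fun ν =>
    tendsto_metricInner (h.tendsto_ribbon_metric hχ) (h.tendsto_ribbon_par hN hχ μ)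
      (h.tendsto_ribbon_par hN hχ ν)

theorem hasDetLim_ribbon_leafBlock (h : ThinLimitAnsatz N U l V ε g φ n g₀ φ₀ n₀) (hN : 3 ≤ N)
    (hχ : χ ∈ U) :
    HasDetLim (ribbon χ) fun p => leafBlock (inducedMetric (g p.1) (φ p.1) p.2) :=
  ⟨_, (h.lim_leaf_lorentzian χ hχ 0 (by simpa using h.l_pos)).det_ne_zero,
    tendsto_det (h.tendsto_ribbon_leafBlock hN hχ)⟩

theorem hasLim_ribbon_ricci (h : ThinLimitAnsatz N U l V ε g φ n g₀ φ₀ n₀) (hN : 3 ≤ N)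
    (hχ : χ ∈ U) (μ ν : Fin 4) : HasLim (ribbon χ) fun p =>
      ricci (leafMetric (inducedMetric (g p.1) (φ p.1)) (p.2 iτ)) (Fin.init p.2) μ ν := by
  refine (ConvJet.ricci (k := 0) (h.convJet_ribbon_leafMetric hN hχ) ?_ μ ν).hasLim
  simp only [leafMetric, gnc_init_last]
  exact h.hasDetLim_ribbon_leafBlock hN hχ

/-! #### Bounds at the ribbon -/

theorem exists_lipschitz (h : ThinLimitAnsatz N U l V ε g φ n g₀ φ₀ n₀) (hN : 3 ≤ N) :
    ∃ C : ℝ≥0, ∀ᶠ ρ in 𝓝[>] 0, LipschitzOnWith C (φ ρ) (slab U l) ∧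
      ∀ μ : Fin 4, LipschitzOnWith C (pd μ.castSucc (φ ρ)) (slab U l) := by
  obtain ⟨C, hC⟩ := h.brane_lipschitz
  refine ⟨C, ?_⟩
  filter_upwards [hC, Ioo_mem_nhdsGT h.l_pos] with ρ hρ hρl
  refine ⟨LipschitzOnWith.of_dist_le_mul fun x hx y hy => ?_, fun μ =>
    LipschitzOnWith.of_dist_le_mul fun x hx y hy => ?_⟩
  · refine le_trans ?_ ((hρ 0 (by omega)).dist_le_mul x hx y hy)
    have h1 := (parDeriv 0 (φ ρ) x - parDeriv 0 (φ ρ) y).le_opNorm 0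
    rw [dist_eq_norm, dist_eq_norm]
    simpa [parDeriv, leaf, gnc_init_last] using h1
  · refine le_trans ?_ ((hρ 1 (by omega)).dist_le_mul x hx y hy)
    have h1 := (parDeriv 1 (φ ρ) x - parDeriv 1 (φ ρ) y).le_opNorm fun _ => Pi.single μ 1
    have h2 : ∀ x ∈ slab U l, pd μ.castSucc (φ ρ) x = parDeriv 1 (φ ρ) x fun _ => Pi.single μ 1 := by
      intro x hx
      rw [pd_castSucc_eq_leaf, pd_eq_iteratedFDeriv]
      · rfl
      · have := h.leaf_contDiffAt hρl.1.le hρl.2 hx.1 hx.2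
        rw [withLimit_of_ne hρl.1.ne'] at this
        exact this.differentiableAt (by norm_cast; omega)
    rw [dist_eq_norm, dist_eq_norm, h2 x hx, h2 y hy]
    simpa [norm_single_one] using h1

/-- The Lipschitz hypothesis refers to all five coordinates. Applied to `φ` and to `∂_μ φ` it
controls one `τ`-derivative of each; nothing of the kind bounds `∂_τ² φ` in the ribbon. -/
theorem exists_norm_le (h : ThinLimitAnsatz N U l V ε g φ n g₀ φ₀ n₀) (hN : 3 ≤ N) :
    ∃ C, ∀ᶠ ρ in 𝓝[>] 0, ∀ x ∈ slab U l, ‖pd iτ (φ ρ) x‖ ≤ C ∧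
      ∀ μ : Fin 4, ‖pd iτ (pd μ.castSucc (φ ρ)) x‖ ≤ C := by
  obtain ⟨C, hC⟩ := h.exists_lipschitz hN
  refine ⟨C, hC.mono fun ρ hρ x hx => ?_⟩
  have h1 := (isOpen_slab h.isOpen_U l).mem_nhds hx
  exact ⟨norm_pd_le_of_lipschitzOn h1 hρ.1 iτ, fun μ => norm_pd_le_of_lipschitzOn h1 (hρ.2 μ) iτ⟩

variable {𝒰 : Ultrafilter (ℝ × (Fin 5 → ℝ))}

theorem hasLim_ultra_tangent (h : ThinLimitAnsatz N U l V ε g φ n g₀ φ₀ n₀) (hN : 3 ≤ N)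
    (hχ : χ ∈ U) (h𝒰 : ↑𝒰 ≤ ribbon χ) :
    HasLim (𝒰 : Filter (ℝ × (Fin 5 → ℝ))) (fun p => pd iτ (φ p.1) p.2) ∧
      ∀ μ : Fin 4, HasLim (𝒰 : Filter (ℝ × (Fin 5 → ℝ)))
        (fun p => pd iτ (pd μ.castSucc (φ p.1)) p.2) := by
  obtain ⟨C, hC⟩ := h.exists_norm_le hN
  have h1 : ∀ᶠ p : ℝ × (Fin 5 → ℝ) in ribbon χ, ∀ x ∈ slab U l, ‖pd iτ (φ p.1) x‖ ≤ C ∧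
      ∀ μ : Fin 4, ‖pd iτ (pd μ.castSucc (φ p.1)) x‖ ≤ C := tendsto_fst.eventually hC
  refine ⟨HasLim.of_norm_le h𝒰 (C := C) ?_, fun μ => HasLim.of_norm_le h𝒰 (C := C) ?_⟩
  · filter_upwards [h1, h.eventually_ribbon hχ] with p h1 h2 using (h1 p.2 h2.2).1
  · filter_upwards [h1, h.eventually_ribbon hχ] with p h1 h2 using (h1 p.2 h2.2).2 μ

/-- Inside the ribbon `∂_τ φ` need not converge, but it is bounded, so it does along every
ultrafilter. The limit is again an oriented frame at the ridge with the same leaf directions, to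
which the rotation lemma applies. -/
theorem exists_ultra_frame (h : ThinLimitAnsatz N U l V ε g φ n g₀ φ₀ n₀) (hN : 3 ≤ N)
    (hχ : χ ∈ U) (h𝒰 : ↑𝒰 ≤ ribbon χ) :
    ∃ v w, Tendsto (fun p : ℝ × (Fin 5 → ℝ) => pd iτ (φ p.1) p.2) 𝒰 (𝓝 v) ∧
      Tendsto (fun p : ℝ × (Fin 5 → ℝ) => n p.1 p.2) 𝒰 (𝓝 w) ∧
      IsRidgeFrame ε (g₀ (leaf φ₀ 0 χ)) (ridgeVectors φ₀ χ v) w := by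
  obtain ⟨v, hv⟩ := (h.hasLim_ultra_tangent hN hχ h𝒰).1
  have he : ∀ᶠ p : ℝ × (Fin 5 → ℝ) in 𝒰, p.1 ∈ Ioo 0 l ∧ p.2 ∈ slab U l :=
    (h.eventually_ribbon hχ).filter_mono h𝒰
  obtain ⟨w, hw, hf⟩ := h.exists_tendsto_normal hN (L := (𝒰 : Filter (ℝ × (Fin 5 → ℝ)))) hχ
    (tendsto_fst_ribbon.mono_left h𝒰) (tendsto_snd_ribbon.mono_left h𝒰)
    (he.mono fun p hp h0 => absurd h0 hp.1.1.ne') (v := v) (hv.congr' (by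
      filter_upwards [he] with p hp
      rw [withLimit_of_ne hp.1.1.ne']))
  refine ⟨v, w, hv, hw.congr' ?_, hf⟩
  filter_upwards [he] with p hp
  rw [withLimit_of_ne hp.1.1.ne']

end ThinLimitAnsatz

end

noncomputable section

/-! ### Components along the ridge and in its normal plane -/

section Components

variable {d : ℕ}

/-- The linear form `⟨·, w⟩`. -/
def innerCLM (h : Fin d → Fin d → ℝ) (w : Fin d → ℝ) : (Fin d → ℝ) →L[ℝ] ℝ :=
  LinearMap.toContinuousLinearMap
    { toFun := fun v => metricInner h v w
      map_add' := fun u v => metricInner_add_left h u v w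
      map_smul' := fun c v => metricInner_smul_left h c v w }

/-- The components of a vector along `x` and `y`, as a complex number. -/
def planeCoord (h : Fin d → Fin d → ℝ) (x y : Fin d → ℝ) : (Fin d → ℝ) →L[ℝ] ℂ :=
  (Complex.equivRealProdCLM.symm : ℝ × ℝ →L[ℝ] ℂ).comp ((innerCLM h x).prod (innerCLM h y))

theorem planeCoord_apply (h : Fin d → Fin d → ℝ) (x y v : Fin d → ℝ) :
    planeCoord h x y v = ⟨metricInner h v x, metricInner h v y⟩ := by
  apply Complex.ext <;> simp [planeCoord, innerCLM]

/-- The components of a vector along the vectors `e μ`. -/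
def leafCoord {m : ℕ} (h : Fin d → Fin d → ℝ) (e : Fin m → Fin d → ℝ) :
    (Fin d → ℝ) →L[ℝ] (Fin m → ℝ) := ContinuousLinearMap.pi fun μ => innerCLM h (e μ)

theorem leafCoord_apply {m : ℕ} (h : Fin d → Fin d → ℝ) (e : Fin m → Fin d → ℝ) (v : Fin d → ℝ)
    (μ : Fin m) : leafCoord h e v μ = metricInner h v (e μ) := rfl

end Components

namespace IsRidgeFrame

variable {ε : ℝ} {h : Fin 6 → Fin 6 → ℝ} {v v' : Fin 5 → Fin 6 → ℝ} {n n' : Fin 6 → ℝ}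

theorem eq_zero_of_coord (hf : IsRidgeFrame ε h v n) {w : Fin 6 → ℝ}
    (hP : planeCoord h (v iτ) n w = 0) (hQ : leafCoord h (fun μ : Fin 4 => v μ.castSucc) w = 0) :
    w = 0 := by
  rw [planeCoord_apply] at hP
  refine hf.eq_zero (fun a => ?_) (congrArg Complex.im hP)
  refine Fin.lastCases (congrArg Complex.re hP) (fun μ => ?_) a
  have := congrFun hQ μ
  rwa [leafCoord_apply] at this

theorem planeCoord_comb (hf : IsRidgeFrame ε h v n) (a b : ℝ) :
    planeCoord h (v iτ) n (a • v iτ + b • n) = a + b * Complex.I := by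
  have h1 : metricInner h (v iτ) (v iτ) = 1 := hf.gram.tt
  rw [planeCoord_apply, metricInner_add_left, metricInner_add_left, metricInner_smul_left,
    metricInner_smul_left, metricInner_smul_left, metricInner_smul_left, hf.unit, hf.normal,
    metricInner_comm hf.symm (v iτ) n, hf.normal, h1]
  apply Complex.ext <;> simp

/-- In complex notation a rotation of the normal plane is multiplication by a unit number, which
commutes with the quarter turn from tangent to normal. -/
theorem planeCoord_rotated (hf : IsRidgeFrame ε h v n) (hf' : IsRidgeFrame ε h v' n')
    (he : ∀ μ : Fin 4, v' μ.castSucc = v μ.castSucc) :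
    ‖planeCoord h (v iτ) n (v' iτ)‖ = 1 ∧
      planeCoord h (v iτ) n n' = Complex.I * planeCoord h (v iτ) n (v' iτ) := by
  obtain ⟨a, b, hab, h1, h2⟩ := hf.exists_rotation hf' he
  rw [h1, h2, hf.planeCoord_comb, hf.planeCoord_comb]
  constructor
  · rw [← sq_eq_sq₀ (norm_nonneg _) zero_le_one, Complex.sq_norm, Complex.normSq_add_mul_I, hab,
      one_pow]
  · apply Complex.ext <;> simp

theorem leafCoord_eq_zero (hf : IsRidgeFrame ε h v n)
    (he : ∀ μ : Fin 4, v' μ.castSucc = v μ.castSucc) :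
    leafCoord h (fun μ : Fin 4 => v' μ.castSucc) (v iτ) = 0 := by
  funext μ
  rw [leafCoord_apply, he]
  exact hf.gram.tm μ

/-- A vector with convergent components in convergent frames converges. -/
theorem hasLim_of_inner {ι : Type*} {L : Filter ι} {h : ι → Fin 6 → Fin 6 → ℝ}
    {v : ι → Fin 5 → Fin 6 → ℝ} {n b : ι → Fin 6 → ℝ} {h₀ : Fin 6 → Fin 6 → ℝ}
    {v₀ : Fin 5 → Fin 6 → ℝ} {n₀ : Fin 6 → ℝ} (hs : ∀ᶠ i in L, IsRidgeFrame ε (h i) (v i) (n i))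
    (hh : Tendsto h L (𝓝 h₀)) (hv : Tendsto v L (𝓝 v₀)) (hn : Tendsto n L (𝓝 n₀))
    (hf : IsRidgeFrame ε h₀ v₀ n₀) (hbv : ∀ a, HasLim L fun i => metricInner (h i) (b i) (v i a))
    (hbn : HasLim L fun i => metricInner (h i) (b i) (n i)) : HasLim L b := by
  have hF : ∀ A B, HasLim L fun i => frameMatrix (v i) (n i) A B := fun A B => by
    refine Fin.lastCases ?_ (fun a => ?_) A
    · simp only [frameMatrix_last]
      exact ⟨_, tendsto_pi_nhds.1 hn B⟩
    · simp only [frameMatrix_castSucc]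
      exact ⟨_, tendsto_pi_nhds.1 (tendsto_pi_nhds.1 hv a) B⟩
  have hFd : HasDetLim L fun i A B => frameMatrix (v i) (n i) A B :=
    ⟨_, hf.frame_det_ne_zero, tendsto_frameMatrix_det hv hn⟩
  have hhc : ∀ A B, HasLim L fun i => h i A B := fun A B =>
    ⟨_, tendsto_pi_nhds.1 (tendsto_pi_nhds.1 hh A) B⟩
  have hhd : HasDetLim L h := ⟨_, hf.det_ne_zero, tendsto_det hh⟩
  have hβ : ∀ C, HasLim L fun i => metricInner (h i) (frameMatrix (v i) (n i) C) (b i) := by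
    intro C
    refine Fin.lastCases ?_ (fun a => ?_) C
    · refine hbn.congr ?_
      filter_upwards [hs] with i hi
      rw [metricInner_comm hi.symm, frameMatrix_last]
    · refine (hbv a).congr ?_
      filter_upwards [hs] with i hi
      rw [metricInner_comm hi.symm, frameMatrix_castSucc]
  have hγ : ∀ M, HasLim L fun i => ∑ C, invMetric (fun A B => frameMatrix (v i) (n i) A B) M C *
      metricInner (h i) (frameMatrix (v i) (n i) C) (b i) := fun M =>
    HasLim.sum _ fun C => (HasLim.invMetric hF hFd M C).mul (hβ C)
  have hδ : ∀ A, HasLim L fun i => ∑ M, invMetric (h i) A M *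
      ∑ C, invMetric (fun A B => frameMatrix (v i) (n i) A B) M C *
        metricInner (h i) (frameMatrix (v i) (n i) C) (b i) := fun A =>
    HasLim.sum _ fun M => (HasLim.invMetric hhc hhd A M).mul (hγ M)
  refine HasLim.pi fun A => (hδ A).congr ?_
  filter_upwards [hs] with i hi
  -- The vector is recovered from its components by inverting first the frame matrix and then the
  -- metric, both of which have nonzero limiting determinants.
  have e1 : (Matrix.of (h i))⁻¹ *ᵥ ((frameMatrix (v i) (n i))⁻¹ *ᵥ
      (frameMatrix (v i) (n i) *ᵥ (Matrix.of (h i) *ᵥ b i))) = b i := by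
    rw [Matrix.mulVec_mulVec _ (frameMatrix (v i) (n i))⁻¹,
      Matrix.nonsing_inv_mul _ (isUnit_iff_ne_zero.2 hi.frame_det_ne_zero), Matrix.one_mulVec,
      Matrix.mulVec_mulVec, Matrix.nonsing_inv_mul _ (isUnit_iff_ne_zero.2 hi.det_ne_zero),
      Matrix.one_mulVec]
  conv_rhs => rw [← e1]
  simp only [invMetric, ← mulVec_apply]
  rfl

end IsRidgeFrame

/-- The normal acceleration `n_L ∂_τ² φ^L` of the lines of constant `χ`. -/
def normalAccel (g : MetricField 6) (φ n : (Fin 5 → ℝ) → (Fin 6 → ℝ)) (x : Fin 5 → ℝ) : ℝ :=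
  metricInner (g (φ x)) (n x) (pd iτ (pd iτ φ) x)

/-- The components in the normal plane of the ridge, with respect to the face `τ > 0`. -/
def ridgePlane (g₀ : MetricField 6) (φ₀ n₀ : (Fin 5 → ℝ) → (Fin 6 → ℝ)) (χ : Fin 4 → ℝ) :
    (Fin 6 → ℝ) →L[ℝ] ℂ :=
  planeCoord (g₀ (leaf φ₀ 0 χ)) (tangentSide φ₀ (𝓝[>] 0) χ) (normalSide n₀ (𝓝[>] 0) χ)

/-- The components along the ridge. -/
def ridgeCoord (g₀ : MetricField 6) (φ₀ : (Fin 5 → ℝ) → (Fin 6 → ℝ)) (χ : Fin 4 → ℝ) :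
    (Fin 6 → ℝ) →L[ℝ] (Fin 4 → ℝ) :=
  leafCoord (g₀ (leaf φ₀ 0 χ)) fun μ => pd μ (leaf φ₀ 0) χ

namespace ThinLimitAnsatz

variable {N : ℕ} {U : Set (Fin 4 → ℝ)} {l : ℝ} {V : Set (Fin 6 → ℝ)} {ε : ℝ}
  {g : ℝ → MetricField 6} {φ n : ℝ → (Fin 5 → ℝ) → (Fin 6 → ℝ)}
  {g₀ : MetricField 6} {φ₀ n₀ : (Fin 5 → ℝ) → (Fin 6 → ℝ)} {χ : Fin 4 → ℝ}

theorem right_frame (h : ThinLimitAnsatz N U l V ε g φ n g₀ φ₀ n₀) (hN : 3 ≤ N) (hχ : χ ∈ U) :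
    IsRidgeFrame ε (g₀ (leaf φ₀ 0 χ)) (ridgeVectors φ₀ χ (tangentSide φ₀ (𝓝[>] 0) χ))
      (normalSide n₀ (𝓝[>] 0) χ) := (h.normal_outside hN hχ (Or.inl rfl)).2

theorem ridge_eq_zero (h : ThinLimitAnsatz N U l V ε g φ n g₀ φ₀ n₀) (hN : 3 ≤ N) (hχ : χ ∈ U)
    {w : Fin 6 → ℝ} (hP : ridgePlane g₀ φ₀ n₀ χ w = 0) (hQ : ridgeCoord g₀ φ₀ χ w = 0) :
    w = 0 := by
  refine (h.right_frame hN hχ).eq_zero_of_coord ?_ ?_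
  · rw [ridgeVectors_last]; exact hP
  · simp only [ridgeVectors_castSucc]; exact hQ

theorem ridgePlane_comb (h : ThinLimitAnsatz N U l V ε g φ n g₀ φ₀ n₀) (hN : 3 ≤ N) (hχ : χ ∈ U)
    (a b : ℝ) : ridgePlane g₀ φ₀ n₀ χ
      (a • tangentSide φ₀ (𝓝[>] 0) χ + b • normalSide n₀ (𝓝[>] 0) χ) = a + b * Complex.I := by
  have := (h.right_frame hN hχ).planeCoord_comb a b
  rwa [ridgeVectors_last] at this

/-- All three expressions are constant on the set of rotated reference frames, which contains every
cluster point of the actual frame. Hence they converge although the frame may keep turning. -/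
theorem tendsto_ribbon_frame (h : ThinLimitAnsatz N U l V ε g φ n g₀ φ₀ n₀) (hN : 3 ≤ N)
    (hχ : χ ∈ U) :
    Tendsto (fun p => ‖ridgePlane g₀ φ₀ n₀ χ (pd iτ (φ p.1) p.2)‖) (ribbon χ) (𝓝 1) ∧
    Tendsto (fun p => ridgePlane g₀ φ₀ n₀ χ (n p.1 p.2)
      - Complex.I * ridgePlane g₀ φ₀ n₀ χ (pd iτ (φ p.1) p.2)) (ribbon χ) (𝓝 0) ∧
    Tendsto (fun p => ridgeCoord g₀ φ₀ χ (pd iτ (φ p.1) p.2)) (ribbon χ) (𝓝 0) := by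
  simp only [tendsto_iff_ultrafilter _ (ribbon χ)]
  rw [← forall_and, ← forall_and]
  intro 𝒰
  rw [← imp_and, ← imp_and]
  intro h𝒰
  obtain ⟨v, w, hv, hw, hf⟩ := h.exists_ultra_frame hN hχ h𝒰
  have e1 := ((ridgePlane g₀ φ₀ n₀ χ).continuous.tendsto _).comp hv
  have e2 := ((ridgePlane g₀ φ₀ n₀ χ).continuous.tendsto _).comp hw
  have e3 := ((ridgeCoord g₀ φ₀ χ).continuous.tendsto _).comp hv
  obtain ⟨r1, r2⟩ := (h.right_frame hN hχ).planeCoord_rotated hf fun μ => by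
    rw [ridgeVectors_castSucc, ridgeVectors_castSucc]
  have r3 := hf.leafCoord_eq_zero (v' := ridgeVectors φ₀ χ v) fun μ => rfl
  simp only [ridgeVectors_last, ridgeVectors_castSucc] at r1 r2 r3
  refine ⟨?_, ?_, ?_⟩
  · rw [← r1]; exact e1.norm
  · have := e2.sub (e1.const_mul Complex.I)
    rw [ridgePlane, r2, sub_self] at this
    exact this
  · rw [← r3]; exact e3

/-- The reference frame is that of the face `τ > 0`, whose tangent is thus the number `1`; the
tangent of the other face is turned by `α`. -/
theorem tendsto_side_plane (h : ThinLimitAnsatz N U l V ε g φ n g₀ φ₀ n₀) (hN : 3 ≤ N)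
    (hχ : χ ∈ U) : ∃ α : ℝ, -Real.pi < α ∧ α < Real.pi ∧
      orientedDihedralAngle g₀ φ₀ n₀ χ = -α ∧
      Tendsto (fun p => ridgePlane g₀ φ₀ n₀ χ (pd iτ (withLimit φ φ₀ p.1) (gnc χ p.2)))
        (outside (𝓝[>] 0)) (𝓝 1) ∧
      Tendsto (fun p => ridgePlane g₀ φ₀ n₀ χ (pd iτ (withLimit φ φ₀ p.1) (gnc χ p.2)))
        (outside (𝓝[<] 0)) (𝓝 (Complex.exp (α * Complex.I))) := by
  obtain ⟨α, h1, h2, h3, h4, -⟩ := h.exists_angle hN hχ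
  refine ⟨α, h1, h2, h4, ?_, ?_⟩
  · have e1 := ((ridgePlane g₀ φ₀ n₀ χ).continuous.tendsto _).comp
      (h.tendsto_tangent hN hχ (Or.inl rfl))
    have e2 := h.ridgePlane_comb hN hχ 1 0
    simp only [one_smul, zero_smul, add_zero, Complex.ofReal_one, Complex.ofReal_zero,
      zero_mul] at e2
    rwa [e2] at e1
  · have e1 := ((ridgePlane g₀ φ₀ n₀ χ).continuous.tendsto _).comp
      (h.tendsto_tangent hN hχ (Or.inr rfl))
    rw [h3, h.ridgePlane_comb hN hχ] at e1
    rwa [Complex.exp_mul_I, ← Complex.ofReal_cos, ← Complex.ofReal_sin]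

/-- The `τ`-derivatives of the conditions defining Gaussian normal coordinates. -/
theorem inner_accel (h : ThinLimitAnsatz N U l V ε g φ n g₀ φ₀ n₀) (hN : 3 ≤ N) {ρ : ℝ}
    (hρ : ρ ∈ Ioo 0 l) {x : Fin 5 → ℝ} (hx : x ∈ slab U l) (a : Fin 5) :
    metricInner (g ρ (φ ρ x)) (pd iτ (pd iτ (φ ρ)) x) (pd a (φ ρ) x)
      = -metricInner (fun A B => ∑ C, pd iτ (φ ρ) x C * pd C (fun Y => g ρ Y A B) (φ ρ x))
          (pd iτ (φ ρ) x) (pd a (φ ρ) x)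
        - metricInner (g ρ (φ ρ x)) (pd iτ (φ ρ) x) (pd iτ (pd a (φ ρ)) x) := by
  have h1 := pd_inducedMetric (g := g ρ) (f := φ ρ) (x := x)
    (fun A B => (h.approx_metric_contDiffAt hN hρ hx A B).differentiableAt (by simp))
    ((h.approx_contDiffAt hN hρ hx).of_le (by exact_mod_cast (by norm_num : 2 ≤ 3))) iτ iτ a
  have h2 : pd iτ (fun y => inducedMetric (g ρ) (φ ρ) y iτ a) x = 0 := by
    refine Fin.lastCases ?_ (fun μ => ?_) a
    · exact pd_eq_zero_of_eqOn (isOpen_slab h.isOpen_U l) (fun y hy => h.gauss_tt ρ hρ y hy) _ hx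
    · exact pd_eq_zero_of_eqOn (isOpen_slab h.isOpen_U l) (fun y hy => h.gauss_tm ρ hρ y hy μ) _ hx
  rw [h2] at h1
  linarith

/-- The tangential part of the acceleration is bounded. -/
theorem exists_accel_sub_le (h : ThinLimitAnsatz N U l V ε g φ n g₀ φ₀ n₀) (hN : 3 ≤ N)
    (hχ : χ ∈ U) : ∃ C, ∀ᶠ p in ribbon χ,
      ‖pd iτ (pd iτ (φ p.1)) p.2 - normalAccel (g p.1) (φ p.1) (n p.1) p.2 • n p.1 p.2‖ ≤ C := by
  refine exists_norm_le_of_ultrafilter fun 𝒰 h𝒰 => ?_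
  obtain ⟨v, w, hv, hw, hf⟩ := h.exists_ultra_frame hN hχ h𝒰
  have he : ∀ᶠ p : ℝ × (Fin 5 → ℝ) in 𝒰, p.1 ∈ Ioo 0 l ∧ p.2 ∈ slab U l :=
    (h.eventually_ribbon hχ).filter_mono h𝒰
  have hpar := fun μ => (h.tendsto_ribbon_par hN hχ μ).mono_left h𝒰
  have hτ := (h.hasLim_ultra_tangent hN hχ h𝒰).2
  have hg : ∀ A B, ConvJet 1 (𝒰 : Filter (ℝ × (Fin 5 → ℝ))) (fun p Y => g p.1 Y A B)
      fun p => φ p.1 p.2 := fun A B => ((h.convJet_ribbon_metric hN hχ A B).of_le (by omega)).mono h𝒰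
  have hvl : ∀ A, HasLim (𝒰 : Filter (ℝ × (Fin 5 → ℝ))) fun p => pd iτ (φ p.1) p.2 A :=
    fun A => HasLim.apply ⟨v, hv⟩ A
  have hva : ∀ a, Tendsto (fun p : ℝ × (Fin 5 → ℝ) => pd a (φ p.1) p.2) 𝒰
      (𝓝 (ridgeVectors φ₀ χ v a)) := fun a => by
    refine Fin.lastCases ?_ (fun μ => ?_) a
    · rw [ridgeVectors_last]; exact hv
    · rw [ridgeVectors_castSucc]; exact hpar μ
  have hM : ∀ a, HasLim (𝒰 : Filter (ℝ × (Fin 5 → ℝ))) fun p =>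
      metricInner (fun A B => ∑ C, pd iτ (φ p.1) p.2 C * pd C (fun Y => g p.1 Y A B) (φ p.1 p.2))
          (pd iτ (φ p.1) p.2) (pd a (φ p.1) p.2) := fun a =>
    HasLim.metricInner (fun A B => HasLim.sum _ fun C => (hvl C).mul ((hg A B).pd C).hasLim) hvl
      fun A => HasLim.apply ⟨_, hva a⟩ A
  refine IsRidgeFrame.hasLim_of_inner (ε := ε)
    (h := fun p : ℝ × (Fin 5 → ℝ) => g p.1 (φ p.1 p.2))
    (v := fun p a => pd a (φ p.1) p.2) (n := fun p => n p.1 p.2) ?_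
    ((h.tendsto_ribbon_metric hχ).mono_left h𝒰) (tendsto_pi_nhds.2 hva) hw hf (fun a => ?_) ?_
  · filter_upwards [he] with p hp using h.approx_isRidgeFrame hN hp.1 hp.2
  · have h1 : HasLim (𝒰 : Filter (ℝ × (Fin 5 → ℝ))) fun p =>
        metricInner (g p.1 (φ p.1 p.2)) (pd iτ (pd iτ (φ p.1)) p.2) (pd a (φ p.1) p.2) := by
      refine Fin.lastCases ?_ (fun μ => ?_) a
      -- Along `τ` itself the inner product of acceleration and velocity occurs on both sides of the
      -- differentiated gauge condition, hence the factor `1/2`.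
      · refine ((hM iτ).const_mul (-(1 / 2))).congr ?_
        filter_upwards [he] with p hp
        have h2 := h.inner_accel hN hp.1 hp.2 iτ
        rw [metricInner_comm (h.approx_isRidgeFrame hN hp.1 hp.2).symm (pd iτ (φ p.1) p.2)
          (pd iτ (pd iτ (φ p.1)) p.2)] at h2
        linarith
      · refine ((hM μ.castSucc).neg.sub (HasLim.metricInner (fun A B => (hg A B).hasLim) hvl
          fun A => (hτ μ).apply A)).congr ?_
        filter_upwards [he] with p hp
        exact (h.inner_accel hN hp.1 hp.2 μ.castSucc).symm
    refine h1.congr ?_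
    filter_upwards [he] with p hp
    rw [metricInner_sub_left, metricInner_smul_left,
      (h.approx_isRidgeFrame hN hp.1 hp.2).normal, mul_zero, sub_zero]
  · refine (HasLim.const 0).congr ?_
    filter_upwards [he] with p hp
    have hfr := h.approx_isRidgeFrame hN hp.1 hp.2
    rw [metricInner_sub_left, metricInner_smul_left, hfr.unit, mul_one, normalAccel,
      metricInner_comm hfr.symm, sub_self]

end ThinLimitAnsatz

end

/-! ### Error terms across the ribbon -/

noncomputable section

theorem eventually_ribbon_Icc {χ : Fin 4 → ℝ} {Q : ℝ × (Fin 5 → ℝ) → Prop}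
    (hQ : ∀ᶠ p in ribbon χ, Q p) :
    ∀ᶠ ρ in 𝓝[>] (0 : ℝ), ∀ τ ∈ Icc (-ρ) ρ, Q (ρ, gnc χ τ) := by
  obtain ⟨A, hA, B, hB, hAB⟩ := eventually_prod_iff.1 hQ
  have h1 : ∀ᶠ τ in 𝓝 (0 : ℝ), B (gnc χ τ) := ((continuous_gnc_right χ).tendsto 0).eventually hB
  obtain ⟨δ, hδ, H⟩ := Metric.eventually_nhds_iff.1 h1
  filter_upwards [hA, Ioo_mem_nhdsGT hδ] with ρ hρ hρδ τ hτ
  refine hAB hρ (H ?_)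
  rw [Real.dist_0_eq_abs]
  exact (abs_le.2 hτ).trans_lt hρδ.2

theorem continuousOn_line {U : Set (Fin 4 → ℝ)} {χ : Fin 4 → ℝ} (hχ : χ ∈ U) {l ρ : ℝ}
    (hρ : ρ ∈ Ioo 0 l) {E : Type*} [TopologicalSpace E] {f : (Fin 5 → ℝ) → E}
    (hf : ∀ x ∈ slab U l, ContinuousAt f x) :
    ContinuousOn (fun τ => f (gnc χ τ)) (uIcc (-ρ) ρ) := fun τ hτ => by
  rw [uIcc_of_le (by linarith [hρ.1])] at hτ
  exact ((hf _ (mem_slab_gnc.2 ⟨hχ, (abs_le.2 hτ).trans_lt hρ.2⟩)).comp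
    (continuous_gnc_right χ).continuousAt).continuousWithinAt

namespace ThinLimitAnsatz

variable {N : ℕ} {U : Set (Fin 4 → ℝ)} {l : ℝ} {V : Set (Fin 6 → ℝ)} {ε : ℝ}
  {g : ℝ → MetricField 6} {φ n : ℝ → (Fin 5 → ℝ) → (Fin 6 → ℝ)}
  {g₀ : MetricField 6} {φ₀ n₀ : (Fin 5 → ℝ) → (Fin 6 → ℝ)} {χ : Fin 4 → ℝ}

/-! #### Continuity of the approximating configurations -/

/-- At fixed `ρ` the families are constant in the index and only the point moves. Continuity of the
normal field, which the ansatz does not postulate, comes out of the same argument. -/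
theorem approx_continuousAt (h : ThinLimitAnsatz N U l V ε g φ n g₀ φ₀ n₀) (hN : 3 ≤ N) {ρ : ℝ}
    (hρ : ρ ∈ Ioo 0 l) {x : Fin 5 → ℝ} (hx : x ∈ slab U l) (M₆ M₅ : ℝ) (a b : Fin 5) :
    ContinuousAt (n ρ) x ∧
      ContinuousAt (fun y => israelLHS M₆ M₅ (g ρ) (φ ρ) (n ρ) y a b) x := by
  refine _root_.tendsto_israelLHS (L := 𝓝 x) (i₀ := x) (ε := ε) (g := fun _ => g ρ)
    (φ := fun _ => φ ρ) (n := fun _ => n ρ) (x := fun y => y) (fun A B => ?_) ?_ ?_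
    (pure_le_nhds x) M₆ M₅ a b
  · exact ConvJet.of_contDiffAt ((h.approx_metric_contDiffAt hN hρ hx A B).of_le
      (by exact_mod_cast (by norm_num : 2 ≤ 3)))
      (h.approx_contDiffAt hN hρ hx).continuousAt.tendsto
  · exact ConvJet.of_contDiffAt (h.approx_contDiffAt hN hρ hx) tendsto_id
  · filter_upwards [(isOpen_slab h.isOpen_U l).mem_nhds hx] with y hy
    exact h.approx_isRidgeFrame hN hρ hy

theorem approx_pd_contDiffAt (h : ThinLimitAnsatz N U l V ε g φ n g₀ φ₀ n₀) (hN : 3 ≤ N) {ρ : ℝ}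
    (hρ : ρ ∈ Ioo 0 l) {x : Fin 5 → ℝ} (hx : x ∈ slab U l) (a : Fin 5) :
    ContDiffAt ℝ (2 : ℕ) (pd a (φ ρ)) x := (h.approx_contDiffAt hN hρ hx).pd (k := 2) a

theorem approx_pd_pd_contDiffAt (h : ThinLimitAnsatz N U l V ε g φ n g₀ φ₀ n₀) (hN : 3 ≤ N)
    {ρ : ℝ} (hρ : ρ ∈ Ioo 0 l) {x : Fin 5 → ℝ} (hx : x ∈ slab U l) (a b : Fin 5) :
    ContDiffAt ℝ (1 : ℕ) (pd a (pd b (φ ρ))) x := (h.approx_pd_contDiffAt hN hρ hx b).pd (k := 1) a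

theorem approx_accel_continuousAt (h : ThinLimitAnsatz N U l V ε g φ n g₀ φ₀ n₀) (hN : 3 ≤ N)
    {ρ : ℝ} (hρ : ρ ∈ Ioo 0 l) {x : Fin 5 → ℝ} (hx : x ∈ slab U l) :
    ContinuousAt (normalAccel (g ρ) (φ ρ) (n ρ)) x := by
  refine tendsto_metricInner (l := 𝓝 x) ?_ (h.approx_continuousAt hN hρ hx 0 0 0 0).1
    (h.approx_pd_pd_contDiffAt hN hρ hx iτ iτ).continuousAt
  exact tendsto_pi_nhds.2 fun A => tendsto_pi_nhds.2 fun B =>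
    (h.approx_metric_contDiffAt hN hρ hx A B).continuousAt.tendsto.comp
      (h.approx_contDiffAt hN hρ hx).continuousAt.tendsto

/-! #### Integrals across the ribbon -/

theorem tendsto_abs_integral (h : ThinLimitAnsatz N U l V ε g φ n g₀ φ₀ n₀) (hχ : χ ∈ U) :
    ∃ I : ℝ, Tendsto (fun ρ => ∫ τ in (-ρ)..ρ, |normalAccel (g ρ) (φ ρ) (n ρ) (gnc χ τ)|)
      (𝓝[>] 0) (𝓝 I) := h.abs_integral χ hχ

/-- A quantity which is small compared with the normal acceleration up to a bounded term does not
contribute to the thin limit. -/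
theorem tendsto_integral_zero (h : ThinLimitAnsatz N U l V ε g φ n g₀ φ₀ n₀) (hN : 3 ≤ N)
    (hχ : χ ∈ U) {F : ℝ × (Fin 5 → ℝ) → ℝ}
    (hF : ∀ e > 0, ∃ C, ∀ᶠ p in ribbon χ,
      |F p| ≤ e * |normalAccel (g p.1) (φ p.1) (n p.1) p.2| + C) :
    Tendsto (fun ρ => ∫ τ in (-ρ)..ρ, F (ρ, gnc χ τ)) (𝓝[>] 0) (𝓝 0) := by
  obtain ⟨I, hI⟩ := h.tendsto_abs_integral hχ
  have hI0 : 0 ≤ I := by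
    refine ge_of_tendsto hI ?_
    filter_upwards [self_mem_nhdsWithin] with ρ hρ
    exact intervalIntegral.integral_nonneg (by linarith [show (0 : ℝ) < ρ from hρ])
      fun τ _ => abs_nonneg _
  refine Metric.tendsto_nhds.2 fun e he => ?_
  -- With this constant the first term contributes at most `e/2` in the limit, the `+ 1` allowing
  -- for `I = 0`; the bounded term contributes `2ρC`, which vanishes.
  obtain ⟨C, hC⟩ := hF (e / (2 * (I + 1))) (by positivity)
  have h1 : Tendsto (fun ρ : ℝ => e / (2 * (I + 1)) *
      (∫ τ in (-ρ)..ρ, |normalAccel (g ρ) (φ ρ) (n ρ) (gnc χ τ)|) + (ρ - -ρ) * C) (𝓝[>] 0)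
      (𝓝 (e / (2 * (I + 1)) * I + (0 - -0) * C)) := by
    have h2 : Tendsto (fun ρ : ℝ => ρ) (𝓝[>] 0) (𝓝 0) := nhdsWithin_le_nhds
    exact (hI.const_mul _).add ((h2.sub h2.neg).mul_const C)
  have h3 : e / (2 * (I + 1)) * I + (0 - -0) * C < e := by
    have : e / (2 * (I + 1)) * I ≤ e / 2 := by
      rw [div_mul_eq_mul_div, div_le_div_iff₀ (by positivity) (by positivity)]
      nlinarith
    linarith
  filter_upwards [h1.eventually_lt_const h3, Ioo_mem_nhdsGT h.l_pos, eventually_ribbon_Icc hC]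
    with ρ h4 hρ h5
  rw [Real.dist_0_eq_abs]
  refine lt_of_le_of_lt ?_ h4
  have h6 : ContinuousOn (fun τ => |normalAccel (g ρ) (φ ρ) (n ρ) (gnc χ τ)|) (uIcc (-ρ) ρ) :=
    continuousOn_line hχ hρ fun x hx => (h.approx_accel_continuousAt hN hρ hx).abs
  have h7 : IntervalIntegrable (fun τ => e / (2 * (I + 1)) *
      |normalAccel (g ρ) (φ ρ) (n ρ) (gnc χ τ)|) MeasureTheory.volume (-ρ) ρ :=
    (continuousOn_const.mul h6).intervalIntegrable
  have h8 := intervalIntegral.norm_integral_le_of_norm_le (μ := MeasureTheory.volume)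
    (f := fun τ => F (ρ, gnc χ τ)) (a := -ρ) (b := ρ)
    (g := fun τ => e / (2 * (I + 1)) * |normalAccel (g ρ) (φ ρ) (n ρ) (gnc χ τ)| + C)
    (by linarith [hρ.1]) (Eventually.of_forall fun τ hτ => h5 τ (Ioc_subset_Icc_self hτ))
    (h7.add (by simp))
  rw [intervalIntegral.integral_add h7 (by simp), intervalIntegral.integral_const_mul,
    intervalIntegral.integral_const, smul_eq_mul] at h8
  exact h8

/-- Inside the ribbon the tangent turns at the rate given by the normal acceleration. -/
theorem exists_im_div_sub_le (h : ThinLimitAnsatz N U l V ε g φ n g₀ φ₀ n₀) (hN : 3 ≤ N)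
    (hχ : χ ∈ U) {e : ℝ} (he : 0 < e) : ∃ C, ∀ᶠ p in ribbon χ,
      |(ridgePlane g₀ φ₀ n₀ χ (pd iτ (pd iτ (φ p.1)) p.2)
        / ridgePlane g₀ φ₀ n₀ χ (pd iτ (φ p.1) p.2)).im - normalAccel (g p.1) (φ p.1) (n p.1) p.2|
        ≤ e * |normalAccel (g p.1) (φ p.1) (n p.1) p.2| + C := by
  obtain ⟨C, hC⟩ := h.exists_accel_sub_le hN hχ
  obtain ⟨t1, t2, -⟩ := h.tendsto_ribbon_frame hN hχ
  refine ⟨2 * (‖ridgePlane g₀ φ₀ n₀ χ‖ * C), ?_⟩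
  have t3 : ∀ᶠ p in ribbon χ, 1 / 2 < ‖ridgePlane g₀ φ₀ n₀ χ (pd iτ (φ p.1) p.2)‖ :=
    t1.eventually_const_lt (by norm_num)
  have t4 : ∀ᶠ p in ribbon χ, ‖ridgePlane g₀ φ₀ n₀ χ (n p.1 p.2)
      - Complex.I * ridgePlane g₀ φ₀ n₀ χ (pd iτ (φ p.1) p.2)‖ < e / 2 := by
    have := t2.norm
    rw [norm_zero] at this
    exact this.eventually_lt_const (by positivity)
  filter_upwards [hC, t3, t4] with p p1 p2 p3
  generalize hκ : normalAccel (g p.1) (φ p.1) (n p.1) p.2 = κ at p1 ⊢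
  generalize hz : ridgePlane g₀ φ₀ n₀ χ (pd iτ (φ p.1) p.2) = z at p2 p3 ⊢
  generalize hA : pd iτ (pd iτ (φ p.1)) p.2 = A at p1 ⊢
  generalize hn : n p.1 p.2 = ν at p1 p3
  have hz0 : z ≠ 0 := norm_pos_iff.1 (by linarith)
  -- The acceleration is split into `κ` times the normal and a bounded rest, and the image of the
  -- normal into `i z` and a small rest. The main part `κ i z` divided by `z` has imaginary part
  -- `κ`; the bound `|z| > 1/2` costs the factor `2` in the errors.
  have e1 : ridgePlane g₀ φ₀ n₀ χ A = κ * (Complex.I * z)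
      + (κ * (ridgePlane g₀ φ₀ n₀ χ ν - Complex.I * z) + ridgePlane g₀ φ₀ n₀ χ (A - κ • ν)) := by
    rw [map_sub, map_smul, Complex.real_smul]; ring
  have e2 : (ridgePlane g₀ φ₀ n₀ χ A / z).im - κ
      = ((κ * (ridgePlane g₀ φ₀ n₀ χ ν - Complex.I * z)
        + ridgePlane g₀ φ₀ n₀ χ (A - κ • ν)) / z).im := by
    rw [e1, add_div, Complex.add_im]
    have : (κ : ℂ) * (Complex.I * z) / z = κ * Complex.I := by field_simp
    rw [this]
    simp
  rw [e2]
  refine (Complex.abs_im_le_norm _).trans ?_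
  rw [norm_div, div_le_iff₀ (by linarith)]
  have e3 : ‖(κ : ℂ) * (ridgePlane g₀ φ₀ n₀ χ ν - Complex.I * z)‖ ≤ |κ| * (e / 2) := by
    rw [norm_mul, Complex.norm_real, Real.norm_eq_abs]
    gcongr
  have e4 : ‖ridgePlane g₀ φ₀ n₀ χ (A - κ • ν)‖ ≤ ‖ridgePlane g₀ φ₀ n₀ χ‖ * C :=
    (ContinuousLinearMap.le_opNorm _ _).trans (by gcongr)
  have e5 : 0 ≤ e * |κ| + 2 * (‖ridgePlane g₀ φ₀ n₀ χ‖ * C) := by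
    have := (norm_nonneg _).trans e4
    positivity
  calc _ ≤ |κ| * (e / 2) + ‖ridgePlane g₀ φ₀ n₀ χ‖ * C := (norm_add_le _ _).trans (add_le_add e3 e4)
    _ = (e * |κ| + 2 * (‖ridgePlane g₀ φ₀ n₀ χ‖ * C)) * (1 / 2) := by ring
    _ ≤ _ := by gcongr

theorem tendsto_im_integral_sub (h : ThinLimitAnsatz N U l V ε g φ n g₀ φ₀ n₀) (hN : 3 ≤ N)
    (hχ : χ ∈ U) : Tendsto (fun ρ => (∫ τ in (-ρ)..ρ,
        ridgePlane g₀ φ₀ n₀ χ (pd iτ (pd iτ (φ ρ)) (gnc χ τ))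
          / ridgePlane g₀ φ₀ n₀ χ (pd iτ (φ ρ) (gnc χ τ))).im
        - ∫ τ in (-ρ)..ρ, normalAccel (g ρ) (φ ρ) (n ρ) (gnc χ τ)) (𝓝[>] 0) (𝓝 0) := by
  refine (h.tendsto_integral_zero hN hχ fun e he => h.exists_im_div_sub_le hN hχ he).congr' ?_
  obtain ⟨t1, -, -⟩ := h.tendsto_ribbon_frame hN hχ
  have t3 : ∀ᶠ p in ribbon χ, 0 < ‖ridgePlane g₀ φ₀ n₀ χ (pd iτ (φ p.1) p.2)‖ :=
    t1.eventually_const_lt (by norm_num)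
  filter_upwards [Ioo_mem_nhdsGT h.l_pos, eventually_ribbon_Icc t3] with ρ hρ h3
  have c1 : ContinuousOn (fun τ => ridgePlane g₀ φ₀ n₀ χ (pd iτ (pd iτ (φ ρ)) (gnc χ τ)))
      (uIcc (-ρ) ρ) := continuousOn_line hχ hρ fun x hx =>
    (ridgePlane g₀ φ₀ n₀ χ).continuous.continuousAt.comp
      (h.approx_pd_pd_contDiffAt hN hρ hx iτ iτ).continuousAt
  have c2 : ContinuousOn (fun τ => ridgePlane g₀ φ₀ n₀ χ (pd iτ (φ ρ) (gnc χ τ)))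
      (uIcc (-ρ) ρ) := continuousOn_line hχ hρ fun x hx =>
    (ridgePlane g₀ φ₀ n₀ χ).continuous.continuousAt.comp
      (h.approx_pd_contDiffAt hN hρ hx iτ).continuousAt
  have c3 := (c1.div c2 fun τ hτ => norm_pos_iff.1 (h3 τ (by
    rwa [uIcc_of_le (by linarith [hρ.1])] at hτ))).intervalIntegrable (μ := MeasureTheory.volume)
  have c4 : IntervalIntegrable (fun τ => normalAccel (g ρ) (φ ρ) (n ρ) (gnc χ τ))
      MeasureTheory.volume (-ρ) ρ := (continuousOn_line hχ hρ fun x hx =>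
    h.approx_accel_continuousAt hN hρ hx).intervalIntegrable
  have c5 := Complex.imCLM.intervalIntegral_comp_comm c3
  simp only [Complex.imCLM_apply, Pi.div_apply] at c5
  rw [← c5, ← intervalIntegral.integral_sub _ c4]
  exact (Complex.continuous_im.comp_continuousOn (c1.div c2 fun τ hτ => norm_pos_iff.1 (h3 τ (by
    rwa [uIcc_of_le (by linarith [hρ.1])] at hτ)))).intervalIntegrable

end ThinLimitAnsatz

end

noncomputable section

/-! ### Lines in the image of a local diffeomorphism -/

section Calculus

variable {d : ℕ} {F : Type*} [NormedAddCommGroup F] [NormedSpace ℝ F]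

theorem pd_comm {f : (Fin d → ℝ) → F} {x : Fin d → ℝ} (hf : ContDiffAt ℝ (2 : ℕ) f x)
    (a b : Fin d) : pd a (pd b f) x = pd b (pd a f) x := by
  have h1 : ∀ a b : Fin d, pd a (pd b f) x
      = fderiv ℝ (fderiv ℝ f) x (Pi.single a 1) (Pi.single b 1) := fun a b => by
    have h2 : DifferentiableAt ℝ (fderiv ℝ f) x :=
      (hf.fderiv_right (m := 1) (by norm_cast)).differentiableAt (by simp)
    rw [(eventuallyEq_pd a (eventually_pd_eq_fderiv (k := 1) b hf)).self_of_nhds,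
      pd_eq_fderiv (h2.clm_apply (differentiableAt_const _)),
      fderiv_clm_apply h2 (differentiableAt_const _)]
    simp
  rw [h1, h1]
  exact hf.isSymmSndFDerivAt (by simp) _ _

theorem fderiv_eq_sum_smulRight {f : (Fin d → ℝ) → F} {x : Fin d → ℝ}
    (h : DifferentiableAt ℝ f x) : fderiv ℝ f x
      = ∑ A, (ContinuousLinearMap.proj (R := ℝ) (φ := fun _ : Fin d => ℝ) A).smulRight (pd A f x) := by
  ext1 v
  rw [fderiv_eq_sum_pd h]
  simp

theorem norm_fderiv_le_of_pd {f : (Fin d → ℝ) → F} {x : Fin d → ℝ}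
    (h : DifferentiableAt ℝ f x) {C : ℝ} (hC0 : 0 ≤ C) (hC : ∀ A, ‖pd A f x‖ ≤ C) :
    ‖fderiv ℝ f x‖ ≤ d * C := by
  refine ContinuousLinearMap.opNorm_le_bound _ (by positivity) fun v => ?_
  rw [fderiv_eq_sum_pd h]
  refine (norm_sum_le _ _).trans ?_
  calc ∑ A, ‖v A • pd A f x‖ ≤ ∑ _A : Fin d, ‖v‖ * C := by
        refine Finset.sum_le_sum fun A _ => ?_
        rw [norm_smul]
        exact mul_le_mul (norm_le_pi_norm v A) (hC A) (norm_nonneg _) (norm_nonneg _)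
    _ = d * C * ‖v‖ := by simp; ring

theorem tendsto_fderiv_of_pd {ι : Type*} {L : Filter ι} {f : ι → (Fin d → ℝ) → F}
    {x : ι → Fin d → ℝ} {a : Fin d → F} (hd : ∀ᶠ i in L, DifferentiableAt ℝ (f i) (x i))
    (h : ∀ A, Tendsto (fun i => pd A (f i) (x i)) L (𝓝 (a A))) :
    Tendsto (fun i => fderiv ℝ (f i) (x i)) L
      (𝓝 (∑ A, (ContinuousLinearMap.proj (R := ℝ) (φ := fun _ : Fin d => ℝ) A).smulRight (a A))) := by
  have h1 : Tendsto (fun i => ∑ A, (ContinuousLinearMap.proj (R := ℝ)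
      (φ := fun _ : Fin d => ℝ) A).smulRight (pd A (f i) (x i))) L
      (𝓝 (∑ A, (ContinuousLinearMap.proj (R := ℝ) (φ := fun _ : Fin d => ℝ) A).smulRight (a A))) :=
    tendsto_finsetSum _ fun A _ => ((ContinuousLinearMap.smulRightL ℝ (Fin d → ℝ) F
      (ContinuousLinearMap.proj (R := ℝ) (φ := fun _ : Fin d => ℝ) A)).continuous.tendsto _).comp
        (h A)
  refine h1.congr' ?_
  filter_upwards [hd] with i hi
  rw [fderiv_eq_sum_smulRight hi]

/-- If the derivative of `f` is close to the isomorphism `A` on a ball, lines through the image of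
the centre lift to curves in the ball. -/
theorem exists_lift_line {E : Type*} [NormedAddCommGroup E] [NormedSpace ℝ E] [CompleteSpace E]
    [Nontrivial E] (A : E ≃L[ℝ] E) {f : E → E} {b w : E} {R : ℝ} (hR : 0 < R)
    (hf : ∀ x ∈ Metric.ball b R, DifferentiableAt ℝ f x)
    (hfc : ∀ x ∈ Metric.ball b R, ContinuousAt (fderiv ℝ f) x)
    (hB : ∀ x ∈ Metric.ball b R, fderiv ℝ f x ∈ range ((↑) : (E ≃L[ℝ] E) → E →L[ℝ] E))
    (hA : ∀ x ∈ Metric.ball b R,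
      ‖fderiv ℝ f x - A‖ ≤ (‖(A.symm : E →L[ℝ] E)‖₊⁻¹ / 2 : ℝ≥0)) :
    ∃ c : ℝ → E, ∀ τ, ‖τ • w‖ ≤ (‖(A.symm : E →L[ℝ] E)‖₊⁻¹ / 2 : ℝ≥0) * (R / 2) →
      c τ ∈ Metric.ball b R ∧ f (c τ) = f b + τ • w ∧
        HasDerivAt c ((fderiv ℝ f (c τ)).inverse w) τ ∧
        ContinuousAt (fun τ => (fderiv ℝ f (c τ)).inverse w) τ := by
  set N : ℝ≥0 := ‖(A.symm : E →L[ℝ] E)‖₊ with hN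
  have hN0 : 0 < N := by
    rw [hN, nnnorm_pos]
    intro h0
    obtain ⟨x, hx⟩ := exists_ne (0 : E)
    refine hx (A.symm.injective ?_)
    have := congrArg (fun L : E →L[ℝ] E => L x) h0
    simpa using this
  have hc : N⁻¹ / 2 < N⁻¹ := NNReal.half_lt_self (inv_ne_zero hN0.ne')
  have happ : ApproximatesLinearOn f (A : E →L[ℝ] E) (Metric.ball b R) (N⁻¹ / 2) :=
    fun x hx y hy => Convex.norm_image_sub_le_of_norm_hasFDerivWithin_le'
      (fun z hz => (hf z hz).hasFDerivAt.hasFDerivWithinAt) hA (convex_ball b R) hy hx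
  set e := happ.toOpenPartialHomeomorph f (Metric.ball b R) (Or.inr hc) Metric.isOpen_ball with he
  have hec : ∀ x, e x = f x := fun x => rfl
  -- The deviation `N⁻¹ / 2` is half of what the inverse function theorem tolerates, so the other
  -- half is the expansion constant. The radius `R / 2` makes the closed ball fit into the open one.
  have ht : Metric.closedBall (f b) ((N⁻¹ / 2 : ℝ≥0) * (R / 2)) ⊆ e.target := by
    have := happ.closedBall_subset_target (Or.inr hc) Metric.isOpen_ball (b := b)
      (ε := R / 2) (by positivity) (Metric.closedBall_subset_ball (by linarith))
    have h2 : ((N⁻¹ : ℝ≥0) : ℝ) - (N⁻¹ / 2 : ℝ≥0) = (N⁻¹ / 2 : ℝ≥0) := by push_cast; ring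
    rwa [h2] at this
  have hl : ∀ τ : ℝ, HasDerivAt (fun τ : ℝ => f b + τ • w) w τ := fun τ => by
    simpa using ((hasDerivAt_id τ).smul_const w).const_add (f b)
  refine ⟨fun τ => e.symm (f b + τ • w), fun τ hτ => ?_⟩
  have hmem : f b + τ • w ∈ e.target := ht (by simpa [dist_eq_norm] using hτ)
  have hball : e.symm (f b + τ • w) ∈ Metric.ball b R := e.map_target hmem
  obtain ⟨B, hBe⟩ := hB _ hball
  have hd : HasFDerivAt e (B : E →L[ℝ] E) (e.symm (f b + τ • w)) := by
    rw [hBe]; exact (hf _ hball).hasFDerivAt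
  have hder : HasDerivAt (fun τ => e.symm (f b + τ • w)) (B.symm w) τ :=
    HasFDerivAt.comp_hasDerivAt (f := fun τ : ℝ => f b + τ • w) τ (e.hasFDerivAt_symm hmem hd) (hl τ)
  refine ⟨hball, by rw [← hec, e.right_inv hmem], ?_, ?_⟩
  · rw [← hBe, ContinuousLinearMap.inverse_equiv]; exact hder
  · have h1 : ContinuousAt (fun τ => fderiv ℝ f (e.symm (f b + τ • w))) τ :=
      ContinuousAt.comp (f := fun τ => e.symm (f b + τ • w)) (hfc _ hball) hder.continuousAt
    have h2 : ContinuousAt ContinuousLinearMap.inverse (fderiv ℝ f (e.symm (f b + τ • w))) := by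
      rw [← hBe]; exact (contDiffAt_map_inverse (n := 0) B).continuousAt
    exact (ContinuousAt.comp (f := fun τ => fderiv ℝ f (e.symm (f b + τ • w))) h2 h1).clm_apply
      continuousAt_const

end Calculus

end

noncomputable section

/-! ### Straightening the leaves -/

/-- The inclusion of the leaf `τ = 0`. -/
def gncLeft : (Fin 4 → ℝ) →L[ℝ] (Fin 5 → ℝ) :=
  LinearMap.toContinuousLinearMap
    { toFun := fun χ => gnc χ 0
      map_add' := fun χ χ' => gnc_ext (fun μ => by simp [gnc_castSucc])
        (by simp only [Pi.add_apply, gnc_last, add_zero])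
      map_smul' := fun c χ => gnc_ext (fun μ => by simp [gnc_castSucc])
        (by simp only [RingHom.id_apply, Pi.smul_apply, gnc_last, smul_zero]) }

theorem gncLeft_apply (χ : Fin 4 → ℝ) : gncLeft χ = gnc χ 0 := rfl

theorem gncLeft_add_smul (χ : Fin 4 → ℝ) (τ : ℝ) :
    gncLeft χ + τ • Pi.single iτ (1 : ℝ) = gnc χ τ := by
  rw [gncLeft_apply, gnc_add_single_last, zero_add]

theorem gnc_injective {χ χ' : Fin 4 → ℝ} {τ τ' : ℝ} (h : gnc χ τ = gnc χ' τ') :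
    χ = χ' ∧ τ = τ' := by
  refine ⟨?_, ?_⟩
  · rw [← init_gnc χ τ, h, init_gnc]
  · rw [← gnc_last χ τ, h, gnc_last]

/-- The map `x ↦ (Q (f x), τ)`. -/
def straighten (Q : (Fin 6 → ℝ) →L[ℝ] (Fin 4 → ℝ)) (f : (Fin 5 → ℝ) → (Fin 6 → ℝ))
    (x : Fin 5 → ℝ) : Fin 5 → ℝ := gncLeft (Q (f x)) + x iτ • Pi.single iτ (1 : ℝ)

section Straighten

variable {Q : (Fin 6 → ℝ) →L[ℝ] (Fin 4 → ℝ)} {f : (Fin 5 → ℝ) → (Fin 6 → ℝ)} {x : Fin 5 → ℝ}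

theorem straighten_eq : straighten Q f x = gnc (Q (f x)) (x iτ) := gncLeft_add_smul _ _

theorem hasFDerivAt_straighten (hf : DifferentiableAt ℝ f x) :
    HasFDerivAt (straighten Q f) ((gncLeft.comp Q).comp (fderiv ℝ f x)
      + (ContinuousLinearMap.proj (R := ℝ) (φ := fun _ : Fin 5 => ℝ) iτ).smulRight
        (Pi.single iτ (1 : ℝ))) x :=
  ((gncLeft.comp Q).hasFDerivAt.comp x hf.hasFDerivAt).add
    (((ContinuousLinearMap.proj (R := ℝ) (φ := fun _ : Fin 5 => ℝ) iτ).smulRight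
        (Pi.single iτ (1 : ℝ) : Fin 5 → ℝ)).hasFDerivAt (x := x))

theorem pd_straighten (hf : DifferentiableAt ℝ f x) (a : Fin 5) :
    pd a (straighten Q f) x = gncLeft (Q (pd a f x))
      + (Pi.single a 1 : Fin 5 → ℝ) iτ • Pi.single iτ (1 : ℝ) := by
  have h1 := hasFDerivAt_straighten (Q := Q) hf
  rw [pd_eq_fderiv h1.differentiableAt, h1.fderiv, pd_eq_fderiv hf]
  rfl

end Straighten

namespace ThinLimitAnsatz

variable {N : ℕ} {U : Set (Fin 4 → ℝ)} {l : ℝ} {V : Set (Fin 6 → ℝ)} {ε : ℝ}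
  {g : ℝ → MetricField 6} {φ n : ℝ → (Fin 5 → ℝ) → (Fin 6 → ℝ)}
  {g₀ : MetricField 6} {φ₀ n₀ : (Fin 5 → ℝ) → (Fin 6 → ℝ)} {χ : Fin 4 → ℝ}

theorem approx_differentiableAt (h : ThinLimitAnsatz N U l V ε g φ n g₀ φ₀ n₀) (hN : 3 ≤ N) {ρ : ℝ}
    (hρ : ρ ∈ Ioo 0 l) {x : Fin 5 → ℝ} (hx : x ∈ slab U l) : DifferentiableAt ℝ (φ ρ) x :=
  (h.approx_contDiffAt hN hρ hx).differentiableAt (by simp)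

/-- The derivative converges although `∂_τ φ` need not: only the ridge components of `∂_τ φ` enter,
and they tend to zero. On the leaf directions the limit is the Gram matrix of the ridge, which is
nondegenerate, so the limit is invertible and fixes the `τ`-direction. -/
theorem exists_straight_equiv (h : ThinLimitAnsatz N U l V ε g φ n g₀ φ₀ n₀) (hN : 3 ≤ N)
    (hχ : χ ∈ U) : ∃ A : (Fin 5 → ℝ) ≃L[ℝ] (Fin 5 → ℝ), A (Pi.single iτ 1) = Pi.single iτ 1 ∧
      Tendsto (fun p => fderiv ℝ (straighten (ridgeCoord g₀ φ₀ χ) (φ p.1)) p.2) (ribbon χ)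
        (𝓝 (A : (Fin 5 → ℝ) →L[ℝ] (Fin 5 → ℝ))) := by
  set Q := ridgeCoord g₀ φ₀ χ with hQ
  let a : Fin 5 → Fin 5 → ℝ := Fin.snoc (α := fun _ => Fin 5 → ℝ)
    (fun μ => gncLeft (Q (pd μ (leaf φ₀ 0) χ))) (Pi.single iτ 1)
  have ha1 : ∀ μ : Fin 4, a μ.castSucc = gncLeft (Q (pd μ (leaf φ₀ 0) χ)) := fun μ =>
    Fin.snoc_castSucc (α := fun _ => Fin 5 → ℝ) _ _ _
  have ha2 : a iτ = Pi.single iτ 1 := Fin.snoc_last (α := fun _ => Fin 5 → ℝ) _ _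
  let A' : (Fin 5 → ℝ) →L[ℝ] (Fin 5 → ℝ) :=
    ∑ b, (ContinuousLinearMap.proj (R := ℝ) (φ := fun _ : Fin 5 => ℝ) b).smulRight (a b)
  have hA' : ∀ v, A' v = gncLeft (Q (∑ μ : Fin 4, v μ.castSucc • pd μ (leaf φ₀ 0) χ))
      + v iτ • Pi.single iτ 1 := fun v => by
    have e1 : A' v = ∑ b, v b • a b := by simp [A']
    rw [e1, Fin.sum_univ_castSucc, ha2]
    simp only [ha1, map_sum, map_smul]
  have hinj : Function.Injective (A' : (Fin 5 → ℝ) →ₗ[ℝ] (Fin 5 → ℝ)) := by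
    refine (injective_iff_map_eq_zero _).2 fun v hv => ?_
    have h1 : A' v = 0 := hv
    rw [hA', gncLeft_add_smul] at h1
    have h2 : (0 : Fin 5 → ℝ) = gnc 0 0 := gnc_ext (fun μ => by simp [gnc_castSucc])
      (by rw [gnc_last]; rfl)
    rw [h2] at h1
    obtain ⟨h3, h4⟩ := gnc_injective h1
    have h5 : (fun μ : Fin 4 => v μ.castSucc) = 0 := by
      refine Matrix.eq_zero_of_vecMul_eq_zero
        (h.lim_leaf_lorentzian χ hχ 0 (by simpa using h.l_pos)).det_ne_zero ?_
      funext ν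
      have h6 := congrFun h3 ν
      rw [hQ, ridgeCoord, leafCoord_apply, metricInner_sum_left] at h6
      simp only [metricInner_smul_left] at h6
      exact h6
    refine gnc_ext (fun μ => congrFun h5 μ) h4
  refine ⟨(LinearEquiv.ofInjectiveEndo _ hinj).toContinuousLinearEquiv, ?_, ?_⟩
  · have e1 : A' (Pi.single iτ 1) = Pi.single iτ 1 := by
      rw [hA']
      simp [-Fin.reduceLast, (Fin.castSucc_lt_last _).ne]
    exact e1
  · have e2 : (((LinearEquiv.ofInjectiveEndo _ hinj).toContinuousLinearEquiv :
        (Fin 5 → ℝ) ≃L[ℝ] (Fin 5 → ℝ)) : (Fin 5 → ℝ) →L[ℝ] (Fin 5 → ℝ)) = A' := by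
      ext1 v; rfl
    rw [e2]
    have he := h.eventually_ribbon hχ
    refine tendsto_fderiv_of_pd ?_ fun b => ?_
    · filter_upwards [he] with p hp
      exact (hasFDerivAt_straighten (h.approx_differentiableAt hN hp.1 hp.2)).differentiableAt
    · have e3 : ∀ᶠ p in ribbon χ, gncLeft (Q (pd b (φ p.1) p.2))
          + (Pi.single b 1 : Fin 5 → ℝ) iτ • Pi.single iτ (1 : ℝ)
          = pd b (straighten Q (φ p.1)) p.2 := by
        filter_upwards [he] with p hp
        exact (pd_straighten (h.approx_differentiableAt hN hp.1 hp.2) b).symm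
      refine Tendsto.congr' e3 ?_
      refine Fin.lastCases ?_ (fun μ => ?_) b
      · rw [ha2, Pi.single_eq_same, one_smul]
        have := ((gncLeft.continuous.tendsto _).comp
          (h.tendsto_ribbon_frame hN hχ).2.2).add_const (Pi.single iτ (1 : ℝ))
        simpa [-Fin.reduceLast] using this
      · rw [ha1, Pi.single_eq_of_ne (Fin.castSucc_lt_last μ).ne', zero_smul]
        simp only [add_zero]
        exact ((gncLeft.comp Q).continuous.tendsto _).comp (h.tendsto_ribbon_par hN hχ μ)

/-- The velocity of the straightened lines is close to `∂_τ φ`. -/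
theorem tendsto_velocity_sub (h : ThinLimitAnsatz N U l V ε g φ n g₀ φ₀ n₀) (hN : 3 ≤ N)
    (hχ : χ ∈ U) : Tendsto (fun p => fderiv ℝ (φ p.1) p.2
      ((fderiv ℝ (straighten (ridgeCoord g₀ φ₀ χ) (φ p.1)) p.2).inverse (Pi.single iτ 1))
      - pd iτ (φ p.1) p.2) (ribbon χ) (𝓝 0) := by
  obtain ⟨A, hA, ht⟩ := h.exists_straight_equiv hN hχ
  rw [tendsto_iff_ultrafilter]
  intro 𝒰 h𝒰
  have h1 : Tendsto (fun p : ℝ × (Fin 5 → ℝ) =>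
      (fderiv ℝ (straighten (ridgeCoord g₀ φ₀ χ) (φ p.1)) p.2).inverse (Pi.single iτ 1)) 𝒰
      (𝓝 (Pi.single iτ 1)) := by
    have h2 := (((ContinuousLinearMap.apply ℝ (Fin 5 → ℝ)
      (Pi.single iτ (1 : ℝ) : Fin 5 → ℝ)).continuous.tendsto _).comp
      (contDiffAt_map_inverse (n := 0) A).continuousAt.tendsto).comp (ht.mono_left h𝒰)
    rw [ContinuousLinearMap.inverse_equiv, ContinuousLinearMap.apply_apply] at h2
    -- Since `A` fixes the `τ`-direction, so does its inverse. The straightened lines are therefore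
    -- asymptotically tangent to the `τ`-lines.
    have h3 : (A.symm : (Fin 5 → ℝ) →L[ℝ] (Fin 5 → ℝ)) (Pi.single iτ 1) = Pi.single iτ 1 := by
      conv_lhs => rw [← hA]
      exact A.symm_apply_apply _
    rw [h3] at h2
    exact h2
  have hb : ∀ b, HasLim (𝒰 : Filter (ℝ × (Fin 5 → ℝ))) fun p => pd b (φ p.1) p.2 := fun b =>
    Fin.lastCases (h.hasLim_ultra_tangent hN hχ h𝒰).1
      (fun μ => ⟨_, (h.tendsto_ribbon_par hN hχ μ).mono_left h𝒰⟩) b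
  choose v hv using hb
  have h4 := (tendsto_finsetSum Finset.univ fun b _ =>
    (tendsto_pi_nhds.1 h1 b).smul (hv b)).sub (hv iτ)
  have h5 : ∑ b, (Pi.single iτ 1 : Fin 5 → ℝ) b • v b - v iτ = 0 := by
    rw [Finset.sum_eq_single iτ (fun b _ hb => by rw [Pi.single_eq_of_ne hb, zero_smul])
      (fun hi => absurd (Finset.mem_univ _) hi), Pi.single_eq_same, one_smul, sub_self]
  rw [h5] at h4
  refine h4.congr' ?_
  filter_upwards [(h.eventually_ribbon hχ).filter_mono h𝒰] with p hp
  rw [fderiv_eq_sum_pd (h.approx_differentiableAt hN hp.1 hp.2)]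

/-- The tangent vectors `∂_τ φ` vary slowly along the leaves. -/
theorem tendsto_tangent_sub (h : ThinLimitAnsatz N U l V ε g φ n g₀ φ₀ n₀) (hN : 3 ≤ N)
    (hχ : χ ∈ U) : Tendsto (fun p => pd iτ (φ p.1) p.2 - pd iτ (φ p.1) (gnc χ (p.2 iτ)))
      (ribbon χ) (𝓝 0) := by
  obtain ⟨C, hC⟩ := h.exists_norm_le hN
  obtain ⟨R, hR, hRU⟩ := Metric.isOpen_iff.1 h.isOpen_U χ hχ
  have h1 : ∀ᶠ p : ℝ × (Fin 5 → ℝ) in ribbon χ, ∀ x ∈ slab U l, ‖pd iτ (φ p.1) x‖ ≤ C ∧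
      ∀ μ : Fin 4, ‖pd iτ (pd μ.castSucc (φ p.1)) x‖ ≤ C := tendsto_fst.eventually hC
  have h2 : Tendsto (fun p : ℝ × (Fin 5 → ℝ) => (Fin.init p.2 : Fin 4 → ℝ)) (ribbon χ) (𝓝 χ) := by
    have := (continuous_init.tendsto (gnc χ 0)).comp (tendsto_snd_ribbon (χ := χ))
    rwa [init_gnc] at this
  have h3 : Tendsto (fun p : ℝ × (Fin 5 → ℝ) => (4 : ℕ) * C * ‖(Fin.init p.2 : Fin 4 → ℝ) - χ‖)
      (ribbon χ) (𝓝 ((4 : ℕ) * C * ‖χ - χ‖)) := ((h2.sub_const χ).norm).const_mul _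
  rw [sub_self, norm_zero, mul_zero] at h3
  refine squeeze_zero_norm' ?_ h3
  filter_upwards [h1, h.eventually_ribbon hχ, h2.eventually (Metric.ball_mem_nhds χ hR)]
    with p p1 p2 p3
  have hmem : ∀ χ' ∈ Metric.ball χ R, gnc χ' (p.2 iτ) ∈ slab U l := fun χ' hχ' =>
    mem_slab_gnc.2 ⟨hRU hχ', p2.2.2⟩
  have hd : ∀ χ' ∈ Metric.ball χ R,
      DifferentiableAt ℝ (fun χ' => pd iτ (φ p.1) (gnc χ' (p.2 iτ))) χ' := fun χ' hχ' =>
    DifferentiableAt.comp (g := pd iτ (φ p.1)) χ'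
      ((h.approx_pd_contDiffAt hN p2.1 (hmem χ' hχ') iτ).differentiableAt (by simp))
      ((contDiff_gnc (p.2 iτ) (k := 1)).contDiffAt.differentiableAt (by simp))
  have hC0 : 0 ≤ C := (norm_nonneg _).trans (p1 p.2 p2.2).1
  -- The mean value inequality is applied along the leaf: the `χ`-derivatives of `∂_τ φ` are the
  -- mixed derivatives `∂_τ ∂_μ φ`, which are bounded.
  have h4 := Convex.norm_image_sub_le_of_norm_hasFDerivWithin_le (𝕜 := ℝ) (C := (4 : ℕ) * C)
    (f := fun χ' => pd iτ (φ p.1) (gnc χ' (p.2 iτ)))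
    (fun χ' hχ' => (hd χ' hχ').hasFDerivAt.hasFDerivWithinAt)
    (fun χ' hχ' => norm_fderiv_le_of_pd (hd χ' hχ') hC0 fun μ => by
      rw [← pd_castSucc, pd_comm ((h.approx_contDiffAt hN p2.1 (hmem χ' hχ')).of_le
        (by exact_mod_cast (by norm_num : 2 ≤ 3)))]
      exact (p1 _ (hmem χ' hχ')).2 μ)
    (convex_ball χ R) (Metric.mem_ball_self hR) p3
  rwa [gnc_init_last] at h4

end ThinLimitAnsatz

end

/-! ### An embedded planar curve close to the section of the brane -/

noncomputable section

theorem eventually_ribbon_ball {χ : Fin 4 → ℝ} {Q : ℝ × (Fin 5 → ℝ) → Prop}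
    (hQ : ∀ᶠ p in ribbon χ, Q p) :
    ∃ R > 0, ∀ᶠ ρ in 𝓝[>] (0 : ℝ), ∀ x ∈ Metric.ball (gnc χ 0) R, Q (ρ, x) := by
  obtain ⟨A, hA, B, hB, hAB⟩ := eventually_prod_iff.1 hQ
  obtain ⟨R, hR, H⟩ := Metric.eventually_nhds_iff_ball.1 hB
  exact ⟨R, hR, hA.mono fun ρ hρ x hx => hAB hρ (H x hx)⟩

theorem gnc_mem_ball {χ : Fin 4 → ℝ} {τ R : ℝ} (hτ : |τ| < R) :
    gnc χ τ ∈ Metric.ball (gnc χ 0) R := by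
  rw [Metric.mem_ball, dist_eq_norm, norm_gnc_sub, sub_zero]; exact hτ

theorem eventually_outside_right {Q : ℝ × ℝ → Prop} (hQ : ∀ᶠ p in outside (𝓝[>] 0), Q p) :
    ∃ R > 0, ∀ᶠ ρ in 𝓝[>] (0 : ℝ), ∀ τ, ρ ≤ τ → τ < R → Q (ρ, τ) := by
  rw [outside, eventually_inf_principal] at hQ
  obtain ⟨A, hA, B, hB, hAB⟩ := eventually_prod_iff.1 hQ
  obtain ⟨R, hR, H⟩ := mem_nhdsGT_iff_exists_Ioo_subset.1 hB
  refine ⟨R, hR, ?_⟩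
  filter_upwards [hA.filter_mono (nhdsWithin_mono _ Ioi_subset_Ici_self), self_mem_nhdsWithin]
    with ρ hρ h0 τ h1 h2
  exact hAB hρ (H ⟨lt_of_lt_of_le h0 h1, h2⟩) (h1.trans (le_abs_self _))

theorem eventually_outside_left {Q : ℝ × ℝ → Prop} (hQ : ∀ᶠ p in outside (𝓝[<] 0), Q p) :
    ∃ R > 0, ∀ᶠ ρ in 𝓝[>] (0 : ℝ), ∀ τ, τ ≤ -ρ → -R < τ → Q (ρ, τ) := by
  rw [outside, eventually_inf_principal] at hQ
  obtain ⟨A, hA, B, hB, hAB⟩ := eventually_prod_iff.1 hQ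
  obtain ⟨R, hR, H⟩ := mem_nhdsLT_iff_exists_Ioo_subset.1 hB
  refine ⟨-R, neg_pos.2 hR, ?_⟩
  filter_upwards [hA.filter_mono (nhdsWithin_mono _ Ioi_subset_Ici_self), self_mem_nhdsWithin]
    with ρ hρ h0 τ h1 h2
  have h0' : (0 : ℝ) < ρ := h0
  refine hAB hρ (H ⟨by linarith, by linarith⟩) ?_
  show ρ ≤ |τ|
  rw [abs_of_neg (by linarith)]
  linarith

/-- The integrand is at least `c` off the ribbon and at worst `-M` on it. A loss of at most `2ρM` is
outweighed by the gain on `[-r, -ρ]`, which is passed first. -/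
theorem integral_left_pos {f : ℝ → ℝ} {c M ρ r : ℝ} (hf : Continuous f) (hρ : 0 < ρ) (hρr : ρ < r)
    (hc : 0 < c) (hfc : ∀ s, ρ ≤ |s| → |s| ≤ r → c ≤ f s) (hM : 0 ≤ M)
    (hfM : ∀ s, |s| ≤ ρ → -M ≤ f s) (hcM : 2 * ρ * M < (r - ρ) * c) {t : ℝ} (ht : -r < t)
    (htr : t ≤ r) : 0 < ∫ u in (-r)..t, f u := by
  have hi : ∀ a b, IntervalIntegrable f MeasureTheory.volume a b := fun a b =>
    hf.intervalIntegrable a b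
  have lower : ∀ {a b k : ℝ}, a ≤ b → (∀ s ∈ Icc a b, k ≤ f s) → (b - a) * k ≤ ∫ u in a..b, f u := by
    intro a b k hab hk
    have := intervalIntegral.integral_mono_on hab (by simp) (hi a b) hk
    rwa [intervalIntegral.integral_const, smul_eq_mul] at this
  rcases le_or_gt t (-ρ) with h1 | h1
  · have h2 := lower ht.le fun s hs => hfc s
      (by rw [abs_of_neg (by linarith [hs.2])]; linarith [hs.2])
      (by rw [abs_of_neg (by linarith [hs.2])]; linarith [hs.1])
    nlinarith
  · rw [← intervalIntegral.integral_add_adjacent_intervals (hi (-r) (-ρ)) (hi (-ρ) t)]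
    have h2 := lower (a := -r) (b := -ρ) (by linarith) fun s hs => hfc s
      (by rw [abs_of_neg (by linarith [hs.2])]; linarith [hs.2])
      (by rw [abs_of_neg (by linarith [hs.2])]; linarith [hs.1])
    rcases le_or_gt t ρ with h3 | h3
    · have h4 := lower h1.le fun s hs => hfM s (abs_le.2 ⟨hs.1, hs.2.trans h3⟩)
      nlinarith
    · rw [← intervalIntegral.integral_add_adjacent_intervals (hi (-ρ) ρ) (hi ρ t)]
      have h4 := lower (a := -ρ) (b := ρ) (by linarith) fun s hs => hfM s (abs_le.2 hs)
      have h5 := lower h3.le fun s hs => hfc s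
        (by rw [abs_of_pos (by linarith [hs.1])]; exact hs.1)
        (by rw [abs_of_pos (by linarith [hs.1])]; linarith [hs.2])
      nlinarith

theorem integral_right_pos {f : ℝ → ℝ} {c M ρ r : ℝ} (hf : Continuous f) (hρ : 0 < ρ)
    (hρr : ρ < r) (hc : 0 < c) (hfc : ∀ s, ρ ≤ |s| → |s| ≤ r → c ≤ f s) (hM : 0 ≤ M)
    (hfM : ∀ s, |s| ≤ ρ → -M ≤ f s) (hcM : 2 * ρ * M < (r - ρ) * c) {s : ℝ} (hs : s < r)
    (hsr : -r ≤ s) : 0 < ∫ u in s..r, f u := by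
  have := integral_left_pos (f := fun u => f (-u)) (hf.comp continuous_neg) hρ hρr hc
    (fun s h1 h2 => hfc _ (by rwa [abs_neg]) (by rwa [abs_neg])) hM
    (fun s h1 => hfM _ (by rwa [abs_neg])) hcM (t := -s) (by linarith) (by linarith)
  rwa [intervalIntegral.integral_comp_neg, neg_neg, neg_neg] at this

namespace ThinLimitAnsatz

variable {N : ℕ} {U : Set (Fin 4 → ℝ)} {l : ℝ} {V : Set (Fin 6 → ℝ)} {ε : ℝ}
  {g : ℝ → MetricField 6} {φ n : ℝ → (Fin 5 → ℝ) → (Fin 6 → ℝ)}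
  {g₀ : MetricField 6} {φ₀ n₀ : (Fin 5 → ℝ) → (Fin 6 → ℝ)} {χ : Fin 4 → ℝ}

/-- The projection of the brane to the normal plane of the ridge contains an embedded curve whose
velocity is close to the projection of `∂_τ φ`. -/
theorem exists_planar_curve (h : ThinLimitAnsatz N U l V ε g φ n g₀ φ₀ n₀) (hN : 3 ≤ N)
    (hχ : χ ∈ U) {e r₁ : ℝ} (he : 0 < e) (hr₁ : 0 < r₁) : ∃ r ∈ Ioc 0 r₁, ∀ᶠ ρ in 𝓝[>] (0 : ℝ),
      ∃ γ γ' : ℝ → ℂ, (∀ τ ∈ Icc (-r) r, HasDerivAt γ (γ' τ) τ) ∧ ContinuousOn γ' (Icc (-r) r) ∧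
        InjOn γ (Icc (-r) r) ∧
        ∀ τ ∈ Icc (-r) r, ‖γ' τ - ridgePlane g₀ φ₀ n₀ χ (pd iτ (φ ρ) (gnc χ τ))‖ < e := by
  set P := ridgePlane g₀ φ₀ n₀ χ with hP
  set Q := ridgeCoord g₀ φ₀ χ with hQ
  obtain ⟨A, -, hA⟩ := h.exists_straight_equiv hN hχ
  set k : ℝ≥0 := ‖(A.symm : (Fin 5 → ℝ) →L[ℝ] (Fin 5 → ℝ))‖₊⁻¹ / 2 with hk
  have hk0 : 0 < k := by
    have : 0 < ‖(A.symm : (Fin 5 → ℝ) →L[ℝ] (Fin 5 → ℝ))‖₊ := by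
      rw [nnnorm_pos]
      intro h0
      have h1 := congrArg (fun L : (Fin 5 → ℝ) →L[ℝ] (Fin 5 → ℝ) => L (A (Pi.single iτ 1))) h0
      simp at h1
    positivity
  have t1 : ∀ᶠ p in ribbon χ, fderiv ℝ (straighten Q (φ p.1)) p.2
      ∈ range ((↑) : ((Fin 5 → ℝ) ≃L[ℝ] (Fin 5 → ℝ)) → (Fin 5 → ℝ) →L[ℝ] (Fin 5 → ℝ)) :=
    hA.eventually (ContinuousLinearEquiv.nhds A)
  have t2 : ∀ᶠ p in ribbon χ, ‖fderiv ℝ (straighten Q (φ p.1)) p.2 - A‖ ≤ k := by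
    have h1 := (hA.sub_const (A : (Fin 5 → ℝ) →L[ℝ] (Fin 5 → ℝ))).norm
    rw [sub_self, norm_zero] at h1
    exact (h1.eventually_lt_const (NNReal.coe_pos.2 hk0)).mono fun p hp => hp.le
  have t3 : ∀ᶠ p in ribbon χ, ‖P (fderiv ℝ (φ p.1) p.2
      ((fderiv ℝ (straighten Q (φ p.1)) p.2).inverse (Pi.single iτ 1))
      - pd iτ (φ p.1) p.2)‖ < e / 2 := by
    have h1 := ((P.continuous.tendsto _).comp (h.tendsto_velocity_sub hN hχ)).norm
    rw [map_zero, norm_zero] at h1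
    exact h1.eventually_lt_const (by positivity)
  have t4 : ∀ᶠ p in ribbon χ,
      ‖P (pd iτ (φ p.1) p.2 - pd iτ (φ p.1) (gnc χ (p.2 iτ)))‖ < e / 2 := by
    have h1 := ((P.continuous.tendsto _).comp (h.tendsto_tangent_sub hN hχ)).norm
    rw [map_zero, norm_zero] at h1
    exact h1.eventually_lt_const (by positivity)
  obtain ⟨R, hR, hRQ⟩ := eventually_ribbon_ball
    ((h.eventually_ribbon hχ).and (t1.and (t2.and (t3.and t4))))
  have hkR : 0 < (k : ℝ) * (R / 2) := mul_pos (NNReal.coe_pos.2 hk0) (by positivity)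
  refine ⟨min r₁ (k * (R / 2)), ⟨lt_min hr₁ hkR, min_le_left _ _⟩, ?_⟩
  filter_upwards [hRQ] with ρ hρ
  have hs : ∀ x ∈ Metric.ball (gnc χ 0) R, ContDiffAt ℝ (1 : ℕ) (straighten Q (φ ρ)) x :=
    fun x hx => by
      refine ContDiffAt.add ((gncLeft.comp Q).contDiff.contDiffAt.comp x
        ((h.approx_contDiffAt hN (hρ x hx).1.1 (hρ x hx).1.2).of_le
          (by exact_mod_cast (by norm_num : 1 ≤ 3)))) ?_
      exact ((contDiff_apply ℝ ℝ iτ).contDiffAt).smul contDiffAt_const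
  -- The line in the `τ`-direction lifts to a curve in the brane which is still parametrised by `τ`
  -- and along which the ridge components of the position are constant.
  obtain ⟨c, hc⟩ := exists_lift_line A (f := straighten Q (φ ρ)) (b := gnc χ 0)
    (w := Pi.single iτ 1) hR (fun x hx => (hs x hx).differentiableAt (by simp))
    (fun x hx => ((hs x hx).fderiv_right (m := 0) (by simp)).continuousAt)
    (fun x hx => (hρ x hx).2.1) (fun x hx => (hρ x hx).2.2.1)
  have hτ' : ∀ τ ∈ Icc (-(min r₁ (k * (R / 2)))) (min r₁ (k * (R / 2))),
      ‖τ • (Pi.single iτ 1 : Fin 5 → ℝ)‖ ≤ k * (R / 2) := fun τ hτ => by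
    rw [norm_smul, norm_single_one, mul_one]
    exact (abs_le.2 hτ).trans (min_le_right _ _)
  have hφd : ∀ x ∈ Metric.ball (gnc χ 0) R, DifferentiableAt ℝ (φ ρ) x := fun x hx =>
    h.approx_differentiableAt hN (hρ x hx).1.1 (hρ x hx).1.2
  have hcoord : ∀ τ ∈ Icc (-(min r₁ (k * (R / 2)))) (min r₁ (k * (R / 2))),
      Q (φ ρ (c τ)) = Q (φ ρ (gnc χ 0)) ∧ c τ iτ = τ := fun τ hτ => by
    have h1 := (hc τ (hτ' τ hτ)).2.1
    rw [straighten_eq, straighten_eq, gnc_last, gnc_add_single_last, zero_add] at h1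
    exact gnc_injective h1
  refine ⟨fun τ => P (φ ρ (c τ)), fun τ => P (fderiv ℝ (φ ρ) (c τ)
    ((fderiv ℝ (straighten Q (φ ρ)) (c τ)).inverse (Pi.single iτ 1))), fun τ hτ => ?_,
    fun τ hτ => ?_, fun s hs' t ht hst => ?_, fun τ hτ => ?_⟩
  · obtain ⟨h1, -, h3, -⟩ := hc τ (hτ' τ hτ)
    exact P.hasFDerivAt.comp_hasDerivAt τ ((hφd _ h1).hasFDerivAt.comp_hasDerivAt τ h3)
  · obtain ⟨h1, -, h3, h4⟩ := hc τ (hτ' τ hτ)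
    have h5 : ContinuousAt (fderiv ℝ (φ ρ)) (c τ) :=
      ((h.approx_contDiffAt hN (hρ _ h1).1.1 (hρ _ h1).1.2).fderiv_right (m := 2)
        (by norm_cast)).continuousAt
    have h6 : ContinuousAt (fun τ => fderiv ℝ (φ ρ) (c τ)) τ :=
      ContinuousAt.comp (f := c) h5 h3.continuousAt
    exact (P.continuous.continuousAt.comp (h6.clm_apply h4)).continuousWithinAt
  · have hb := (hc s (hτ' s hs')).1
    have hb' := (hc t (hτ' t ht)).1
    -- Plane components agree by assumption and ridge components by construction, so the two bulk
    -- points coincide. Injectivity of the brane then identifies the parameters, the `τ`-coordinate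
    -- of the curve being its parameter.
    have h1 : φ ρ (c s) - φ ρ (c t) = 0 := by
      refine h.ridge_eq_zero hN hχ ?_ ?_
      · rw [map_sub]; exact sub_eq_zero.2 hst
      · rw [map_sub]; exact sub_eq_zero.2 ((hcoord s hs').1.trans (hcoord t ht).1.symm)
    have h2 := h.brane_injOn ρ (hρ _ hb).1.1 (hρ _ hb).1.2 (hρ _ hb').1.2 (sub_eq_zero.1 h1)
    rw [← (hcoord s hs').2, h2, (hcoord t ht).2]
  · have hb := (hc τ (hτ' τ hτ)).1
    obtain ⟨-, -, -, h3, h4⟩ := hρ _ hb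
    simp only [(hcoord τ hτ).2, map_sub] at h3 h4
    calc _ ≤ _ := norm_sub_le_norm_sub_add_norm_sub _ (P (pd iτ (φ ρ) (c τ))) _
      _ < e := by linarith

end ThinLimitAnsatz

end

/-! ### Total turning of the tangent across the ribbon -/

noncomputable section

theorem re_pos_of_norm_sub_one_lt {z : ℂ} (h : ‖z - 1‖ < 1) : 0 < z.re := by
  have h1 := (Complex.abs_re_le_norm (z - 1)).trans_lt h
  rw [Complex.sub_re, Complex.one_re] at h1
  linarith [(abs_lt.1 h1).1]

/-- The total turning of a tangent `z`, given the directions of `z` and of the velocity `G` of an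
embedded curve at both ends, in terms of the bisecting direction `m`. -/
theorem tendsto_turning {α : ℝ} (h1 : -Real.pi < α) (h2 : α < Real.pi) {η : ℝ} (hη : 0 < η) :
    ∃ δ > 0, ∀ G₁ G₂ z₁ z₂ : ℂ, ‖G₁ - 1‖ < δ → ‖G₂ - Complex.exp (α * Complex.I)‖ < δ →
      ‖z₁ - 1‖ < δ → ‖z₂ - Complex.exp (α * Complex.I)‖ < δ →
      |Complex.arg (G₁ / Complex.exp ((α / 2 : ℝ) * Complex.I))
        - Complex.arg (G₂ / Complex.exp ((α / 2 : ℝ) * Complex.I))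
        + (Complex.arg (z₁ / G₁) - Complex.arg (z₂ / G₂)) + α| < η := by
  set E := Complex.exp (α * Complex.I) with hE
  set m := Complex.exp ((α / 2 : ℝ) * Complex.I) with hm
  have hE0 : E ≠ 0 := Complex.exp_ne_zero _
  have hm0 : m ≠ 0 := Complex.exp_ne_zero _
  have e1 : (1 : ℂ) / m = Complex.exp ((-(α / 2) : ℝ) * Complex.I) := by
    rw [hm, one_div, ← Complex.exp_neg]; push_cast; ring_nf
  have e2 : E / m = Complex.exp ((α / 2 : ℝ) * Complex.I) := by
    rw [hm, hE, ← Complex.exp_sub]; push_cast; ring_nf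
  have a1 : Complex.arg ((1 : ℂ) / m) = -(α / 2) := by
    rw [e1, Complex.arg_exp_mul_I, toIocMod_eq_self]
    constructor <;> linarith
  have a2 : Complex.arg (E / m) = α / 2 := by
    rw [e2, Complex.arg_exp_mul_I, toIocMod_eq_self]
    constructor <;> linarith
  have hcos : 0 < Real.cos (α / 2) := Real.cos_pos_of_mem_Ioo ⟨by linarith, by linarith⟩
  have s1 : (1 : ℂ) / m ∈ Complex.slitPlane := by
    left; rw [e1, Complex.exp_ofReal_mul_I_re, Real.cos_neg]; exact hcos
  have s2 : E / m ∈ Complex.slitPlane := by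
    left; rw [e2, Complex.exp_ofReal_mul_I_re]; exact hcos
  let Φ : ℂ × ℂ × ℂ × ℂ → ℝ := fun p => Complex.arg (p.1 / m) - Complex.arg (p.2.1 / m)
    + (Complex.arg (p.2.2.1 / p.1) - Complex.arg (p.2.2.2 / p.2.1)) + α
  have hΦ : ContinuousAt Φ (1, E, 1, E) := by
    have c1 : ContinuousAt (fun p : ℂ × ℂ × ℂ × ℂ => p.1) (1, E, 1, E) := by fun_prop
    have c2 : ContinuousAt (fun p : ℂ × ℂ × ℂ × ℂ => p.2.1) (1, E, 1, E) := by fun_prop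
    have c3 : ContinuousAt (fun p : ℂ × ℂ × ℂ × ℂ => p.2.2.1) (1, E, 1, E) := by fun_prop
    have c4 : ContinuousAt (fun p : ℂ × ℂ × ℂ × ℂ => p.2.2.2) (1, E, 1, E) := by fun_prop
    refine ((ContinuousAt.sub ?_ ?_).add (ContinuousAt.sub ?_ ?_)).add continuousAt_const
    · exact ContinuousAt.comp (f := fun p : ℂ × ℂ × ℂ × ℂ => p.1 / m)
        (Complex.continuousAt_arg s1) (c1.div_const m)
    · exact ContinuousAt.comp (f := fun p : ℂ × ℂ × ℂ × ℂ => p.2.1 / m)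
        (Complex.continuousAt_arg s2) (c2.div_const m)
    · exact ContinuousAt.comp (f := fun p : ℂ × ℂ × ℂ × ℂ => p.2.2.1 / p.1)
        (Complex.continuousAt_arg (by simp)) (c3.div c1 one_ne_zero)
    · exact ContinuousAt.comp (f := fun p : ℂ × ℂ × ℂ × ℂ => p.2.2.2 / p.2.1)
        (Complex.continuousAt_arg (by simp [hE0])) (c4.div c2 hE0)
  -- Relative to the bisector the two ends have arguments `-α/2` and `α/2`, and the corrections
  -- `z/G` have argument zero, so everything cancels against `α`.
  have hΦ0 : Φ (1, E, 1, E) = 0 := by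
    simp only [Φ, a1, a2, div_self hE0, div_one, Complex.arg_one]; ring
  obtain ⟨δ, hδ, H⟩ := Metric.continuousAt_iff.1 hΦ η hη
  refine ⟨δ, hδ, fun G₁ G₂ z₁ z₂ g1 g2 g3 g4 => ?_⟩
  have := H (x := (G₁, G₂, z₁, z₂)) (by
    simp only [dist_eq_norm]
    exact max_lt g1 (max_lt g2 (max_lt g3 g4)))
  rw [hΦ0, Real.dist_0_eq_abs] at this
  exact this

namespace ThinLimitAnsatz

variable {N : ℕ} {U : Set (Fin 4 → ℝ)} {l : ℝ} {V : Set (Fin 6 → ℝ)} {ε : ℝ}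
  {g : ℝ → MetricField 6} {φ n : ℝ → (Fin 5 → ℝ) → (Fin 6 → ℝ)}
  {g₀ : MetricField 6} {φ₀ n₀ : (Fin 5 → ℝ) → (Fin 6 → ℝ)} {χ : Fin 4 → ℝ}

/-- The total turning of the tangent across the ribbon. -/
theorem tendsto_im_integral (h : ThinLimitAnsatz N U l V ε g φ n g₀ φ₀ n₀) (hN : 3 ≤ N)
    (hχ : χ ∈ U) : Tendsto (fun ρ => (∫ τ in (-ρ)..ρ,
        ridgePlane g₀ φ₀ n₀ χ (pd iτ (pd iτ (φ ρ)) (gnc χ τ))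
          / ridgePlane g₀ φ₀ n₀ χ (pd iτ (φ ρ) (gnc χ τ))).im) (𝓝[>] 0)
      (𝓝 (orientedDihedralAngle g₀ φ₀ n₀ χ)) := by
  obtain ⟨α, hα1, hα2, hΩ, hp, hm⟩ := h.tendsto_side_plane hN hχ
  set P := ridgePlane g₀ φ₀ n₀ χ with hP
  set E := Complex.exp (α * Complex.I) with hE
  set m := Complex.exp ((α / 2 : ℝ) * Complex.I) with hmdef
  have hm0 : m ≠ 0 := Complex.exp_ne_zero _
  have hm1 : ‖m‖ = 1 := Complex.norm_exp_ofReal_mul_I _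
  have hcos : 0 < Real.cos (α / 2) := Real.cos_pos_of_mem_Ioo ⟨by linarith, by linarith⟩
  have hcos1 : Real.cos (α / 2) ≤ 1 := Real.cos_le_one _
  have r1 : ((1 : ℂ) / m).re = Real.cos (α / 2) := by
    rw [hmdef, one_div, ← Complex.exp_neg,
      show -((α / 2 : ℝ) * Complex.I) = (-(α / 2) : ℝ) * Complex.I by push_cast; ring,
      Complex.exp_ofReal_mul_I_re, Real.cos_neg]
  have r2 : (E / m).re = Real.cos (α / 2) := by
    rw [hmdef, hE, ← Complex.exp_sub,
      show (α : ℂ) * Complex.I - (α / 2 : ℝ) * Complex.I = (α / 2 : ℝ) * Complex.I by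
        push_cast; ring, Complex.exp_ofReal_mul_I_re]
  have hre : ∀ w w' : ℂ, (w / m).re ≥ (w' / m).re - ‖w - w'‖ := fun w w' => by
    have h1 := (Complex.abs_re_le_norm ((w - w') / m))
    rw [norm_div, hm1, div_one, sub_div, Complex.sub_re] at h1
    linarith [(abs_le.1 h1).1]
  rw [hΩ]
  refine Metric.tendsto_nhds.2 fun η hη => ?_
  obtain ⟨δ, hδ, hturn⟩ := tendsto_turning hα1 hα2 hη
  -- The first bound keeps `Re (G/m)` above half the cosine outside the ribbon, as `G` is within
  -- `2e` of `1` or `E`, both of which have `Re (·/m) = cos (α/2)`. The second makes this distance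
  -- small enough for the turning estimate.
  obtain ⟨e, he, he1, he2⟩ : ∃ e > 0, e ≤ Real.cos (α / 2) / 8 ∧ 2 * e ≤ δ :=
    ⟨min (Real.cos (α / 2) / 8) (δ / 2), lt_min (by positivity) (by positivity), min_le_left _ _,
      by linarith [min_le_right (Real.cos (α / 2) / 8) (δ / 2)]⟩
  have t1 : ∀ᶠ p in ribbon χ, p.1 ∈ Ioo 0 l ∧ p.2 ∈ slab U l ∧
      1 - e < ‖P (pd iτ (φ p.1) p.2)‖ ∧ ‖P (pd iτ (φ p.1) p.2)‖ < 1 + e := by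
    have h1 := (h.tendsto_ribbon_frame hN hχ).1
    filter_upwards [h.eventually_ribbon hχ, h1.eventually_const_lt (by linarith : 1 - e < 1),
      h1.eventually_lt_const (by linarith : 1 < 1 + e)] with p p1 p2 p3
      using ⟨p1.1, p1.2, p2, p3⟩
  have t2 : ∀ᶠ p in outside (𝓝[>] 0), ‖P (pd iτ (withLimit φ φ₀ p.1) (gnc χ p.2)) - 1‖ < e := by
    have h1 := (hp.sub_const 1).norm
    rw [sub_self, norm_zero] at h1
    exact h1.eventually_lt_const he
  have t3 : ∀ᶠ p in outside (𝓝[<] 0), ‖P (pd iτ (withLimit φ φ₀ p.1) (gnc χ p.2)) - E‖ < e := by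
    have h1 := (hm.sub_const E).norm
    rw [sub_self, norm_zero] at h1
    exact h1.eventually_lt_const he
  obtain ⟨R₁, hR₁, h1⟩ := eventually_ribbon_ball t1
  obtain ⟨R₂, hR₂, h2⟩ := eventually_outside_right t2
  obtain ⟨R₃, hR₃, h3⟩ := eventually_outside_left t3
  obtain ⟨r, ⟨hr0, hr⟩, hcurve⟩ := h.exists_planar_curve hN hχ he
    (r₁ := min R₁ (min R₂ R₃) / 2) (by positivity)
  have hrR₁ : r < R₁ := by linarith [min_le_left R₁ (min R₂ R₃)]
  have hrR₂ : r < R₂ := by linarith [min_le_right R₁ (min R₂ R₃), min_le_left R₂ R₃]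
  have hrR₃ : r < R₃ := by linarith [min_le_right R₁ (min R₂ R₃), min_le_right R₂ R₃]
  -- The ribbon must be short compared with the arc: below `r cos (α/2) / 10` the possible loss `4ρ`
  -- inside it is less than `(r - ρ) cos (α/2) / 2`.
  have t4 : ∀ᶠ ρ in 𝓝[>] (0 : ℝ), ρ < min r (r * Real.cos (α / 2) / 10) :=
    mem_nhdsWithin_of_mem_nhds (Iio_mem_nhds (lt_min hr0 (by positivity)))
  filter_upwards [h1, h2, h3, hcurve, self_mem_nhdsWithin, t4] with ρ h1 h2 h3 hcurve hρ0' hρ4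
  have hρ0 : 0 < ρ := hρ0'
  have hρr : ρ < r := hρ4.trans_le (min_le_left _ _)
  have hρc : ρ < r * Real.cos (α / 2) / 10 := hρ4.trans_le (min_le_right _ _)
  simp only [withLimit_of_ne hρ0.ne'] at h2 h3
  obtain ⟨γ, γ', hγ, hγc, hγi, hγz⟩ := hcurve
  set z : ℝ → ℂ := fun τ => P (pd iτ (φ ρ) (gnc χ τ)) with hz
  have hball : ∀ τ ∈ Icc (-r) r, gnc χ τ ∈ Metric.ball (gnc χ 0) R₁ := fun τ hτ =>
    gnc_mem_ball ((abs_le.2 hτ).trans_lt hrR₁)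
  have hz1 : ∀ τ ∈ Icc (-r) r, 1 - e < ‖z τ‖ ∧ ‖z τ‖ < 1 + e := fun τ hτ =>
    (h1 _ (hball τ hτ)).2.2
  -- The velocity is extended by its end values so that it is continuous on the whole line, as the
  -- secant averages require.
  set G : ℝ → ℂ := IccExtend (by linarith : -r ≤ r) ((Icc (-r) r).domRestrict γ') with hG
  have hGc : Continuous G := hγc.domRestrict.Icc_extend'
  have hGγ : ∀ τ ∈ Icc (-r) r, G τ = γ' τ := fun τ hτ => IccExtend_of_mem _ _ hτ
  have hGz : ∀ τ ∈ Icc (-r) r, ‖G τ - z τ‖ < e := fun τ hτ => by rw [hGγ τ hτ]; exact hγz τ hτ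
  have hGlow : ∀ τ ∈ Icc (-r) r, 1 - 2 * e < ‖G τ‖ := fun τ hτ => by
    have := norm_sub_norm_le (z τ) (G τ)
    rw [norm_sub_rev] at this
    linarith [hGz τ hτ, (hz1 τ hτ).1]
  have hGup : ∀ τ ∈ Icc (-r) r, ‖G τ‖ < 2 := fun τ hτ => by
    have := norm_sub_norm_le (G τ) (z τ)
    linarith [hGz τ hτ, (hz1 τ hτ).2]
  have hG0 : ∀ τ ∈ Icc (-r) r, G τ ≠ 0 := fun τ hτ h0 => by
    have := hGlow τ hτ
    rw [h0, norm_zero] at this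
    linarith
  have hright : ∀ s, ρ ≤ s → s ≤ r → ‖z s - 1‖ < e ∧ ‖G s - 1‖ < 2 * e := fun s hs hs' => by
    have a1 := h2 s hs (by linarith)
    have a2 := hGz s ⟨by linarith, hs'⟩
    refine ⟨a1, ?_⟩
    calc _ ≤ _ := norm_sub_le_norm_sub_add_norm_sub _ (z s) _
      _ < 2 * e := by linarith
  have hleft : ∀ s, s ≤ -ρ → -r ≤ s → ‖z s - E‖ < e ∧ ‖G s - E‖ < 2 * e := fun s hs hs' => by
    have a1 := h3 s hs (by linarith)
    have a2 := hGz s ⟨hs', by linarith⟩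
    refine ⟨a1, ?_⟩
    calc _ ≤ _ := norm_sub_le_norm_sub_add_norm_sub _ (z s) _
      _ < 2 * e := by linarith
  have hfc : ∀ s, ρ ≤ |s| → |s| ≤ r → Real.cos (α / 2) / 2 ≤ (G s / m).re := fun s hs hs' => by
    rcases le_or_gt 0 s with h0 | h0
    · rw [abs_of_nonneg h0] at hs hs'
      have := hre (G s) 1
      linarith [(hright s hs hs').2]
    · rw [abs_of_neg h0] at hs hs'
      have := hre (G s) E
      linarith [(hleft s (by linarith) (by linarith)).2]
  have hfM : ∀ s, |s| ≤ ρ → -2 ≤ (G s / m).re := fun s hs => by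
    have a1 := Complex.abs_re_le_norm (G s / m)
    rw [norm_div, hm1, div_one] at a1
    have a2 := hGup s (abs_le.1 (hs.trans hρr.le))
    linarith [(abs_le.1 a1).1]
  have hcM : 2 * ρ * 2 < (r - ρ) * (Real.cos (α / 2) / 2) := by nlinarith
  have hfcont : Continuous fun s => (G s / m).re :=
    Complex.continuous_re.comp (hGc.div_const m)
  have hint : ∀ a b, ((∫ u in a..b, G u) / m).re = ∫ u in a..b, (G u / m).re := fun a b => by
    rw [← intervalIntegral.integral_div]
    exact (Complex.reCLM.intervalIntegral_comp_comm
      ((hGc.div_const m).intervalIntegrable a b)).symm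
  -- Integrals of `G` are chords of the curve, nonzero by injectivity. Chords from the end points
  -- stay in the half plane about the bisector by the estimate for short ribbons.
  obtain ⟨θ, hθc, hθ, hθρ⟩ := exists_angle_of_embedded hGc hρ0 hρr hm0 hG0 (fun s t hs hst ht => by
      have hst' : uIcc s t ⊆ Icc (-r) r := by
        rw [uIcc_of_le hst.le]; exact Icc_subset_Icc hs ht
      rw [intervalIntegral.integral_congr fun u hu => hGγ u (hst' hu),
        intervalIntegral.integral_eq_sub_of_hasDerivAt (fun u hu => hγ u (hst' hu))
          (hγc.mono hst').intervalIntegrable, sub_ne_zero]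
      exact fun h0 => hst.ne (hγi ⟨hs, by linarith⟩ ⟨by linarith, ht⟩ h0.symm))
    (fun s hs hs' => lt_of_lt_of_le (by positivity) (hfc s hs hs'))
    (fun t ht htr => by
      rw [hint]
      exact integral_left_pos hfcont hρ0 hρr (by positivity) hfc zero_le_two hfM hcM ht htr)
    (fun s hs hsr => by
      rw [hint]
      exact integral_right_pos hfcont hρ0 hρr (by positivity) hfc zero_le_two hfM hcM hsr hs)
  have hsub : Icc (-ρ) ρ ⊆ Icc (-r) r := Icc_subset_Icc (by linarith) hρr.le
  -- The angle of the embedded curve is transferred to the tangent `z`, which is close to its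
  -- velocity without being the velocity of an embedded curve itself.
  have hfin := im_integral_div_eq (G := G) (z := z) (θ := θ) (a := -ρ) (b := ρ)
    (z' := fun τ => P (pd iτ (pd iτ (φ ρ)) (gnc χ τ))) (by linarith) hGc.continuousOn
    hθc.continuousOn (fun s hs => hθ s (hsub hs)) (fun s hs => by
      have hs' := h1 _ (hball s (hsub hs))
      exact P.hasFDerivAt.comp_hasDerivAt s (hasDerivAt_comp_gnc
        ((h.approx_pd_contDiffAt hN hs'.1 hs'.2.1 iτ).differentiableAt (by simp))))
    (fun s hs => by
      have hs' := h1 _ (hball s (hsub hs))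
      exact (P.continuous.continuousAt.comp (ContinuousAt.comp (f := fun s => gnc χ s)
        (h.approx_pd_pd_contDiffAt hN hs'.1 hs'.2.1 iτ iτ).continuousAt
        (continuous_gnc_right χ).continuousAt)).continuousWithinAt)
    (fun s hs => by
      refine re_pos_of_norm_sub_one_lt ?_
      have h0 := hG0 s (hsub hs)
      have h5 := hGlow s (hsub hs)
      have h6 : z s / G s - 1 = (z s - G s) / G s := by field_simp
      rw [h6, norm_div, div_lt_one (by linarith), norm_sub_rev]
      linarith [hGz s (hsub hs)])
  rw [hθρ] at hfin
  have hR := hright ρ le_rfl hρr.le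
  have hL := hleft (-ρ) le_rfl (by linarith)
  have := hturn (G ρ) (G (-ρ)) (z ρ) (z (-ρ)) (by linarith) (by linarith) (by linarith)
    (by linarith)
  rw [Real.dist_eq, hfin, sub_neg_eq_add]
  exact this

/-- The integral of the normal acceleration across the ribbon tends to the oriented dihedral
angle. -/
theorem tendsto_integral_accel (h : ThinLimitAnsatz N U l V ε g φ n g₀ φ₀ n₀) (hN : 3 ≤ N)
    (hχ : χ ∈ U) : Tendsto (fun ρ => ∫ τ in (-ρ)..ρ, normalAccel (g ρ) (φ ρ) (n ρ) (gnc χ τ))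
      (𝓝[>] 0) (𝓝 (orientedDihedralAngle g₀ φ₀ n₀ χ)) := by
  have := (h.tendsto_im_integral hN hχ).sub (h.tendsto_im_integral_sub hN hχ)
  simpa using this

end ThinLimitAnsatz

end

/-! ### The pillbox limit -/

noncomputable section

theorem metricInner_add_right {d : ℕ} (h : Fin d → Fin d → ℝ) (u v w : Fin d → ℝ) :
    metricInner h u (v + w) = metricInner h u v + metricInner h u w := by
  simp only [metricInner_eq_dotProduct, Matrix.mulVec_add, dotProduct_add]

theorem extrinsicCurvature_eq_add {m d : ℕ} (g : MetricField d) (f : (Fin m → ℝ) → (Fin d → ℝ))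
    (n : Fin d → ℝ) (x : Fin m → ℝ) (a b : Fin m) :
    extrinsicCurvature g f n x a b = metricInner (g (f x)) n (pd a (pd b f) x)
      + metricInner (g (f x)) n
        fun L => ∑ A, ∑ B, christoffel g (f x) L A B * pd a f x A * pd b f x B := by
  rw [← metricInner_add_right]
  rfl

/-- Applying the limit calculus to the neighbourhood filter of the point `(h₀, K₀)` yields
continuity there, which can then be composed. -/
theorem tendsto_traceReversed {ι : Type*} {d : ℕ} {L : Filter ι} {h K : ι → Fin d → Fin d → ℝ}
    {h₀ K₀ : Fin d → Fin d → ℝ} (hh : Tendsto h L (𝓝 h₀)) (hK : Tendsto K L (𝓝 K₀))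
    (hd : (Matrix.of h₀).det ≠ 0) (a b : Fin d) :
    Tendsto (fun i => traceReversed (h i) (K i) a b) L (𝓝 (traceReversed h₀ K₀ a b)) := by
  have h1 : Tendsto (fun p : (Fin d → Fin d → ℝ) × (Fin d → Fin d → ℝ) => p.1) (𝓝 (h₀, K₀))
      (𝓝 h₀) := continuous_fst.tendsto _
  have h2 : Tendsto (fun p : (Fin d → Fin d → ℝ) × (Fin d → Fin d → ℝ) => p.2) (𝓝 (h₀, K₀))
      (𝓝 K₀) := continuous_snd.tendsto _
  have h3 : HasLim (𝓝 (h₀, K₀)) fun p : (Fin d → Fin d → ℝ) × (Fin d → Fin d → ℝ) =>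
      traceReversed p.1 p.2 a b := HasLim.traceReversed
    (fun A B => ⟨_, tendsto_pi_nhds.1 (tendsto_pi_nhds.1 h1 A) B⟩) ⟨_, hd, tendsto_det h1⟩
    (fun A B => ⟨_, tendsto_pi_nhds.1 (tendsto_pi_nhds.1 h2 A) B⟩) a b
  exact (HasLim.tendsto_pure h3 (pure_le_nhds (h₀, K₀))).comp (hh.prodMk_nhds hK)

section GaussNormal

variable {ι : Type*} {L : Filter ι} {h k R : ι → Fin 4 → Fin 4 → ℝ}

theorem HasLim.gnMix (hh : ∀ α β, HasLim L fun i => h i α β) (hd : HasDetLim L h)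
    (hk : ∀ α β, HasLim L fun i => k i α β) (α β : Fin 4) :
    HasLim L fun i => gnMix (h i) (k i) α β :=
  HasLim.const_mul _ (HasLim.sum _ fun σ => (HasLim.invMetric hh hd α σ).mul (hk σ β))

theorem HasLim.gnQuad (hh : ∀ α β, HasLim L fun i => h i α β) (hd : HasDetLim L h)
    (hk : ∀ α β, HasLim L fun i => k i α β) (α β : Fin 4) :
    HasLim L fun i => gnQuad (h i) (k i) α β :=
  (HasLim.sum _ fun σ => ((HasLim.gnMix hh hd hk σ σ).mul ((hk α β).const_mul _)).sub
    ((HasLim.gnMix hh hd hk σ β).mul ((hk α σ).const_mul _))).sub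
    (HasLim.sum _ fun σ => ((hk β σ).const_mul _).mul (HasLim.gnMix hh hd hk σ α))

theorem HasLim.gnRest (hh : ∀ α β, HasLim L fun i => h i α β) (hd : HasDetLim L h)
    (hk : ∀ α β, HasLim L fun i => k i α β) (hR : ∀ α β, HasLim L fun i => R i α β)
    (α β : Fin 4) : HasLim L fun i => gnRest (h i) (k i) (R i) α β := by
  have hi := HasLim.invMetric hh hd
  have hq := HasLim.gnQuad hh hd hk
  have hm := HasLim.gnMix hh hd hk
  exact (((hR α β).add (hq α β)).add ((hk α β).mul (HasLim.sum _ fun c => HasLim.sum _ fun e =>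
    (hi c e).mul ((hk c e).const_mul _)))).sub (((hh α β).const_mul _).mul
      (((HasLim.sum _ fun c => HasLim.sum _ fun e => (hi c e).mul ((hR c e).add (hq c e))).sub
        (HasLim.sum _ fun c => HasLim.sum _ fun e => (hm c e).mul (hm e c))).add
        (HasLim.sum _ fun c => HasLim.sum _ fun e => (HasLim.sum _ fun p => HasLim.sum _ fun q =>
          ((hi c p).mul (hk p q)).mul (hi q e)).mul ((hk c e).const_mul _))))

end GaussNormal

/-- The trace-reversed extrinsic curvature of the leaf through `Y`. -/
def leafTraceReversed (h : MetricField 5) (μ ν : Fin 4) (Y : Fin 5 → ℝ) : ℝ :=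
  traceReversed (leafBlock (h Y)) (fun α β => -(1 / 2) * leafDeriv h Y α β) μ ν

namespace ThinLimitAnsatz

variable {N : ℕ} {U : Set (Fin 4 → ℝ)} {l : ℝ} {V : Set (Fin 6 → ℝ)} {ε : ℝ}
  {g : ℝ → MetricField 6} {φ n : ℝ → (Fin 5 → ℝ) → (Fin 6 → ℝ)}
  {g₀ : MetricField 6} {φ₀ n₀ : (Fin 5 → ℝ) → (Fin 6 → ℝ)} {χ : Fin 4 → ℝ}

theorem approx_isGaussNormal (h : ThinLimitAnsatz N U l V ε g φ n g₀ φ₀ n₀) (hN : 3 ≤ N) {ρ : ℝ}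
    (hρ : ρ ∈ Ioo 0 l) {x : Fin 5 → ℝ} (hx : x ∈ slab U l) :
    IsGaussNormal (inducedMetric (g ρ) (φ ρ) x) := (h.approx_isRidgeFrame hN hρ hx).gram

theorem approx_induced_contDiffAt (h : ThinLimitAnsatz N U l V ε g φ n g₀ φ₀ n₀) (hN : 3 ≤ N)
    {ρ : ℝ} (hρ : ρ ∈ Ioo 0 l) {x : Fin 5 → ℝ} (hx : x ∈ slab U l) (a b : Fin 5) :
    ContDiffAt ℝ (2 : ℕ) (fun Y => inducedMetric (g ρ) (φ ρ) Y a b) x := by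
  have h1 : ∀ A B, ConvJet 2 (pure ()) (fun _ Y => g ρ Y A B) fun _ => φ ρ x := fun A B =>
    ConvJet.of_contDiffAt ((h.approx_metric_contDiffAt hN hρ hx A B).of_le
      (by exact_mod_cast (by norm_num : 2 ≤ 3))) tendsto_const_nhds
  have h2 : ConvJet 3 (pure ()) (fun _ => φ ρ) fun _ => x :=
    ConvJet.of_contDiffAt (h.approx_contDiffAt hN hρ hx) tendsto_const_nhds
  simpa using (ConvJet.inducedMetric (g := fun _ => g ρ) (f := fun _ => φ ρ) h1 h2 a b).contDiffAt

theorem approx_leafTraceReversed_contDiffAt (h : ThinLimitAnsatz N U l V ε g φ n g₀ φ₀ n₀)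
    (hN : 3 ≤ N) {ρ : ℝ} (hρ : ρ ∈ Ioo 0 l) {x : Fin 5 → ℝ} (hx : x ∈ slab U l) (μ ν : Fin 4) :
    ContDiffAt ℝ (1 : ℕ) (leafTraceReversed (inducedMetric (g ρ) (φ ρ)) μ ν) x := by
  have h1 : ∀ α β : Fin 4, ContDiffAt ℝ (1 : ℕ)
      (fun Y => leafBlock (inducedMetric (g ρ) (φ ρ) Y) α β) x := fun α β =>
    (h.approx_induced_contDiffAt hN hρ hx α.castSucc β.castSucc).of_le
      (by exact_mod_cast (by norm_num : 1 ≤ 2))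
  have h2 : ∀ α β : Fin 4, ContDiffAt ℝ (1 : ℕ)
      (fun Y => -(1 / 2) * leafDeriv (inducedMetric (g ρ) (φ ρ)) Y α β) x := fun α β =>
    contDiffAt_const.mul ((h.approx_induced_contDiffAt hN hρ hx α.castSucc β.castSucc).pd (k := 1) iτ)
  exact (h2 μ ν).sub ((h1 μ ν).mul (ContDiffAt.sum fun c _ => ContDiffAt.sum fun e _ =>
    (contDiffAt_invMetric h1 (h.approx_isGaussNormal hN hρ hx).det_ne_zero c e).mul (h2 c e)))

/-- The components of the junction conditions along the leaves, as the sum of a multiple of the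
normal acceleration, of a `τ`-derivative and of terms of first order in `∂_τ`. -/
theorem israelLHS_castSucc (h : ThinLimitAnsatz N U l V ε g φ n g₀ φ₀ n₀) (hN : 3 ≤ N) {ρ : ℝ}
    (hρ : ρ ∈ Ioo 0 l) {x : Fin 5 → ℝ} (hx : x ∈ slab U l) (M₆ M₅ : ℝ) (μ ν : Fin 4) :
    israelLHS M₆ M₅ (g ρ) (φ ρ) (n ρ) x μ.castSucc ν.castSucc
      = -(2 * M₆ ^ 4) * (leafBlock (inducedMetric (g ρ) (φ ρ) x) μ ν
          * normalAccel (g ρ) (φ ρ) (n ρ) x)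
        + M₅ ^ 3 * pd iτ (leafTraceReversed (inducedMetric (g ρ) (φ ρ)) μ ν) x
        + (2 * M₆ ^ 4 * (traceReversed (leafBlock (inducedMetric (g ρ) (φ ρ) x))
            (leafBlock (extrinsicCurvature (g ρ) (φ ρ) (n ρ x) x)) μ ν
            - leafBlock (inducedMetric (g ρ) (φ ρ) x) μ ν * metricInner (g ρ (φ ρ x)) (n ρ x)
              fun L => ∑ A, ∑ B, christoffel (g ρ) (φ ρ x) L A B * pd iτ (φ ρ) x A
                * pd iτ (φ ρ) x B)
          + M₅ ^ 3 * gnRest (leafBlock (inducedMetric (g ρ) (φ ρ) x))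
            (leafDeriv (inducedMetric (g ρ) (φ ρ)) x)
            (ricci (leafMetric (inducedMetric (g ρ) (φ ρ)) (x iτ)) (Fin.init x)) μ ν) := by
  have hy : gnc (Fin.init x) (x iτ) ∈ slab U l := by rwa [gnc_init_last]
  have h1 := einstein_castSucc (isOpen_slab h.isOpen_U l)
    (fun y hy => h.approx_isGaussNormal hN hρ hy) hy
    (fun a b => h.approx_induced_contDiffAt hN hρ hy a b) μ ν
  rw [gnc_init_last] at h1
  -- The sign in front of the normal acceleration comes from the subtracted trace, through which
  -- alone `K̃_{ττ}` enters the leaf components.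
  rw [israelLHS, traceReversed_castSucc (h.approx_isGaussNormal hN hρ hx), h1,
    extrinsicCurvature_eq_add _ _ _ _ iτ iτ]
  simp only [normalAccel]
  unfold leafTraceReversed
  ring

/-- Up to bounded terms, the junction conditions inside the ribbon consist of a multiple of the
normal acceleration and of a `τ`-derivative. -/
theorem exists_rest_le (h : ThinLimitAnsatz N U l V ε g φ n g₀ φ₀ n₀) (hN : 3 ≤ N)
    (hχ : χ ∈ U) (M₆ M₅ : ℝ) (μ ν : Fin 4) : ∃ C, ∀ᶠ p in ribbon χ,
      ‖israelLHS M₆ M₅ (g p.1) (φ p.1) (n p.1) p.2 μ.castSucc ν.castSucc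
        + 2 * M₆ ^ 4 * (leafBlock (inducedMetric (g p.1) (φ p.1) p.2) μ ν
          * normalAccel (g p.1) (φ p.1) (n p.1) p.2)
        - M₅ ^ 3 * pd iτ (leafTraceReversed (inducedMetric (g p.1) (φ p.1)) μ ν) p.2‖ ≤ C := by
  refine exists_norm_le_of_ultrafilter fun 𝒰 h𝒰 => ?_
  obtain ⟨v, w, hv, hw, -⟩ := h.exists_ultra_frame hN hχ h𝒰
  have he : ∀ᶠ p : ℝ × (Fin 5 → ℝ) in 𝒰, p.1 ∈ Ioo 0 l ∧ p.2 ∈ slab U l :=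
    (h.eventually_ribbon hχ).filter_mono h𝒰
  have hg : ∀ A B, ConvJet 1 (𝒰 : Filter (ℝ × (Fin 5 → ℝ))) (fun p Y => g p.1 Y A B)
      fun p => φ p.1 p.2 := fun A B => ((h.convJet_ribbon_metric hN hχ A B).of_le (by omega)).mono h𝒰
  have hgd := (h.hasDetLim_ribbon_metric hχ).mono h𝒰
  have hvl : ∀ A, HasLim (𝒰 : Filter (ℝ × (Fin 5 → ℝ))) fun p => pd iτ (φ p.1) p.2 A :=
    fun A => HasLim.apply ⟨v, hv⟩ A
  have hpar : ∀ μ : Fin 4, HasLim (𝒰 : Filter (ℝ × (Fin 5 → ℝ)))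
      fun p => pd μ.castSucc (φ p.1) p.2 := fun μ =>
    ⟨_, (h.tendsto_ribbon_par hN hχ μ).mono_left h𝒰⟩
  have hτ := (h.hasLim_ultra_tangent hN hχ h𝒰).2
  have hpp := fun α β => (h.hasLim_ribbon_par_par hN hχ α β).mono h𝒰
  have hb : ∀ α β, HasLim (𝒰 : Filter (ℝ × (Fin 5 → ℝ)))
      fun p => leafBlock (inducedMetric (g p.1) (φ p.1) p.2) α β := fun α β =>
    ⟨_, tendsto_pi_nhds.1 (tendsto_pi_nhds.1
      ((h.tendsto_ribbon_leafBlock hN hχ).mono_left h𝒰) α) β⟩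
  have hbd := (h.hasDetLim_ribbon_leafBlock hN hχ).mono h𝒰
  have hk : ∀ α β, HasLim (𝒰 : Filter (ℝ × (Fin 5 → ℝ)))
      fun p => leafDeriv (inducedMetric (g p.1) (φ p.1)) p.2 α β := fun α β => by
    have h1 : HasLim (𝒰 : Filter (ℝ × (Fin 5 → ℝ))) fun p =>
        metricInner (fun A B => ∑ C, pd iτ (φ p.1) p.2 C * pd C (fun Y => g p.1 Y A B) (φ p.1 p.2))
          (pd α.castSucc (φ p.1) p.2) (pd β.castSucc (φ p.1) p.2) :=
      HasLim.metricInner (fun A B => HasLim.sum _ fun C => (hvl C).mul ((hg A B).pd C).hasLim)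
        (fun A => (hpar α).apply A) fun A => (hpar β).apply A
    refine ((h1.add (HasLim.metricInner (fun A B => (hg A B).hasLim) (fun A => (hτ α).apply A)
      fun A => (hpar β).apply A)).add (HasLim.metricInner (fun A B => (hg A B).hasLim)
      (fun A => (hpar α).apply A) fun A => (hτ β).apply A)).congr ?_
    filter_upwards [he] with p hp
    exact (pd_inducedMetric (fun A B => (h.approx_metric_contDiffAt hN hp.1 hp.2 A
      B).differentiableAt (by simp)) ((h.approx_contDiffAt hN hp.1 hp.2).of_le
      (by exact_mod_cast (by norm_num : 2 ≤ 3))) iτ α.castSucc β.castSucc).symm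
  have hK : ∀ α β, HasLim (𝒰 : Filter (ℝ × (Fin 5 → ℝ)))
      fun p => leafBlock (extrinsicCurvature (g p.1) (φ p.1) (n p.1 p.2) p.2) α β := fun α β =>
    HasLim.extrinsicCurvature hg hgd (hpar α) (hpar β) (hpp α β) ⟨w, hw⟩
  have hΓ : HasLim (𝒰 : Filter (ℝ × (Fin 5 → ℝ))) fun p => metricInner (g p.1 (φ p.1 p.2))
      (n p.1 p.2) fun L => ∑ A, ∑ B, christoffel (g p.1) (φ p.1 p.2) L A B * pd iτ (φ p.1) p.2 A
        * pd iτ (φ p.1) p.2 B :=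
    HasLim.metricInner (fun A B => (hg A B).hasLim) (fun A => HasLim.apply ⟨w, hw⟩ A) fun L =>
      HasLim.sum _ fun A => HasLim.sum _ fun B =>
        ((ConvJet.christoffel (k := 0) hg hgd L A B).hasLim.mul (hvl A)).mul (hvl B)
  refine (((((HasLim.traceReversed hb hbd hK μ ν).sub ((hb μ ν).mul hΓ)).const_mul
    (2 * M₆ ^ 4)).add ((HasLim.gnRest hb hbd hk
      (fun α β => (h.hasLim_ribbon_ricci hN hχ α β).mono h𝒰) μ ν).const_mul (M₅ ^ 3)))).congr ?_
  filter_upwards [he] with p hp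
  rw [h.israelLHS_castSucc hN hp.1 hp.2]
  ring

/-- The leaf metric converges throughout the ribbon but its `τ`-derivative only outside. The path of
points is therefore required to stay outside, as the ribbon edges do. -/
theorem tendsto_leafTraceReversed (h : ThinLimitAnsatz N U l V ε g φ n g₀ φ₀ n₀) (hN : 3 ≤ N)
    (hχ : χ ∈ U) {F : Filter ℝ} (hF : F = 𝓝[>] 0 ∨ F = 𝓝[<] 0) {σ : ℝ → ℝ}
    (hσ : Tendsto (fun ρ => (ρ, σ ρ)) (𝓝[>] 0) (outside F)) (μ ν : Fin 4) :
    Tendsto (fun ρ => leafTraceReversed (inducedMetric (g ρ) (φ ρ)) μ ν (gnc χ (σ ρ))) (𝓝[>] 0)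
      (𝓝 (cod2TraceReversed g₀ φ₀ F χ μ ν)) := by
  have h0 : Tendsto (fun ρ => (ρ, gnc χ (σ ρ))) (𝓝[>] 0) (ribbon χ) :=
    tendsto_id.prodMk ((tendsto_gnc_outside hF χ).comp hσ)
  have h1 := (h.tendsto_ribbon_leafBlock hN hχ).comp h0
  have h2 := (h.tendsto_leafCurvature hN hχ hF).comp hσ
  refine (tendsto_traceReversed h1 h2
    (h.lim_leaf_lorentzian χ hχ 0 (by simpa using h.l_pos)).det_ne_zero μ ν).congr' ?_
  filter_upwards [h0.eventually (h.eventually_ribbon hχ)] with ρ hρ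
  have h3 : (leafCurvature (withLimit g g₀ ρ) (withLimit φ φ₀ ρ) χ (σ ρ) : Fin 4 → Fin 4 → ℝ)
      = fun α β => -(1 / 2) * leafDeriv (inducedMetric (g ρ) (φ ρ)) (gnc χ (σ ρ)) α β := by
    funext α β
    rw [h.leafCurvature_eq hN (h.isRegularPoint hρ.1 hρ.2), withLimit_of_ne hρ.1.1.ne',
      withLimit_of_ne hρ.1.1.ne']
  simp only [Function.comp_apply, h3, leafTraceReversed]

/-- The pillbox limit of the components of the junction conditions along the ridge. -/
theorem tendsto_integral_israelLHS (h : ThinLimitAnsatz N U l V ε g φ n g₀ φ₀ n₀) (hN : 3 ≤ N)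
    (hχ : χ ∈ U) (M₆ M₅ : ℝ) (μ ν : Fin 4) :
    Tendsto (fun ρ => ∫ τ in (-ρ)..ρ,
        israelLHS M₆ M₅ (g ρ) (φ ρ) (n ρ) (gnc χ τ) μ.castSucc ν.castSucc) (𝓝[>] 0)
      (𝓝 (-2 * M₆ ^ 4 * orientedDihedralAngle g₀ φ₀ n₀ χ * cod2Metric g₀ φ₀ χ μ ν
        + M₅ ^ 3 * cod2Jump g₀ φ₀ χ μ ν)) := by
  set S : ℝ → (Fin 5 → ℝ) → ℝ := fun ρ => leafTraceReversed (inducedMetric (g ρ) (φ ρ)) μ ν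
    with hS
  -- The leaf metric multiplying the normal acceleration is replaced by its value at the ridge, so
  -- that it can leave the integral. The replacement costs `o(1)` times the acceleration, which the
  -- integral lemma absorbs.
  let F : ℝ × (Fin 5 → ℝ) → ℝ := fun p =>
    israelLHS M₆ M₅ (g p.1) (φ p.1) (n p.1) p.2 μ.castSucc ν.castSucc
      + 2 * M₆ ^ 4 * cod2Metric g₀ φ₀ χ μ ν * normalAccel (g p.1) (φ p.1) (n p.1) p.2
      - M₅ ^ 3 * pd iτ (S p.1) p.2
  have hF : Tendsto (fun ρ => ∫ τ in (-ρ)..ρ, F (ρ, gnc χ τ)) (𝓝[>] 0) (𝓝 0) := by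
    refine h.tendsto_integral_zero hN hχ fun e he => ?_
    obtain ⟨C, hC⟩ := h.exists_rest_le hN hχ M₆ M₅ μ ν
    refine ⟨C, ?_⟩
    have h1 : Tendsto (fun p => |2 * M₆ ^ 4 * (cod2Metric g₀ φ₀ χ μ ν
        - leafBlock (inducedMetric (g p.1) (φ p.1) p.2) μ ν)|) (ribbon χ) (𝓝 0) := by
      have h2 := ((tendsto_pi_nhds.1 (tendsto_pi_nhds.1 (h.tendsto_ribbon_leafBlock hN hχ) μ)
        ν).const_sub (cod2Metric g₀ φ₀ χ μ ν)).const_mul (2 * M₆ ^ 4)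
      rw [sub_self, mul_zero] at h2
      simpa using h2.abs
    filter_upwards [hC, h1.eventually_lt_const he] with p p1 p2
    rw [Real.norm_eq_abs] at p1
    have e1 : F p = 2 * M₆ ^ 4 * (cod2Metric g₀ φ₀ χ μ ν
        - leafBlock (inducedMetric (g p.1) (φ p.1) p.2) μ ν)
          * normalAccel (g p.1) (φ p.1) (n p.1) p.2
        + (israelLHS M₆ M₅ (g p.1) (φ p.1) (n p.1) p.2 μ.castSucc ν.castSucc
          + 2 * M₆ ^ 4 * (leafBlock (inducedMetric (g p.1) (φ p.1) p.2) μ ν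
            * normalAccel (g p.1) (φ p.1) (n p.1) p.2)
          - M₅ ^ 3 * pd iτ (leafTraceReversed (inducedMetric (g p.1) (φ p.1)) μ ν) p.2) := by
      simp only [F, hS]; ring
    rw [e1]
    refine (abs_add_le _ _).trans (add_le_add ?_ p1)
    rw [abs_mul]
    gcongr
  have hR := h.tendsto_leafTraceReversed hN hχ (Or.inl rfl) tendsto_right_outside μ ν
  have hL := h.tendsto_leafTraceReversed hN hχ (Or.inr rfl) tendsto_left_outside μ ν
  have hlim := (hF.sub ((h.tendsto_integral_accel hN hχ).const_mul
    (2 * M₆ ^ 4 * cod2Metric g₀ φ₀ χ μ ν))).add ((hR.sub hL).const_mul (M₅ ^ 3))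
  have hval : 0 - 2 * M₆ ^ 4 * cod2Metric g₀ φ₀ χ μ ν * orientedDihedralAngle g₀ φ₀ n₀ χ
      + M₅ ^ 3 * (cod2TraceReversed g₀ φ₀ (𝓝[>] 0) χ μ ν
        - cod2TraceReversed g₀ φ₀ (𝓝[<] 0) χ μ ν)
      = -2 * M₆ ^ 4 * orientedDihedralAngle g₀ φ₀ n₀ χ * cod2Metric g₀ φ₀ χ μ ν
        + M₅ ^ 3 * cod2Jump g₀ φ₀ χ μ ν := by
    rw [cod2Jump]; ring
  rw [hval] at hlim
  refine hlim.congr' ?_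
  filter_upwards [Ioo_mem_nhdsGT h.l_pos] with ρ hρ
  have i1 : IntervalIntegrable (fun τ => israelLHS M₆ M₅ (g ρ) (φ ρ) (n ρ) (gnc χ τ) μ.castSucc
      ν.castSucc) MeasureTheory.volume (-ρ) ρ :=
    (continuousOn_line hχ hρ fun x hx =>
      (h.approx_continuousAt hN hρ hx M₆ M₅ μ.castSucc ν.castSucc).2).intervalIntegrable
  have i2 : IntervalIntegrable (fun τ => 2 * M₆ ^ 4 * cod2Metric g₀ φ₀ χ μ ν
      * normalAccel (g ρ) (φ ρ) (n ρ) (gnc χ τ)) MeasureTheory.volume (-ρ) ρ :=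
    ((continuousOn_line hχ hρ fun x hx =>
      h.approx_accel_continuousAt hN hρ hx).intervalIntegrable).const_mul _
  have i3 : IntervalIntegrable (fun τ => pd iτ (S ρ) (gnc χ τ)) MeasureTheory.volume (-ρ) ρ :=
    (continuousOn_line hχ hρ fun x hx => ((h.approx_leafTraceReversed_contDiffAt hN hρ hx μ ν).pd
      (k := 0) iτ).continuousAt).intervalIntegrable
  -- The second derivatives of the induced metric, which may blow up in the ribbon, disappear into
  -- boundary values at its edges.
  have ftc : ∫ τ in (-ρ)..ρ, pd iτ (S ρ) (gnc χ τ) = S ρ (gnc χ ρ) - S ρ (gnc χ (-ρ)) :=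
    intervalIntegral.integral_eq_sub_of_hasDerivAt (f := fun τ => S ρ (gnc χ τ)) (fun τ hτ => by
      rw [uIcc_of_le (by linarith [hρ.1])] at hτ
      exact hasDerivAt_comp_gnc ((h.approx_leafTraceReversed_contDiffAt hN hρ (mem_slab_gnc.2
        ⟨hχ, (abs_le.2 hτ).trans_lt hρ.2⟩) μ ν).differentiableAt (by simp))) i3
  have hsplit : ∫ τ in (-ρ)..ρ, F (ρ, gnc χ τ) = (∫ τ in (-ρ)..ρ, israelLHS M₆ M₅ (g ρ) (φ ρ) (n ρ)
      (gnc χ τ) μ.castSucc ν.castSucc) + 2 * M₆ ^ 4 * cod2Metric g₀ φ₀ χ μ ν *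
        (∫ τ in (-ρ)..ρ, normalAccel (g ρ) (φ ρ) (n ρ) (gnc χ τ))
      - M₅ ^ 3 * (S ρ (gnc χ ρ) - S ρ (gnc χ (-ρ))) := by
    rw [← ftc, ← intervalIntegral.integral_const_mul, ← intervalIntegral.integral_const_mul,
      ← intervalIntegral.integral_add i1 i2, ← intervalIntegral.integral_sub (i1.add i2)
        (i3.const_mul _)]
  rw [hsplit]
  ring

end ThinLimitAnsatz

end

/-! ### Mirror symmetry and the codimension-2 junction conditions -/

noncomputable section

theorem traceReversed_neg {m : ℕ} (h K : Fin m → Fin m → ℝ) (a b : Fin m) :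
    traceReversed h (-K) a b = -traceReversed h K a b := by
  simp only [traceReversed, Pi.neg_apply, mul_neg, Finset.sum_neg_distrib]
  ring

namespace ThinLimitAnsatz

variable {N : ℕ} {U : Set (Fin 4 → ℝ)} {l : ℝ} {V : Set (Fin 6 → ℝ)} {ε : ℝ}
  {g : ℝ → MetricField 6} {φ n : ℝ → (Fin 5 → ℝ) → (Fin 6 → ℝ)}
  {g₀ : MetricField 6} {φ₀ n₀ : (Fin 5 → ℝ) → (Fin 6 → ℝ)} {χ : Fin 4 → ℝ}

theorem leafCurvature_limit (h : ThinLimitAnsatz N U l V ε g φ n g₀ φ₀ n₀) (hN : 3 ≤ N)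
    (hχ : χ ∈ U) {τ : ℝ} (hτ : |τ| < l) (hτ0 : τ ≠ 0) (μ ν : Fin 4) :
    leafCurvature g₀ φ₀ χ τ μ ν
      = -(1 / 2) * deriv (fun s => inducedMetric g₀ (leaf φ₀ s) χ μ ν) τ := by
  have h1 := h.leafCurvature_eq hN (ρ := 0) (χ := χ) (τ := τ)
    ⟨mem_slab_gnc.2 ⟨hχ, hτ⟩, le_rfl, h.l_pos, fun _ => by simpa [gnc] using hτ0⟩ μ ν
  rw [withLimit_zero, withLimit_zero] at h1
  rw [h1, leafDeriv, pd_last]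
  simp only [← leafMetric_inducedMetric]
  rfl

/-- The extrinsic curvature of the leaves of a mirror symmetric brane is odd. -/
theorem cod2Curvature_left_of_even (h : ThinLimitAnsatz N U l V ε g φ n g₀ φ₀ n₀) (hN : 3 ≤ N)
    (hχ : χ ∈ U) (hs : ∀ τ, |τ| < l →
      inducedMetric g₀ (leaf φ₀ (-τ)) χ = inducedMetric g₀ (leaf φ₀ τ) χ) :
    cod2Curvature g₀ φ₀ (𝓝[<] 0) χ = -cod2Curvature g₀ φ₀ (𝓝[>] 0) χ := by
  have hL := (h.tendsto_sides hN hχ (Or.inr rfl)).2.2.comp tendsto_neg_side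
  have hR := (h.tendsto_sides hN hχ (Or.inl rfl)).2.2.neg
  refine tendsto_nhds_unique (hL.congr' ?_) hR
  filter_upwards [Ioo_mem_nhdsGT h.l_pos] with τ hτ
  have hτl : |τ| < l := by rw [abs_of_pos hτ.1]; exact hτ.2
  funext μ ν
  have he : (fun s => inducedMetric g₀ (leaf φ₀ (-s)) χ μ ν)
      =ᶠ[𝓝 τ] fun s => inducedMetric g₀ (leaf φ₀ s) χ μ ν := by
    filter_upwards [(isOpen_lt continuous_abs continuous_const).mem_nhds hτl] with s hsl
    rw [hs s hsl]
  -- The derivative of an even function is odd; evenness is only known on `(-l, l)`, hence the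
  -- passage through a neighbourhood of `τ`.
  have h1 := deriv_comp_neg (fun s => inducedMetric g₀ (leaf φ₀ s) χ μ ν) τ
  rw [he.deriv_eq] at h1
  rw [Function.comp_apply, Pi.neg_apply, Pi.neg_apply,
    h.leafCurvature_limit hN hχ (by rwa [abs_neg]) (neg_ne_zero.2 hτ.1.ne'),
    h.leafCurvature_limit hN hχ hτl hτ.1.ne', h1]
  ring

theorem cod2Jump_of_even (h : ThinLimitAnsatz N U l V ε g φ n g₀ φ₀ n₀) (hN : 3 ≤ N)
    (hχ : χ ∈ U) (hs : ∀ τ, |τ| < l →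
      inducedMetric g₀ (leaf φ₀ (-τ)) χ = inducedMetric g₀ (leaf φ₀ τ) χ) (μ ν : Fin 4) :
    cod2Jump g₀ φ₀ χ μ ν = 2 * cod2TraceReversed g₀ φ₀ (𝓝[>] 0) χ μ ν := by
  rw [cod2Jump, cod2TraceReversed, cod2TraceReversed, h.cod2Curvature_left_of_even hN hχ hs,
    traceReversed_neg]
  ring

/-- A fixed point off the ridge lies outside all sufficiently thin ribbons, so the converging
sequence is eventually zero. -/
theorem israelLHS_limit_eq_zero (h : ThinLimitAnsatz N U l V ε g φ n g₀ φ₀ n₀) (hN : 3 ≤ N)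
    {M₆ M₅ : ℝ} {a b : Fin 5} {x : Fin 5 → ℝ} (hx : x ∈ slab U l) (hx0 : x iτ ≠ 0)
    (h0 : ∀ ρ ∈ Ioo 0 l, ρ < |x iτ| → israelLHS M₆ M₅ (g ρ) (φ ρ) (n ρ) x a b = 0) :
    israelLHS M₆ M₅ g₀ φ₀ n₀ x a b = 0 := by
  refine tendsto_nhds_unique ((h.tendsto_israelLHS hN hx hx0 M₆ M₅ a b).congr' ?_)
    tendsto_const_nhds
  filter_upwards [Ioo_mem_nhdsGT h.l_pos, Ioo_mem_nhdsGT (abs_pos.2 hx0)] with ρ h1 h2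
  exact h0 ρ h1 h2.2

/-- The integrated source does not depend on `ρ`, so uniqueness of limits equates it with the
pillbox limit. -/
theorem junction_of_integral_source (h : ThinLimitAnsatz N U l V ε g φ n g₀ φ₀ n₀) (hN : 3 ≤ N)
    (hχ : χ ∈ U) {M₆ M₅ c : ℝ} {T : ℝ → (Fin 5 → ℝ) → Fin 5 → Fin 5 → ℝ} {μ ν : Fin 4}
    (hT : ∀ ρ ∈ Ioo 0 l, ∀ x ∈ slab U l, ∀ a b,
      israelLHS M₆ M₅ (g ρ) (φ ρ) (n ρ) x a b = T ρ x a b)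
    (hc : ∀ ρ ∈ Ioo 0 l, ∫ τ in (-ρ)..ρ, T ρ (gnc χ τ) μ.castSucc ν.castSucc = c) :
    -2 * M₆ ^ 4 * orientedDihedralAngle g₀ φ₀ n₀ χ * cod2Metric g₀ φ₀ χ μ ν
      + M₅ ^ 3 * cod2Jump g₀ φ₀ χ μ ν = c := by
  refine tendsto_nhds_unique ((h.tendsto_integral_israelLHS hN hχ M₆ M₅ μ ν).congr' ?_)
    tendsto_const_nhds
  filter_upwards [Ioo_mem_nhdsGT h.l_pos] with ρ hρ
  rw [← hc ρ hρ]
  refine intervalIntegral.integral_congr fun τ hτ => ?_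
  rw [uIcc_of_le (by linarith [hρ.1])] at hτ
  exact hT ρ hρ _ (mem_slab_gnc.2 ⟨hχ, (abs_le.2 hτ).trans_lt hρ.2⟩) _ _

end ThinLimitAnsatz

end

theorem mainTheorem1 (N : ℕ) (hN : 3 ≤ N) (U : Set (Fin 4 → ℝ)) (l : ℝ) (V : Set (Fin 6 → ℝ))
    (ε M₆ M₅ : ℝ)
    (g : ℝ → MetricField 6) (φ n : ℝ → (Fin 5 → ℝ) → (Fin 6 → ℝ))
    (g₀ : MetricField 6) (φ₀ n₀ : (Fin 5 → ℝ) → (Fin 6 → ℝ))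
    (h : ThinLimitAnsatz N U l V ε g φ n g₀ φ₀ n₀) :
    -- the one-sided limits at the codimension-2 brane exist
    (∀ χ ∈ U, ∀ F : Filter ℝ, F = 𝓝[>] 0 ∨ F = 𝓝[<] 0 →
      Tendsto (fun τ => pd iτ φ₀ (gnc χ τ)) F (𝓝 (tangentSide φ₀ F χ)) ∧
      Tendsto (fun τ => n₀ (gnc χ τ)) F (𝓝 (normalSide n₀ F χ)) ∧
      Tendsto (fun τ => leafCurvature g₀ φ₀ χ τ) F (𝓝 (cod2Curvature g₀ φ₀ F χ))) ∧
    -- the deficit angle is twice the oriented dihedral angle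
    (∀ χ ∈ U, deficitAngle φ₀ n₀ χ = 2 * orientedDihedralAngle g₀ φ₀ n₀ χ) ∧
    -- the pillbox limit of the 4D components of the left-hand side of the junction conditions
    (∀ χ ∈ U, ∀ μ ν : Fin 4,
      Tendsto (fun ρ => ∫ τ in (-ρ)..ρ,
          israelLHS M₆ M₅ (g ρ) (φ ρ) (n ρ) (gnc χ τ) μ.castSucc ν.castSucc) (𝓝[>] 0)
        (𝓝 (-2 * M₆ ^ 4 * orientedDihedralAngle g₀ φ₀ n₀ χ * cod2Metric g₀ φ₀ χ μ ν
          + M₅ ^ 3 * cod2Jump g₀ φ₀ χ μ ν))) ∧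
    -- the limit metric solves the Einstein equations wherever the approximating metrics do
    (∀ X ∈ V, (∀ᶠ ρ in 𝓝[>] 0, ∀ A B, einstein (g ρ) X A B = 0) →
      ∀ A B, einstein g₀ X A B = 0) ∧
    -- consequences of the Israel junction conditions with sources supported in the ribbons
    (∀ T : ℝ → (Fin 5 → ℝ) → Fin 5 → Fin 5 → ℝ,
      (∀ ρ ∈ Ioo 0 l, ∀ x ∈ slab U l, ∀ a b,
        israelLHS M₆ M₅ (g ρ) (φ ρ) (n ρ) x a b = T ρ x a b) →
      (∀ ρ ∈ Ioo 0 l, ∀ x ∈ slab U l, ρ < |x iτ| → ∀ a b, T ρ x a b = 0) →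
      -- source-free junction conditions away from the codimension-2 brane
      (∀ x ∈ slab U l, x iτ ≠ 0 → ∀ a b, israelLHS M₆ M₅ g₀ φ₀ n₀ x a b = 0) ∧
      -- codimension-2 junction conditions
      (∀ Tbar : (Fin 4 → ℝ) → Fin 4 → Fin 4 → ℝ,
        (∀ ρ ∈ Ioo 0 l, ∀ χ ∈ U, ∀ μ ν : Fin 4,
          ∫ τ in (-ρ)..ρ, T ρ (gnc χ τ) μ.castSucc ν.castSucc = Tbar χ μ ν) →
        ∀ χ ∈ U, ∀ μ ν : Fin 4,
          -2 * M₆ ^ 4 * orientedDihedralAngle g₀ φ₀ n₀ χ * cod2Metric g₀ φ₀ χ μ ν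
              + M₅ ^ 3 * cod2Jump g₀ φ₀ χ μ ν = Tbar χ μ ν ∧
          -M₆ ^ 4 * deficitAngle φ₀ n₀ χ * cod2Metric g₀ φ₀ χ μ ν
              + M₅ ^ 3 * cod2Jump g₀ φ₀ χ μ ν = Tbar χ μ ν) ∧
      -- codimension-2 junction conditions with 4D induced gravity, first without and then with
      -- mirror symmetry of the codimension-1 brane
      (∀ (M₄ : ℝ) (Tbar : (Fin 4 → ℝ) → Fin 4 → Fin 4 → ℝ),
        (∀ ρ ∈ Ioo 0 l, ∀ χ ∈ U, ∀ μ ν : Fin 4,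
          ∫ τ in (-ρ)..ρ, T ρ (gnc χ τ) μ.castSucc ν.castSucc
            = Tbar χ μ ν - M₄ ^ 2 * einstein (cod2Metric g₀ φ₀) χ μ ν) →
        (∀ χ ∈ U, ∀ μ ν : Fin 4,
          -M₆ ^ 4 * deficitAngle φ₀ n₀ χ * cod2Metric g₀ φ₀ χ μ ν
              + M₅ ^ 3 * cod2Jump g₀ φ₀ χ μ ν
              + M₄ ^ 2 * einstein (cod2Metric g₀ φ₀) χ μ ν = Tbar χ μ ν) ∧
        ((∀ χ ∈ U, ∀ τ, |τ| < l →
            inducedMetric g₀ (leaf φ₀ (-τ)) χ = inducedMetric g₀ (leaf φ₀ τ) χ) →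
          ∀ χ ∈ U, ∀ μ ν : Fin 4,
            -M₆ ^ 4 * deficitAngle φ₀ n₀ χ * cod2Metric g₀ φ₀ χ μ ν
                + 2 * M₅ ^ 3 * cod2TraceReversed g₀ φ₀ (𝓝[>] 0) χ μ ν
                + M₄ ^ 2 * einstein (cod2Metric g₀ φ₀) χ μ ν = Tbar χ μ ν))) := by
  refine ⟨fun χ hχ F hF => h.tendsto_sides hN hχ hF, fun χ hχ => h.deficitAngle_eq hN hχ,
    fun χ hχ μ ν => h.tendsto_integral_israelLHS hN hχ M₆ M₅ μ ν,
    fun X hX h0 A B => h.einstein_eq_zero hN hX h0 A B, fun T hT hT0 =>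
      ⟨fun x hx hx0 a b => h.israelLHS_limit_eq_zero hN hx hx0 fun ρ hρ hρx => by
        rw [hT ρ hρ x hx, hT0 ρ hρ x hx hρx], fun Tbar hTbar χ hχ μ ν => ?_,
      fun M₄ Tbar hTbar => ?_⟩⟩
  · have h1 := h.junction_of_integral_source hN hχ hT fun ρ hρ => hTbar ρ hρ χ hχ μ ν
    refine ⟨h1, ?_⟩
    rw [h.deficitAngle_eq hN hχ, ← h1]
    ring
  · have hcas : ∀ χ ∈ U, ∀ μ ν : Fin 4,
        -M₆ ^ 4 * deficitAngle φ₀ n₀ χ * cod2Metric g₀ φ₀ χ μ ν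
          + M₅ ^ 3 * cod2Jump g₀ φ₀ χ μ ν
          + M₄ ^ 2 * einstein (cod2Metric g₀ φ₀) χ μ ν = Tbar χ μ ν := fun χ hχ μ ν => by
      have h1 := h.junction_of_integral_source hN hχ hT fun ρ hρ => hTbar ρ hρ χ hχ μ ν
      rw [h.deficitAngle_eq hN hχ]
      linear_combination h1
    refine ⟨hcas, fun hs χ hχ μ ν => ?_⟩
    rw [← hcas χ hχ μ ν, h.cod2Jump_of_even hN hχ fun τ hτ => hs χ hχ τ hτ]
    ring
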